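/- **Setting.** Let $p$ be a prime and let $\mathcal O$ be either a complete discrete valuation ring with residue field $k$ of characteristic $p$, or a field $\mathcal O=k$ of characteristic $p$. Let $K$ be a normal subgroup of a finite group $H$ and $G=H/K$. Let $A_1$ be a $K$-interior $H$-algebra over $\mathcal O$, finitely generated as an $\mathcal O$-module: $H$ acts on the unital $\mathcal O$-algebra $A_1$ by algebra automorphisms, and there is an $H$-equivariant group homomorphism $K\to A_1^*$ that induces the action of $K$ on $A_1$. Let $A=A_1\otimes_{\mathcal OK}\mathcal OH=\bigoplus_{\sigma\in G}A_\sigma$, $A_\sigma=A_1\otimes x$ for $x\in\sigma$, with $(a\otimes x)(c\otimes y)=a\,({}^xc)\otimes xy$; $H$ acts on $A$ by conjugation with the elements $1\otimes h$. Let $b$ be a primitive idempotent of $A_1^K$ that lies in $Z(A_1)$; identify $b$ with $b\otimes1\in A$. Let $P\le K$ be a defect group of $b$, that is, $b\in (A_1)^K_P=\mathrm{Tr}_P^K(A_1^P)$ and $\mathrm{Br}_P(b)\ne0$. Here, for an $H$-algebra $B$ over $\mathcal O$, $B(P)=k\otimes_{\mathcal O}\bigl(B^P/\sum_{Q<P}B^P_Q\bigr)$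 is the Brauer quotient, an $N_H(P)$-algebra, and $\mathrm{Br}_P:B^P\to B(P)$ is the projection. Let $\bar b=\mathrm{Br}_P(b)$. The algebra $A(P)$ is $G$-graded with $A(P)_\sigma=\mathrm{Br}_P(A_\sigma^P)$ and $A(P)_1\cong A_1(P)$. Let $R=\bigoplus_{\tau\in C_H(P)/C_K(P)}R_\tau$, $R_\tau=A_1(P)\otimes x$ for $x\in\tau$, be the algebra constructed in the same way from the $C_K(P)$-interior $C_H(P)$-algebra $A_1(P)$; $N_H(P)$ acts on $R$ by ${}^n(a\otimes x)={}^na\otimes nxn^{-1}$, and $\bar b$ is identified with $\bar b\otimes 1\in R$. A subscript $b$ or $\bar b$ on a group denotes the stabilizer of that element. **The three extensions.** Put $C_\sigma=b(A_\sigma)^K$ and $E_\sigma=\bar b A(P)_\sigma^{N_K(P)}$ for $\sigma\in G_b$, and $D_\tau=\bar b (R_\tau)^{N_K(P)}$ for $\tau\in C_H(P)_{\bar b}/C_K(P)$. Let $$G[b]=\{\sigma\in G_b: C_\sigma C_{\sigma^{-1}}=C_1\},\qquad G[\bar b]=\{\sigma\in G_b: E_\sigma E_{\sigma^{-1}}=E_1\},$$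 $$\overline{N_H(P)}[\bar b]=\{\sigma\in N_H(P)_bK/K: E_\sigma E_{\sigma^{-1}}=E_1\},\qquad \overline{C_H(P)}[\bar b]=\{\tau\in C_H(P)_{\bar b}/C_K(P): D_\tau D_{\tau^{-1}}=D_1\},$$ and let $C=\bigoplus_{\sigma\in G[b]}C_\sigma$, $D=\bigoplus_{\tau\in\overline{C_H(P)}[\bar b]}D_\tau$, $E=\bigoplus_{\sigma\in G[\bar b]}E_\sigma$ (with identity elements $b,\bar b,\bar b$). For $X\in\{C,D,E\}$ put $\bar X_1=X_1/J(X_1)$ and $\bar X=X/XJ(X_1)$, where $J$ is the Jacobson radical, and let $\mathrm{hU}(\bar X)$ be the group of homogeneous units of $\bar X$. The extensions are $$(1)\ \ 1\to \bar C_1^*\to \mathrm{hU}(\bar C)\to G[b]\to1,\qquad (2)\ \ 1\to \bar D_1^*\to \mathrm{hU}(\bar D)\to \overline{C_H(P)}[\bar b]\to1,\qquad (3)\ \ 1\to \bar E_1^*\to \mathrm{hU}(\bar E)\to G[\bar b]\to1 .$$ $H_b$ acts on (1) by conjugation, $K$ acting trivially, so $G_b$ acts; $N_H(P)_b$ acts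 on (2) and (3). **Theorem.** The subsets $G[b]$, $G[\bar b]$, $\overline{N_H(P)}[\bar b]$, $\overline{C_H(P)}[\bar b]$ are subgroups, the three sequences are exact, and the following hold. 1. $G_b=N_H(P)_bK/K=N_H(P)_{\bar b}K/K$; moreover $N_H(P)_b=N_H(P)_{\bar b}$. 2. $G[b]=G[\bar b]=\overline{N_H(P)}[\bar b]$. 3. The extensions (1) and (3) are isomorphic. 4. The isomorphism in 3 can be chosen compatible with the identity map $G[b]\to G[\bar b]=\overline{N_H(P)}[\bar b]$ and with the actions of $G_b\cong N_H(P)_{\bar b}/N_K(P)$ on the two extensions: if $h\in H_b$ and $n\in N_H(P)_b$ have the same image in $G_b$, it carries the action of $h$ on (1) to the action of $n$ on (3). It can moreover be chosen to be induced by an isomorphism $\bar C\to\bar E$ of graded $\mathcal O$-algebras that is compatible with these actions in the same sense. 5. The natural homomorphism $C_H(P)/C_K(P)\to G$ is injective and maps $\overline{C_H(P)}[\bar b]$ into $G[b]$, and there is a monomorphism of extensions from (2) into (3) (all three vertical maps are injective) that is compatible with the monomorphism $\overline{C_H(P)}[\bar b]\to G[b]=G[\bar b]$ and with the action of $G_b$: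 if $n,n'\in N_H(P)_b$ have the same image in $G_b$, it carries the action of $n$ on (2) to the action of $n'$ on (3). It can moreover be chosen to be induced by an injective homomorphism of graded $\mathcal O$-algebras $\bar D\to\bar E$ that is compatible with these actions in the same sense. -/

import Mathlib

/-!
Conventions. All actions are left actions: the right action `a ↦ a^h` of an `H`-algebra is
`a ↦ act h⁻¹ a`. An action of a group `L` on an `O`-algebra `B` is a homomorphism from `L` to the
monoid of `O`-algebra endomorphisms of `B`.
-/

namespace BlockExt

/-- A family of submodules `grad σ = B_σ` of an `O`-algebra `B`, multiplicative in `σ : Γ`, together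
with a subalgebra `fix`, an idempotent `e ∈ grad 1 ∩ fix` that commutes with the elements of degree in
a subgroup `base` of `Γ`, and a group `Λ` that acts on `B` and on `Γ`, compatibly with all of this.
The three Clifford extensions below are obtained from three such data by one and the same
construction. -/
structure CliffordDatum (O Γ Λ B : Type*) [CommRing O] [Group Γ] [Group Λ] [Ring B]
    [Algebra O B] where
  grad : Γ → Submodule O B
  mul_mem_grad : ∀ {σ τ : Γ} {x y : B}, x ∈ grad σ → y ∈ grad τ → x * y ∈ grad (σ * τ)
  fix : Subalgebra O B
  e : B
  e_mem_grad : e ∈ grad 1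
  e_mem_fix : e ∈ fix
  e_mul_e : e * e = e
  base : Subgroup Γ
  e_comm : ∀ {σ : Γ} {x : B}, σ ∈ base → x ∈ grad σ → e * x = x * e
  actB : Λ →* (B →ₐ[O] B)
  actΓ : Λ →* Monoid.End Γ
  act_grad : ∀ (l : Λ) {σ : Γ} {x : B}, x ∈ grad σ → actB l x ∈ grad (actΓ l σ)
  act_fix : ∀ (l : Λ) {x : B}, x ∈ fix → actB l x ∈ fix
  act_e : ∀ l : Λ, actB l e = e
  act_base : ∀ (l : Λ) {σ : Γ}, σ ∈ base → actΓ l σ ∈ base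

namespace CliffordDatum

variable {O Γ Λ B : Type*} [CommRing O] [Group Γ] [Group Λ] [Ring B] [Algebra O B]
  (S : CliffordDatum O Γ Λ B)

/-- The component `e · (B_σ ∩ fix)` of degree `σ`. -/
def comp (σ : Γ) : Submodule O B :=
  (S.grad σ ⊓ Subalgebra.toSubmodule S.fix).map (LinearMap.mulLeft O S.e)

variable {S}

theorem mem_comp {σ : Γ} {x : B} :
    x ∈ S.comp σ ↔ ∃ y, y ∈ S.grad σ ∧ y ∈ S.fix ∧ S.e * y = x := by
  simp [comp, Submodule.mem_map, and_assoc]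

theorem e_mul {σ : Γ} {x : B} (hx : x ∈ S.comp σ) : S.e * x = x := by
  obtain ⟨y, -, -, rfl⟩ := mem_comp.1 hx
  rw [← mul_assoc, S.e_mul_e]

theorem comp_grad {σ : Γ} {x : B} (hx : x ∈ S.comp σ) : x ∈ S.grad σ := by
  obtain ⟨y, hy, -, rfl⟩ := mem_comp.1 hx
  simpa using S.mul_mem_grad S.e_mem_grad hy

theorem comp_fix {σ : Γ} {x : B} (hx : x ∈ S.comp σ) : x ∈ S.fix := by
  obtain ⟨y, -, hy, rfl⟩ := mem_comp.1 hx
  exact S.fix.mul_mem S.e_mem_fix hy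

theorem mul_e {σ : Γ} (hσ : σ ∈ S.base) {x : B} (hx : x ∈ S.comp σ) : x * S.e = x := by
  rw [← S.e_comm hσ (comp_grad hx), e_mul hx]

theorem mul_mem_comp {σ τ : Γ} {x y : B} (hx : x ∈ S.comp σ) (hy : y ∈ S.comp τ) :
    x * y ∈ S.comp (σ * τ) :=
  mem_comp.2 ⟨x * y, S.mul_mem_grad (comp_grad hx) (comp_grad hy),
    S.fix.mul_mem (comp_fix hx) (comp_fix hy), by rw [← mul_assoc, e_mul hx]⟩

variable (S) in
theorem e_mem_comp : S.e ∈ S.comp 1 :=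
  mem_comp.2 ⟨S.e, S.e_mem_grad, S.e_mem_fix, S.e_mul_e⟩

theorem act_comp (l : Λ) {σ : Γ} {x : B} (hx : x ∈ S.comp σ) :
    S.actB l x ∈ S.comp (S.actΓ l σ) := by
  obtain ⟨y, hy, hy', rfl⟩ := mem_comp.1 hx
  exact mem_comp.2 ⟨S.actB l y, S.act_grad l hy, S.act_fix l hy', by rw [map_mul, S.act_e]⟩

theorem comp_mul_comp_le (σ τ : Γ) : S.comp σ * S.comp τ ≤ S.comp (σ * τ) :=
  Submodule.mul_le.2 fun _ hx _ hy => mul_mem_comp hx hy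

theorem comp_mul_comp_inv_iff {σ : Γ} :
    S.comp σ * S.comp σ⁻¹ = S.comp 1 ↔ S.e ∈ S.comp σ * S.comp σ⁻¹ := by
  refine ⟨fun h => h ▸ S.e_mem_comp, fun h => le_antisymm ?_ fun x hx => ?_⟩
  · simpa using comp_mul_comp_le (S := S) σ σ⁻¹
  · have h1 : x * S.e ∈ S.comp 1 * (S.comp σ * S.comp σ⁻¹) := Submodule.mul_mem_mul hx h
    rw [mul_e S.base.one_mem hx, ← mul_assoc] at h1
    have h2 : S.comp 1 * S.comp σ ≤ S.comp σ := by
      simpa using comp_mul_comp_le (S := S) 1 σ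
    exact (mul_le_mul' h2 le_rfl :
      S.comp 1 * S.comp σ * S.comp σ⁻¹ ≤ S.comp σ * S.comp σ⁻¹) h1

theorem strong_mul {σ τ : Γ} (hσb : σ ∈ S.base)
    (hσ : S.comp σ * S.comp σ⁻¹ = S.comp 1) (hτ : S.comp τ * S.comp τ⁻¹ = S.comp 1) :
    S.comp (σ * τ) * S.comp (σ * τ)⁻¹ = S.comp 1 := by
  rw [comp_mul_comp_inv_iff]
  have h1 : S.comp σ ≤ S.comp σ * S.comp 1 := fun x hx => by
    simpa [mul_e hσb hx] using Submodule.mul_mem_mul hx S.e_mem_comp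
  have h2 : S.comp σ * S.comp σ⁻¹ ≤ S.comp (σ * τ) * S.comp (σ * τ)⁻¹ := by
    refine (mul_le_mul' h1 le_rfl).trans ?_
    rw [← hτ, ← mul_assoc, mul_assoc, mul_inv_rev]
    exact mul_le_mul' (comp_mul_comp_le _ _) (comp_mul_comp_le _ _)
  exact h2 (hσ ▸ S.e_mem_comp)

variable (S) [Finite Γ]

/-- The subgroup `{σ ∈ base | C_σ C_{σ⁻¹} = C_1}`, where `C_σ = e (B_σ ∩ fix)`. -/
def strong : Subgroup Γ where
  carrier := {σ | σ ∈ S.base ∧ S.comp σ * S.comp σ⁻¹ = S.comp 1}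
  one_mem' := ⟨S.base.one_mem, by
    rw [comp_mul_comp_inv_iff]
    simpa [S.e_mul_e] using Submodule.mul_mem_mul S.e_mem_comp S.e_mem_comp⟩
  mul_mem' := fun hσ hτ => ⟨S.base.mul_mem hσ.1 hτ.1, strong_mul hσ.1 hσ.2 hτ.2⟩
  inv_mem' := fun {σ} hσ => by
    have key : ∀ n : ℕ, σ ^ n ∈ S.base ∧ S.comp (σ ^ n) * S.comp (σ ^ n)⁻¹ = S.comp 1 := by
      intro n
      induction n with
      | zero =>
        refine ⟨by simp, ?_⟩
        rw [comp_mul_comp_inv_iff]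
        simpa [S.e_mul_e] using Submodule.mul_mem_mul S.e_mem_comp S.e_mem_comp
      | succ n ih =>
        rw [pow_succ]
        exact ⟨S.base.mul_mem ih.1 hσ.1, strong_mul ih.1 ih.2 hσ.2⟩
    have h := key (Nat.card Γ - 1)
    have : σ ^ (Nat.card Γ - 1) = σ⁻¹ := by
      rw [eq_inv_iff_mul_eq_one, ← pow_succ, Nat.sub_add_cancel Nat.card_pos, pow_card_eq_one']
    rw [this] at h
    exact h

variable {S} in
theorem mem_strong {σ : Γ} :
    σ ∈ S.strong ↔ σ ∈ S.base ∧ S.comp σ * S.comp σ⁻¹ = S.comp 1 := Iff.rfl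

variable {S} in
theorem act_strong (l : Λ) {σ : Γ} (hσ : σ ∈ S.strong) : S.actΓ l σ ∈ S.strong := by
  refine ⟨S.act_base l hσ.1, ?_⟩
  rw [comp_mul_comp_inv_iff]
  have h : S.e ∈ S.comp σ * S.comp σ⁻¹ := comp_mul_comp_inv_iff.1 hσ.2
  have h1 := Submodule.mem_map_of_mem (f := (S.actB l).toLinearMap) h
  rw [Submodule.map_mul] at h1
  rw [← S.act_e l]
  have h2 : (S.comp σ).map (S.actB l).toLinearMap ≤ S.comp (S.actΓ l σ) := by
    rintro _ ⟨x, hx, rfl⟩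
    exact act_comp l hx
  have h3 : (S.comp σ⁻¹).map (S.actB l).toLinearMap ≤ S.comp (S.actΓ l σ)⁻¹ := by
    rintro _ ⟨x, hx, rfl⟩
    rw [← map_inv]
    exact act_comp l hx
  exact (mul_le_mul' h2 h3 : _ ≤ S.comp (S.actΓ l σ) * S.comp (S.actΓ l σ)⁻¹) h1

/-- The sum of the components of degree in the subgroup `strong`, as a subring of `B` whose identity
element is `e`. -/
def sub : NonUnitalSubalgebra O B where
  __ := ⨆ σ : S.strong, S.comp σ
  mul_mem' := by
    intro x y hx hy
    have h := Submodule.mul_mem_mul hx hy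
    refine (?_ : (⨆ σ : S.strong, S.comp σ) * (⨆ σ : S.strong, S.comp σ) ≤ _) h
    rw [Submodule.iSup_mul]
    refine iSup_le fun σ => ?_
    rw [Submodule.mul_iSup]
    refine iSup_le fun τ => ?_
    exact (comp_mul_comp_le _ _).trans (le_iSup (fun σ : S.strong => S.comp σ) (σ * τ))

/-- The strongly graded algebra `C = ⨁ C_σ`, `σ ∈ strong`, with identity element `e`. -/
def C : Type _ := ↥S.sub

variable {S} in
theorem comp_le_sub {σ : Γ} (hσ : σ ∈ S.strong) {x : B} (hx : x ∈ S.comp σ) : x ∈ S.sub :=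
  (le_iSup (fun σ : S.strong => S.comp σ) ⟨σ, hσ⟩ :) hx

variable {S} in
theorem sub_induction {p : B → Prop} {x : B} (hx : x ∈ S.sub)
    (mem : ∀ σ ∈ S.strong, ∀ y ∈ S.comp σ, p y) (zero : p 0)
    (add : ∀ y z, p y → p z → p (y + z)) : p x :=
  Submodule.iSup_induction (fun σ : S.strong => S.comp σ) (motive := p)
    (show x ∈ ⨆ σ : S.strong, S.comp σ from hx) (fun σ y hy => mem σ σ.2 y hy) zero add

variable {S} in
theorem e_mul_sub {x : B} (hx : x ∈ S.sub) : S.e * x = x :=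
  sub_induction (p := fun x => S.e * x = x) hx (fun _ _ _ hy => e_mul hy) (mul_zero _) fun y z hy hz => by
    rw [mul_add, hy, hz]

variable {S} in
theorem sub_mul_e {x : B} (hx : x ∈ S.sub) : x * S.e = x :=
  sub_induction (p := fun x => x * S.e = x) hx (fun _ hσ _ hy => mul_e hσ.1 hy) (zero_mul _) fun y z hy hz => by
    rw [add_mul, hy, hz]

instance : NonUnitalRing S.C := inferInstanceAs (NonUnitalRing ↥S.sub)

instance : Module O S.C := inferInstanceAs (Module O ↥S.sub)

instance : Ring S.C where
  __ := (inferInstance : NonUnitalRing S.C)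
  one := (⟨S.e, comp_le_sub S.strong.one_mem S.e_mem_comp⟩ : ↥S.sub)
  one_mul x := Subtype.ext (e_mul_sub (Subtype.prop (p := (· ∈ S.sub)) x))
  mul_one x := Subtype.ext (sub_mul_e (Subtype.prop (p := (· ∈ S.sub)) x))

instance : Algebra O S.C :=
  Algebra.ofModule (fun r x y => Subtype.ext (smul_mul_assoc r (x : ↥S.sub).1 (y : ↥S.sub).1))
    (fun r x y => Subtype.ext (mul_smul_comm r (x : ↥S.sub).1 (y : ↥S.sub).1))

/-- The inclusion of `C` into `B`. -/
def val : S.C →ₗ[O] B := Submodule.subtype S.sub.toSubmodule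

theorem val_injective : Function.Injective S.val := Subtype.val_injective

theorem val_mul (x y : S.C) : S.val (x * y) = S.val x * S.val y := rfl

theorem val_one : S.val 1 = S.e := rfl

theorem val_mem (x : S.C) : S.val x ∈ S.sub := Subtype.prop (p := (· ∈ S.sub)) x

/-- The component `C_σ` as a submodule of `C`. -/
def Ccomp (σ : Γ) : Submodule O S.C := (S.comp σ).comap S.val

/-- The identity component `C_1`. -/
def C₁ : Subalgebra O S.C where
  __ := S.Ccomp 1
  mul_mem' := fun {x y} hx hy => by
    have := mul_mem_comp (S := S) (σ := 1) (τ := 1) (x := S.val x) (y := S.val y) hx hy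
    rw [mul_one] at this
    exact this
  algebraMap_mem' := fun r => by
    rw [Algebra.algebraMap_eq_smul_one]
    exact (S.Ccomp 1).smul_mem r S.e_mem_comp

/-- The two-sided ideal of `C` generated by the Jacobson radical `J(C_1)`. As `C` is strongly graded,
`C J(C_1)` is two-sided, so this is `C J(C_1)`. -/
def radIdeal : Ideal S.C :=
  (TwoSidedIdeal.span (Subtype.val '' (Ring.jacobson S.C₁ : Set S.C₁))).asIdeal

instance : S.radIdeal.IsTwoSided := by unfold radIdeal; infer_instance

/-- The quotient `C̄ = C / C J(C_1)`. -/
def Cbar : Type _ := S.C ⧸ S.radIdeal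

instance : Ring S.Cbar := inferInstanceAs (Ring (S.C ⧸ S.radIdeal))

instance : Algebra O S.Cbar := inferInstanceAs (Algebra O (S.C ⧸ S.radIdeal))

/-- The projection `C → C̄`. -/
def proj : S.C →ₐ[O] S.Cbar := Ideal.Quotient.mkₐ O S.radIdeal

theorem proj_surjective : Function.Surjective S.proj := Ideal.Quotient.mk_surjective

theorem proj_eq_zero {x : S.C} : S.proj x = 0 ↔ x ∈ S.radIdeal := Ideal.Quotient.eq_zero_iff_mem

/-- The component `C̄_σ`, the image of `C_σ`. -/
def CbarComp (σ : Γ) : Submodule O S.Cbar := (S.Ccomp σ).map S.proj.toLinearMap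

/-- `C̄_1 = C_1 / J(C_1)`. -/
def Cbar₁ : Type _ := S.C₁ ⧸ Ring.jacobson S.C₁

instance : Ring S.Cbar₁ := inferInstanceAs (Ring (S.C₁ ⧸ Ring.jacobson S.C₁))

instance : Algebra O S.Cbar₁ := inferInstanceAs (Algebra O (S.C₁ ⧸ Ring.jacobson S.C₁))

/-- The canonical map `C̄_1 = C_1 / J(C_1) → C̄`. -/
def Cbar₁Map : S.Cbar₁ →ₐ[O] S.Cbar :=
  Ideal.Quotient.liftₐ (Ring.jacobson S.C₁) (S.proj.comp S.C₁.val) fun a ha => by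
    refine S.proj_eq_zero.2 ?_
    exact TwoSidedIdeal.subset_span ⟨a, ha, rfl⟩

theorem Cbar₁Map_mem (x : S.Cbar₁) : S.Cbar₁Map x ∈ S.CbarComp 1 := by
  obtain ⟨x, rfl⟩ := Ideal.Quotient.mk_surjective x
  exact ⟨x.1, x.2, rfl⟩

theorem one_mem_CbarComp : (1 : S.Cbar) ∈ S.CbarComp 1 := ⟨1, S.e_mem_comp, map_one S.proj⟩

variable {S} in
theorem mul_mem_CbarComp {σ τ : Γ} {x y : S.Cbar} (hx : x ∈ S.CbarComp σ)
    (hy : y ∈ S.CbarComp τ) : x * y ∈ S.CbarComp (σ * τ) := by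
  obtain ⟨x, hx, rfl⟩ := hx
  obtain ⟨y, hy, rfl⟩ := hy
  exact ⟨x * y, mul_mem_comp hx hy, map_mul S.proj x y⟩

/-- The group `hU(C̄)` of homogeneous units of `C̄`. A homogeneous unit is recorded together with its
degree; the inverse of a unit of degree `σ` has degree `σ⁻¹`. -/
def hU : Subgroup (↥S.strong × S.Cbarˣ) where
  carrier := {u | (u.2 : S.Cbar) ∈ S.CbarComp u.1 ∧
    ((u.2⁻¹ : S.Cbarˣ) : S.Cbar) ∈ S.CbarComp (u.1⁻¹ : S.strong)}
  one_mem' := ⟨S.one_mem_CbarComp, by simpa using S.one_mem_CbarComp⟩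
  mul_mem' := fun hu hv => ⟨mul_mem_CbarComp hu.1 hv.1, by
    simpa using mul_mem_CbarComp hv.2 hu.2⟩
  inv_mem' := fun hu => ⟨hu.2, by simpa using hu.1⟩

/-- The underlying unit of `C̄` of a homogeneous unit. -/
def toUnit : S.hU →* S.Cbarˣ := (MonoidHom.snd _ _).comp S.hU.subtype

/-- The degree `hU(C̄) → strong`. -/
def deg : S.hU →* S.strong := (MonoidHom.fst _ _).comp S.hU.subtype

/-- The map `C̄_1^* → hU(C̄)`. -/
def inl : S.Cbar₁ˣ →* S.hU :=
  ((MonoidHom.inr S.strong S.Cbarˣ).comp (Units.map S.Cbar₁Map.toMonoidHom)).codRestrict S.hU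
    fun u => ⟨S.Cbar₁Map_mem u.1, by
      have := S.Cbar₁Map_mem (u⁻¹).1
      simpa using this⟩

/-- The sequence `1 → C̄_1^* → hU(C̄) → strong → 1` is a group extension. -/
def IsExtension : Prop :=
  Function.Injective S.inl ∧ S.inl.range = S.deg.ker ∧ Function.Surjective S.deg

/-! ### The action of `Λ` -/

variable {S} in
theorem act_sub (l : Λ) {x : B} (hx : x ∈ S.sub) : S.actB l x ∈ S.sub :=
  sub_induction (p := fun x => S.actB l x ∈ S.sub) hx (fun _ hσ _ hy => comp_le_sub (act_strong l hσ) (act_comp l hy))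
    (by rw [map_zero]; exact S.sub.zero_mem)
    fun y z hy hz => by rw [map_add]; exact S.sub.add_mem hy hz

/-- The action of `Λ` on `C`. -/
def actC (l : Λ) : S.C →ₐ[O] S.C :=
  AlgHom.ofLinearMap
    ({ toFun := fun x => (⟨S.actB l (S.val x), act_sub l (S.val_mem x)⟩ : ↥S.sub)
       map_add' := fun x y => Subtype.ext (map_add (S.actB l) (S.val x) (S.val y))
       map_smul' := fun r x => Subtype.ext (map_smul (S.actB l) r (S.val x)) } : S.C →ₗ[O] S.C)
    (Subtype.ext (S.act_e l))
    (fun x y => Subtype.ext (map_mul (S.actB l) (S.val x) (S.val y)))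

theorem val_actC (l : Λ) (x : S.C) : S.val (S.actC l x) = S.actB l (S.val x) := rfl

variable {S} in
theorem actC_mem (l : Λ) {σ : Γ} {x : S.C} (hx : x ∈ S.Ccomp σ) :
    S.actC l x ∈ S.Ccomp (S.actΓ l σ) := act_comp l hx

/-- The action of `Λ` on `C_1`. -/
def actC₁ (l : Λ) : S.C₁ →ₐ[O] S.C₁ :=
  ((S.actC l).comp S.C₁.val).codRestrict S.C₁ fun x => by
    have := actC_mem l (S := S) (σ := 1) x.2
    rw [map_one] at this
    exact this

theorem actC_actC_inv (l : Λ) (x : S.C) : S.actC l (S.actC l⁻¹ x) = x := by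
  apply S.val_injective
  rw [val_actC, val_actC, ← AlgHom.mul_apply, ← map_mul, mul_inv_cancel, map_one, AlgHom.one_apply]

theorem actC₁_surjective (l : Λ) : Function.Surjective (S.actC₁ l) := fun x =>
  ⟨S.actC₁ l⁻¹ x, Subtype.ext (S.actC_actC_inv l x)⟩

theorem actC₁_jacobson (l : Λ) {x : S.C₁} (hx : x ∈ Ring.jacobson S.C₁) :
    S.actC₁ l x ∈ Ring.jacobson S.C₁ := by
  have : RingHomSurjective (S.actC₁ l).toRingHom := ⟨S.actC₁_surjective l⟩
  exact Ring.map_jacobson_le (S.actC₁ l).toRingHom ⟨x, hx, rfl⟩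

theorem actC_radIdeal (l : Λ) {x : S.C} (hx : x ∈ S.radIdeal) : S.actC l x ∈ S.radIdeal := by
  have h : TwoSidedIdeal.span (Subtype.val '' (Ring.jacobson S.C₁ : Set S.C₁)) ≤
      (TwoSidedIdeal.span (Subtype.val '' (Ring.jacobson S.C₁ : Set S.C₁))).comap (S.actC l) := by
    rw [TwoSidedIdeal.span_le]
    rintro _ ⟨y, hy, rfl⟩
    refine (TwoSidedIdeal.mem_comap _).2 ?_
    exact TwoSidedIdeal.subset_span ⟨S.actC₁ l y, S.actC₁_jacobson l hy, rfl⟩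
  exact (TwoSidedIdeal.mem_comap _).1 (h hx)

/-- The action of `Λ` on `C̄`. -/
def actCbar (l : Λ) : S.Cbar →ₐ[O] S.Cbar :=
  Ideal.Quotient.liftₐ S.radIdeal (S.proj.comp (S.actC l)) fun _ ha =>
    S.proj_eq_zero.2 (S.actC_radIdeal l ha)

variable {S} in
theorem actCbar_mem (l : Λ) {σ : Γ} {x : S.Cbar} (hx : x ∈ S.CbarComp σ) :
    S.actCbar l x ∈ S.CbarComp (S.actΓ l σ) := by
  obtain ⟨x, hx, rfl⟩ := hx
  exact ⟨S.actC l x, actC_mem l hx, rfl⟩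

/-- The action of `Λ` on the group `strong`. -/
def actStrong (l : Λ) : S.strong →* S.strong :=
  ((S.actΓ l).comp S.strong.subtype).codRestrict S.strong fun σ => act_strong l σ.2

/-- The action of `Λ` on `hU(C̄)`. -/
def actHU (l : Λ) : S.hU →* S.hU :=
  (((S.actStrong l).prodMap (Units.map (S.actCbar l).toMonoidHom)).comp S.hU.subtype).codRestrict
    S.hU fun u => ⟨actCbar_mem l u.2.1, by
      have := actCbar_mem l u.2.2
      rw [Subgroup.coe_inv, map_inv] at this
      exact this⟩

end CliffordDatum

end BlockExt

namespace BlockExt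

/-- A `K`-interior `H`-algebra structure on the `O`-algebra `B`, for a normal subgroup `K` of `H`:
an action of `H` on `B` by `O`-algebra endomorphisms (hence automorphisms, as `H` is a group), and a
group homomorphism `x ↦ x · 1` from `K` to `Bˣ` that is `H`-equivariant and induces on `B` the given
action of `K`. -/
structure InteriorAlgebra (O : Type*) {H : Type*} [CommRing O] [Group H] (K : Subgroup H)
    [hK : K.Normal] (B : Type*) [Ring B] [Algebra O B] where
  act : H →* (B →ₐ[O] B)
  unit : K →* Bˣ
  act_unit : ∀ (h : H) (x : K),
    act h (unit x : B) = (unit ⟨h * x * h⁻¹, hK.conj_mem x x.2 h⟩ : B)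
  act_coe : ∀ (x : K) (a : B), act (x : H) a = unit x * a * ((unit x)⁻¹ : Bˣ)

namespace InteriorAlgebra

variable {O H : Type*} [CommRing O] [Group H] {K : Subgroup H} [hK : K.Normal]
  {B : Type*} [Ring B] [Algebra O B] (𝒜 : InteriorAlgebra O K B)

theorem act_act (g h : H) (a : B) : 𝒜.act g (𝒜.act h a) = 𝒜.act (g * h) a := by
  rw [map_mul, AlgHom.mul_apply]

/-- The functions `f : H → B` such that `f (k x) = f x (k · 1)⁻¹` for `k ∈ K`. The function `f` stands
for the element `∑ f x ⊗ x` of `B ⊗_{OK} OH`, where `x` runs over representatives of `H/K`. -/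
def funs : Submodule O (H → B) where
  carrier := {f | ∀ (k : K) (x : H), f (k * x) = f x * ((𝒜.unit k)⁻¹ : Bˣ)}
  zero_mem' := fun k x => by simp
  add_mem' := fun hf hg k x => by simp [hf k x, hg k x, add_mul]
  smul_mem' := fun r f hf k x => by simp [hf k x]

/-- The `O`-algebra `A = B ⊗_{OK} OH = ⨁ B ⊗ x`, with multiplication
`(a ⊗ x) (c ⊗ y) = a (x • c) ⊗ x y`. -/
def Crossed : Type _ := ↥𝒜.funs

namespace Crossed

variable {𝒜}

instance : AddCommGroup 𝒜.Crossed := inferInstanceAs (AddCommGroup ↥𝒜.funs)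

instance : Module O 𝒜.Crossed := inferInstanceAs (Module O ↥𝒜.funs)

variable (𝒜) in
/-- The coefficients of an element: `coeff f x = a` if the component of `f` in degree `Kx` is
`a ⊗ x`. -/
def coeff : 𝒜.Crossed →ₗ[O] (H → B) := 𝒜.funs.subtype

theorem coeff_mul_left (f : 𝒜.Crossed) (k : K) (x : H) :
    coeff 𝒜 f (k * x) = coeff 𝒜 f x * ((𝒜.unit k)⁻¹ : Bˣ) :=
  Subtype.prop (p := (· ∈ 𝒜.funs)) f k x

theorem ext {f g : 𝒜.Crossed} (h : ∀ x, coeff 𝒜 f x = coeff 𝒜 g x) : f = g :=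
  Subtype.ext (funext h)

theorem coeff_mul_right (f : 𝒜.Crossed) (x : H) (k : K) :
    coeff 𝒜 f (x * k) = coeff 𝒜 f x *
      𝒜.act x (((𝒜.unit k)⁻¹ : Bˣ) : B) := by
  have h := coeff_mul_left f ⟨x * k * x⁻¹, hK.conj_mem k k.2 x⟩ x
  have h2 := 𝒜.act_unit x k⁻¹
  have h3 : (⟨x * ((k⁻¹ : K) : H) * x⁻¹, hK.conj_mem _ (k⁻¹).2 x⟩ : K) =
      (⟨x * k * x⁻¹, hK.conj_mem k k.2 x⟩ : K)⁻¹ := by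
    ext; simp [mul_assoc]
  rw [h3, map_inv, map_inv] at h2
  rw [h2, ← h]
  simp

/-- The terms of the sum that defines the product depend only on the class of `s` modulo `K`. -/
theorem term_eq (f g : 𝒜.Crossed) (z s t : H) (hst : (s : H ⧸ K) = t) :
    coeff 𝒜 f s * 𝒜.act s (coeff 𝒜 g (s⁻¹ * z)) =
      coeff 𝒜 f t * 𝒜.act t (coeff 𝒜 g (t⁻¹ * z)) := by
  obtain ⟨k, rfl⟩ : ∃ k : K, s * k = t := ⟨⟨s⁻¹ * t, QuotientGroup.eq.1 hst⟩, by simp⟩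
  have h1 : (s * k)⁻¹ * z = ((k⁻¹ : K) : H) * (s⁻¹ * z) := by simp [mul_assoc]
  rw [coeff_mul_right, h1, coeff_mul_left, ← act_act, act_coe, mul_assoc, ← map_mul]
  simp [mul_assoc]

open Classical in
variable (𝒜) in
/-- The element `a ⊗ x`. -/
noncomputable def tmul (a : B) (x : H) : 𝒜.Crossed :=
  (⟨fun y => if h : y * x⁻¹ ∈ K then a * ((𝒜.unit ⟨y * x⁻¹, h⟩)⁻¹ : Bˣ) else 0, by
    intro k y
    have h1 : (k : H) * y * x⁻¹ ∈ K ↔ y * x⁻¹ ∈ K := by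
      rw [mul_assoc]; exact K.mul_mem_cancel_left k.2
    by_cases h : y * x⁻¹ ∈ K
    · have h2 : (⟨k * y * x⁻¹, h1.2 h⟩ : K) = k * ⟨y * x⁻¹, h⟩ := by ext; simp [mul_assoc]
      beta_reduce
      rw [dif_pos (h1.2 h), dif_pos h, h2, map_mul, mul_inv_rev, Units.val_mul, mul_assoc]
    · simp [h, h1]⟩ : ↥𝒜.funs)

theorem coeff_tmul_self (a : B) (x : H) : coeff 𝒜 (tmul 𝒜 a x) x = a := by
  have h : x * x⁻¹ ∈ K := by simp
  have h2 : (⟨x * x⁻¹, h⟩ : K) = 1 := by ext; simp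
  exact (dif_pos h).trans (by rw [h2]; simp)

theorem coeff_tmul_of_ne (a : B) {x y : H} (h : (y : H ⧸ K) ≠ x) :
    coeff 𝒜 (tmul 𝒜 a x) y = 0 := by
  have h2 : y * x⁻¹ ∉ K := fun h2 => h <| by
    rw [eq_comm, QuotientGroup.eq]
    exact (hK.mem_comm_iff).1 h2
  exact dif_neg h2

theorem ext_of_support {f g : 𝒜.Crossed} (x : H)
    (hf : ∀ y : H, (y : H ⧸ K) ≠ x → coeff 𝒜 f y = 0)
    (hg : ∀ y : H, (y : H ⧸ K) ≠ x → coeff 𝒜 g y = 0)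
    (h : coeff 𝒜 f x = coeff 𝒜 g x) : f = g := by
  refine ext fun y => ?_
  by_cases hy : (y : H ⧸ K) = x
  · obtain ⟨k, rfl⟩ : ∃ k : K, x * k = y := ⟨⟨x⁻¹ * y, QuotientGroup.eq.1 hy.symm⟩, by simp⟩
    rw [coeff_mul_right, coeff_mul_right, h]
  · rw [hf y hy, hg y hy]

/-- The tensor relation over `OK`. -/
theorem tmul_unit (a : B) (k : K) (x : H) :
    tmul 𝒜 (a * 𝒜.unit k) x = tmul 𝒜 a (k * x) := by
  have h : ((k * x : H) : H ⧸ K) = x := by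
    rw [eq_comm, QuotientGroup.eq, ← mul_assoc]
    simpa using hK.conj_mem k k.2 x⁻¹
  refine ext_of_support x (fun y hy => coeff_tmul_of_ne _ hy)
    (fun y hy => coeff_tmul_of_ne _ (by rwa [h])) ?_
  have h2 := coeff_mul_left (tmul 𝒜 a (k * x)) k⁻¹ (k * x)
  rw [coeff_tmul_self, map_inv, inv_inv] at h2
  rw [coeff_tmul_self, ← h2]
  simp

variable (𝒜) in
/-- The component `A_σ = B ⊗ x`, where `σ = Kx`. -/
def grad (σ : H ⧸ K) : Submodule O 𝒜.Crossed where
  carrier := {f | ∀ x : H, (x : H ⧸ K) ≠ σ → coeff 𝒜 f x = 0}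
  zero_mem' := fun x _ => by simp
  add_mem' := fun hf hg x hx => by simp [hf x hx, hg x hx]
  smul_mem' := fun r f hf x hx => by simp [hf x hx]

theorem tmul_mem_grad (a : B) (x : H) : tmul 𝒜 a x ∈ grad 𝒜 (x : H ⧸ K) :=
  fun _ hy => coeff_tmul_of_ne a hy

theorem eq_tmul {x : H} {f : 𝒜.Crossed} (hf : f ∈ grad 𝒜 (x : H ⧸ K)) :
    f = tmul 𝒜 (coeff 𝒜 f x) x :=
  ext_of_support x hf (tmul_mem_grad _ _) (by rw [coeff_tmul_self])

noncomputable instance : One 𝒜.Crossed := ⟨tmul 𝒜 1 1⟩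

theorem one_def : (1 : 𝒜.Crossed) = tmul 𝒜 1 1 := rfl

variable [Finite H]

/-- The product `(f g)(z) = ∑ f(s) (s • g(s⁻¹ z))`, where `s` runs over representatives of `H/K`. -/
noncomputable instance : Mul 𝒜.Crossed where
  mul f g := (⟨fun z => ∑ᶠ σ : H ⧸ K,
      coeff 𝒜 f σ.out * 𝒜.act σ.out (coeff 𝒜 g (σ.out⁻¹ * z)), by
    intro k z
    let _ := Fintype.ofFinite (H ⧸ K)
    simp only [finsum_eq_sum_of_fintype]
    rw [Finset.sum_mul]
    refine Finset.sum_congr rfl fun σ _ => ?_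
    generalize σ.out = s
    have h1 : s⁻¹ * (k * z) = ((⟨s⁻¹ * k * s, by simpa using hK.conj_mem k k.2 s⁻¹⟩ : K) : H) *
        (s⁻¹ * z) := by simp [mul_assoc]
    have h2 := 𝒜.act_unit s ⟨s⁻¹ * k * s, by simpa using hK.conj_mem k k.2 s⁻¹⟩⁻¹
    have h3 : (⟨s * ((⟨s⁻¹ * k * s, by simpa using hK.conj_mem k k.2 s⁻¹⟩⁻¹ : K) : H) * s⁻¹,
        hK.conj_mem _ (Subtype.prop _) s⟩ : K) = k⁻¹ := by
      ext; simp [mul_assoc]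
    rw [h3, map_inv, map_inv] at h2
    rw [h1, coeff_mul_left, map_mul, h2, mul_assoc]⟩ : ↥𝒜.funs)

theorem coeff_mul (f g : 𝒜.Crossed) (z : H) : coeff 𝒜 (f * g) z =
    ∑ᶠ σ : H ⧸ K, coeff 𝒜 f σ.out * 𝒜.act σ.out (coeff 𝒜 g (σ.out⁻¹ * z)) := rfl

theorem coeff_mul_of_rep [Fintype (H ⧸ K)] (f g : 𝒜.Crossed) (z : H) {ι : Type*} [Fintype ι]
    (e : ι ≃ H ⧸ K) (r : ι → H) (hr : ∀ i, (r i : H ⧸ K) = e i) : coeff 𝒜 (f * g) z =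
    ∑ i, coeff 𝒜 f (r i) * 𝒜.act (r i) (coeff 𝒜 g ((r i)⁻¹ * z)) := by
  rw [coeff_mul, finsum_eq_sum_of_fintype, ← e.sum_comp]
  exact Finset.sum_congr rfl fun i _ => term_eq f g z _ _ (by
    rw [hr]; exact QuotientGroup.out_eq' _)

theorem coeff_tmul_mul (a : B) (x : H) (f : 𝒜.Crossed) (z : H) :
    coeff 𝒜 (tmul 𝒜 a x * f) z = a * 𝒜.act x (coeff 𝒜 f (x⁻¹ * z)) := by
  let _ := Fintype.ofFinite (H ⧸ K)
  rw [coeff_mul, finsum_eq_sum_of_fintype, Finset.sum_eq_single (x : H ⧸ K)]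
  · rw [term_eq _ _ z _ x (QuotientGroup.out_eq' _), coeff_tmul_self]
  · intro σ _ hσ
    rw [coeff_tmul_of_ne, zero_mul]
    rwa [QuotientGroup.out_eq']
  · simp

theorem coeff_mul_tmul (f : 𝒜.Crossed) (a : B) (y z : H) :
    coeff 𝒜 (f * tmul 𝒜 a y) z = coeff 𝒜 f (z * y⁻¹) * 𝒜.act (z * y⁻¹) a := by
  let _ := Fintype.ofFinite (H ⧸ K)
  rw [coeff_mul, finsum_eq_sum_of_fintype, Finset.sum_eq_single ((z * y⁻¹ : H) : H ⧸ K)]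
  · rw [term_eq _ _ z _ (z * y⁻¹) (QuotientGroup.out_eq' _)]
    simp [coeff_tmul_self]
  · intro σ _ hσ
    rw [coeff_tmul_of_ne, map_zero, mul_zero]
    intro h
    apply hσ
    rw [QuotientGroup.mk_mul, QuotientGroup.mk_inv, QuotientGroup.out_eq', inv_mul_eq_iff_eq_mul] at h
    rw [QuotientGroup.mk_mul, QuotientGroup.mk_inv, h, mul_inv_cancel_right]
  · simp

/-- The multiplication rule. -/
theorem tmul_mul_tmul (a c : B) (x y : H) :
    tmul 𝒜 a x * tmul 𝒜 c y = tmul 𝒜 (a * 𝒜.act x c) (x * y) := by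
  refine ext_of_support (x * y) (fun z hz => ?_) (fun z hz => coeff_tmul_of_ne _ hz) ?_
  · rw [coeff_tmul_mul, coeff_tmul_of_ne, map_zero, mul_zero]
    intro h
    apply hz
    rw [← mul_inv_cancel_left x z, QuotientGroup.mk_mul, h, QuotientGroup.mk_mul]
  · rw [coeff_tmul_mul, inv_mul_cancel_left, coeff_tmul_self, coeff_tmul_self]

theorem one_mul_aux (f : 𝒜.Crossed) : 1 * f = f :=
  ext fun z => by rw [one_def, coeff_tmul_mul]; simp

theorem mul_one_aux (f : 𝒜.Crossed) : f * 1 = f :=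
  ext fun z => by rw [one_def, coeff_mul_tmul]; simp

theorem mul_assoc_aux (f g h : 𝒜.Crossed) : f * g * h = f * (g * h) := by
  let _ := Fintype.ofFinite (H ⧸ K)
  refine ext fun z => ?_
  have h1 : ∀ (s t : H), coeff 𝒜 f t * 𝒜.act t (coeff 𝒜 g (t⁻¹ * s) *
      𝒜.act (t⁻¹ * s) (coeff 𝒜 h ((t⁻¹ * s)⁻¹ * (t⁻¹ * z)))) =
      coeff 𝒜 f t * 𝒜.act t (coeff 𝒜 g (t⁻¹ * s)) * 𝒜.act s (coeff 𝒜 h (s⁻¹ * z)) := by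
    intro s t
    rw [map_mul, act_act]
    simp [mul_assoc]
  rw [coeff_mul, coeff_mul, finsum_eq_sum_of_fintype, finsum_eq_sum_of_fintype]
  have h2 : ∀ τ : H ⧸ K, coeff 𝒜 (g * h) (τ.out⁻¹ * z) = ∑ σ : H ⧸ K,
      coeff 𝒜 g (τ.out⁻¹ * σ.out) *
        𝒜.act (τ.out⁻¹ * σ.out) (coeff 𝒜 h ((τ.out⁻¹ * σ.out)⁻¹ * (τ.out⁻¹ * z))) := by
    intro τ
    refine coeff_mul_of_rep g h _ (Equiv.mulLeft τ⁻¹) (fun σ => τ.out⁻¹ * σ.out) fun σ => ?_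
    rw [QuotientGroup.mk_mul, QuotientGroup.mk_inv, QuotientGroup.out_eq', QuotientGroup.out_eq']
    rfl
  simp only [h2, map_sum, Finset.mul_sum, h1]
  rw [Finset.sum_comm]
  refine Finset.sum_congr rfl fun σ _ => ?_
  rw [coeff_mul, finsum_eq_sum_of_fintype, Finset.sum_mul]

noncomputable instance : Ring 𝒜.Crossed where
  __ := (inferInstance : AddCommGroup 𝒜.Crossed)
  mul_assoc := mul_assoc_aux
  one_mul := one_mul_aux
  mul_one := mul_one_aux
  left_distrib f g h := by
    let _ := Fintype.ofFinite (H ⧸ K)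
    refine ext fun z => ?_
    simp [coeff_mul, finsum_eq_sum_of_fintype, mul_add, Finset.sum_add_distrib]
  right_distrib f g h := by
    let _ := Fintype.ofFinite (H ⧸ K)
    refine ext fun z => ?_
    simp [coeff_mul, finsum_eq_sum_of_fintype, add_mul, Finset.sum_add_distrib]
  zero_mul f := by
    refine ext fun z => ?_
    simp [coeff_mul]
  mul_zero f := by
    refine ext fun z => ?_
    simp [coeff_mul]

noncomputable instance : Algebra O 𝒜.Crossed :=
  Algebra.ofModule
    (fun r f g => by
      let _ := Fintype.ofFinite (H ⧸ K)
      refine ext fun z => ?_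
      simp [coeff_mul, finsum_eq_sum_of_fintype, Finset.smul_sum])
    (fun r f g => by
      let _ := Fintype.ofFinite (H ⧸ K)
      refine ext fun z => ?_
      simp [coeff_mul, finsum_eq_sum_of_fintype, Finset.smul_sum])

theorem mul_mem_grad {σ τ : H ⧸ K} {f g : 𝒜.Crossed} (hf : f ∈ grad 𝒜 σ) (hg : g ∈ grad 𝒜 τ) :
    f * g ∈ grad 𝒜 (σ * τ) := by
  induction σ using QuotientGroup.induction_on with | _ x
  induction τ using QuotientGroup.induction_on with | _ y
  rw [eq_tmul hf, eq_tmul hg, tmul_mul_tmul]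
  exact tmul_mem_grad _ _

end Crossed

/-- An action of a group `L` on `B` and on `H` (fixing `K` as a set) that is compatible with the
`K`-interior `H`-algebra structure of `B`. -/
structure Sym (L : Type*) [Group L] where
  onB : L →* (B →ₐ[O] B)
  onH : L →* MulAut H
  onH_mem : ∀ (l : L) {k : H}, k ∈ K → onH l k ∈ K
  onB_unit : ∀ (l : L) (k : K), onB l (𝒜.unit k : B) = (𝒜.unit ⟨onH l k, onH_mem l k.2⟩ : B)
  onB_act : ∀ (l : L) (h : H) (a : B), onB l (𝒜.act h a) = 𝒜.act (onH l h) (onB l a)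

namespace Sym

variable {𝒜} {L : Type*} [Group L] (s : 𝒜.Sym L)

/-- The action of `L` on `H/K`. -/
def onQuot : L →* Monoid.End (H ⧸ K) where
  toFun l := QuotientGroup.map K K (s.onH l).toMonoidHom fun _ hk => s.onH_mem l hk
  map_one' := by
    refine MonoidHom.ext fun σ => ?_
    induction σ using QuotientGroup.induction_on with | _ x
    change ((s.onH 1 x : H) : H ⧸ K) = x
    rw [map_one, MulAut.one_apply]
  map_mul' l m := by
    refine MonoidHom.ext fun σ => ?_
    induction σ using QuotientGroup.induction_on with | _ x
    change ((s.onH (l * m) x : H) : H ⧸ K) = (s.onH l (s.onH m x) : H)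
    rw [map_mul, MulAut.mul_apply]

theorem onQuot_coe (l : L) (x : H) : s.onQuot l (x : H ⧸ K) = (s.onH l x : H) := rfl

theorem onH_inv_apply (l : L) (x : H) : s.onH l (s.onH l⁻¹ x) = x := by
  rw [← MulAut.mul_apply, ← map_mul, mul_inv_cancel, map_one, MulAut.one_apply]

theorem onH_inv_apply' (l : L) (x : H) : s.onH l⁻¹ (s.onH l x) = x := by
  rw [← MulAut.mul_apply, ← map_mul, inv_mul_cancel, map_one, MulAut.one_apply]

/-- The linear map `a ⊗ x ↦ (l • a) ⊗ (l • x)`. -/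
def crossedLin (l : L) : 𝒜.Crossed →ₗ[O] 𝒜.Crossed where
  toFun f := (⟨fun x => s.onB l (Crossed.coeff 𝒜 f (s.onH l⁻¹ x)), by
    intro k x
    have h := s.onB_unit l ⟨s.onH l⁻¹ (k⁻¹ : K), s.onH_mem l⁻¹ (k⁻¹).2⟩
    have h1 : (⟨s.onH l (s.onH l⁻¹ (k⁻¹ : K)), s.onH_mem l (s.onH_mem l⁻¹ (k⁻¹).2)⟩ : K) = k⁻¹ :=
      Subtype.ext (s.onH_inv_apply l _)
    have h2 : (⟨s.onH l⁻¹ (k⁻¹ : K), s.onH_mem l⁻¹ (k⁻¹).2⟩ : K) =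
        (⟨s.onH l⁻¹ k, s.onH_mem l⁻¹ k.2⟩ : K)⁻¹ := by
      ext; simp
    have h3 := Crossed.coeff_mul_left f ⟨s.onH l⁻¹ k, s.onH_mem l⁻¹ k.2⟩ (s.onH l⁻¹ x)
    rw [h2, map_inv] at h
    have h4 : (𝒜.unit ⟨s.onH l ((⟨s.onH l⁻¹ k, s.onH_mem l⁻¹ k.2⟩ : K)⁻¹ : K),
      s.onH_mem l (Subtype.prop _)⟩) = (𝒜.unit k)⁻¹ := by
      rw [← map_inv]
      congr 1
      ext
      rw [← s.onH_inv_apply l ((k⁻¹ : K) : H)]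
      simp
    rw [h4] at h
    change s.onB l (Crossed.coeff 𝒜 f (s.onH l⁻¹ (k * x))) = s.onB l _ * _
    rw [← h, ← map_mul (s.onB l), ← h3, map_mul (s.onH l⁻¹)]⟩ : ↥𝒜.funs)
  map_add' f g := Crossed.ext fun x => by
    change s.onB l (Crossed.coeff 𝒜 (f + g) _) = s.onB l _ + s.onB l _
    simp
  map_smul' r f := Crossed.ext fun x => by
    change s.onB l (Crossed.coeff 𝒜 (r • f) _) = r • s.onB l _
    simp

theorem coeff_crossedLin (l : L) (f : 𝒜.Crossed) (x : H) :
    Crossed.coeff 𝒜 (s.crossedLin l f) x = s.onB l (Crossed.coeff 𝒜 f (s.onH l⁻¹ x)) := rfl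

theorem onH_coe_ne (l : L) {x y : H} (h : (x : H ⧸ K) ≠ (s.onH l y : H)) :
    ((s.onH l⁻¹ x : H) : H ⧸ K) ≠ y := by
  intro h1
  apply h
  have h2 := congrArg (s.onQuot l) h1
  rwa [onQuot_coe, onQuot_coe, s.onH_inv_apply] at h2

theorem crossedLin_mem (l : L) {σ : H ⧸ K} {f : 𝒜.Crossed} (hf : f ∈ Crossed.grad 𝒜 σ) :
    s.crossedLin l f ∈ Crossed.grad 𝒜 (s.onQuot l σ) := by
  induction σ using QuotientGroup.induction_on with | _ y
  intro x hx
  rw [coeff_crossedLin, hf _ (s.onH_coe_ne l hx), map_zero]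

theorem crossedLin_tmul (l : L) (a : B) (x : H) :
    s.crossedLin l (Crossed.tmul 𝒜 a x) = Crossed.tmul 𝒜 (s.onB l a) (s.onH l x) := by
  refine Crossed.ext_of_support (s.onH l x) (s.crossedLin_mem l (Crossed.tmul_mem_grad a x))
    (fun y hy => Crossed.coeff_tmul_of_ne _ hy) ?_
  rw [coeff_crossedLin, s.onH_inv_apply', Crossed.coeff_tmul_self, Crossed.coeff_tmul_self]

variable [Finite H]

/-- The action of `L` on the algebra `A = B ⊗_{OK} OH`, given by
`l • (a ⊗ x) = (l • a) ⊗ (l • x)`. -/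
noncomputable def crossed : L →* (𝒜.Crossed →ₐ[O] 𝒜.Crossed) where
  toFun l := AlgHom.ofLinearMap (s.crossedLin l)
    (by rw [Crossed.one_def, crossedLin_tmul, map_one, map_one])
    (fun f g => by
      let _ := Fintype.ofFinite (H ⧸ K)
      refine Crossed.ext fun z => ?_
      rw [coeff_crossedLin, Crossed.coeff_mul, finsum_eq_sum_of_fintype, map_sum]
      rw [Crossed.coeff_mul_of_rep (s.crossedLin l f) (s.crossedLin l g) z
        ({ toFun := s.onQuot l
           invFun := s.onQuot l⁻¹
           left_inv := fun σ => by
            induction σ using QuotientGroup.induction_on with | _ y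
            rw [onQuot_coe, onQuot_coe, onH_inv_apply']
           right_inv := fun σ => by
            induction σ using QuotientGroup.induction_on with | _ y
            rw [onQuot_coe, onQuot_coe, onH_inv_apply] } : H ⧸ K ≃ H ⧸ K)
        (fun σ => s.onH l σ.out) (fun σ => by
          rw [← onQuot_coe, QuotientGroup.out_eq']; rfl)]
      refine Finset.sum_congr rfl fun σ _ => ?_
      rw [coeff_crossedLin, coeff_crossedLin, onH_inv_apply', map_mul, s.onB_act, map_mul (s.onH l⁻¹),
        map_inv (s.onH l⁻¹), onH_inv_apply'])
  map_one' := by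
    ext f
    refine Crossed.ext fun x => ?_
    change Crossed.coeff 𝒜 (s.crossedLin 1 f) x = _
    rw [coeff_crossedLin]
    simp
  map_mul' l m := by
    ext f
    refine Crossed.ext fun x => ?_
    change Crossed.coeff 𝒜 (s.crossedLin (l * m) f) x =
      Crossed.coeff 𝒜 (s.crossedLin l (s.crossedLin m f)) x
    rw [coeff_crossedLin, coeff_crossedLin, coeff_crossedLin]
    simp

theorem crossed_tmul (l : L) (a : B) (x : H) :
    s.crossed l (Crossed.tmul 𝒜 a x) = Crossed.tmul 𝒜 (s.onB l a) (s.onH l x) :=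
  s.crossedLin_tmul l a x

theorem crossed_mem (l : L) {σ : H ⧸ K} {f : 𝒜.Crossed} (hf : f ∈ Crossed.grad 𝒜 σ) :
    s.crossed l f ∈ Crossed.grad 𝒜 (s.onQuot l σ) := s.crossedLin_mem l hf

end Sym

/-- `H` acts on `B` by the given action and on itself by conjugation. -/
def conjSym : 𝒜.Sym H where
  onB := 𝒜.act
  onH := MulAut.conj
  onH_mem l k hk := hK.conj_mem k hk l
  onB_unit l k := 𝒜.act_unit l k
  onB_act l h a := by
    rw [act_act, act_act, MulAut.conj_apply, inv_mul_cancel_right]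

variable [Finite H]

/-- The structural homomorphism `H → A^*`, `h ↦ 1 ⊗ h`. -/
noncomputable def interior : H →* 𝒜.Crossedˣ :=
  MonoidHom.toHomUnits
    { toFun := fun h => Crossed.tmul 𝒜 1 h
      map_one' := rfl
      map_mul' := fun g h => by rw [Crossed.tmul_mul_tmul]; simp }

/-- The action of `H` on `A = B ⊗_{OK} OH`. -/
noncomputable def crossedAct : H →* (𝒜.Crossed →ₐ[O] 𝒜.Crossed) := 𝒜.conjSym.crossed

/-- The action of `H` on `A` is the conjugation action. -/
theorem crossedAct_eq_conj (h : H) (f : 𝒜.Crossed) :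
    𝒜.crossedAct h f = 𝒜.interior h * f * (𝒜.interior h⁻¹ : 𝒜.Crossedˣ) := by
  refine Crossed.ext fun z => ?_
  change 𝒜.act h (Crossed.coeff 𝒜 f (MulAut.conj h⁻¹ z)) =
    Crossed.coeff 𝒜 (Crossed.tmul 𝒜 1 h * f * Crossed.tmul 𝒜 1 h⁻¹) z
  rw [Crossed.coeff_mul_tmul, Crossed.coeff_tmul_mul]
  simp [mul_assoc]

end InteriorAlgebra

end BlockExt

namespace BlockExt

section Brauer

variable {O H B : Type*} [CommRing O] [Group H] [Ring B] [Algebra O B]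
  (act : H →* (B →ₐ[O] B))

/-- The subalgebra `B^Q` of `Q`-fixed elements. -/
def fixedPts (Q : Subgroup H) : Subalgebra O B where
  carrier := {a | ∀ q ∈ Q, act q a = a}
  mul_mem' := fun ha hb q hq => by rw [map_mul, ha q hq, hb q hq]
  add_mem' := fun ha hb q hq => by rw [map_add, ha q hq, hb q hq]
  algebraMap_mem' := fun r q _ => (act q).commutes r

variable {act} in
theorem mem_fixedPts {Q : Subgroup H} {a : B} : a ∈ fixedPts act Q ↔ ∀ q ∈ Q, act q a = a :=
  Iff.rfl

theorem fixedPts_mono {Q P : Subgroup H} (h : Q ≤ P) : fixedPts act P ≤ fixedPts act Q :=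
  fun _ ha q hq => ha q (h hq)

/-- The relative trace `Tr_Q^P : a ↦ ∑ x • a`, where `x` runs over representatives of `P/Q`. It is
meant for `Q ≤ P` and `a ∈ B^Q`, and then does not depend on the choice of representatives. -/
noncomputable def relTrace (Q P : Subgroup H) : B →ₗ[O] B :=
  ∑ᶠ x : P ⧸ Q.subgroupOf P, (act (x.out : H)).toLinearMap

/-- `B_Q^P = Tr_Q^P(B^Q)`. -/
noncomputable def traceImage (Q P : Subgroup H) : Submodule O B :=
  (Subalgebra.toSubmodule (fixedPts act Q)).map (relTrace act Q P)

theorem act_eq_of_rep {Q P : Subgroup H} {a : B} (ha : a ∈ fixedPts act Q) {s t : P}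
    (h : (s : P ⧸ Q.subgroupOf P) = t) : act (s : H) a = act (t : H) a := by
  have h1 : (s : H)⁻¹ * t ∈ Q := by simpa [Subgroup.mem_subgroupOf] using QuotientGroup.eq.1 h
  have h2 := ha _ h1
  rw [← h2, ← AlgHom.mul_apply, ← map_mul, mul_inv_cancel_left, h2]

variable {act} in
theorem fixedPts_map {Q Q' : Subgroup H} (n : H) (hQ : ∀ q ∈ Q', n⁻¹ * q * n ∈ Q) {a : B}
    (ha : a ∈ fixedPts act Q) : act n a ∈ fixedPts act Q' := fun q hq => by
  have h := ha _ (hQ q hq)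
  conv_rhs => rw [← h]
  rw [← AlgHom.mul_apply, ← AlgHom.mul_apply, ← map_mul, ← map_mul]
  simp [mul_assoc]

theorem conj_mem_of_normalizer {P : Subgroup H} {n : H} (hn : n ∈ Subgroup.normalizer (P : Set H))
    {x : H} (hx : x ∈ P) : n * x * n⁻¹ ∈ P := (Subgroup.mem_normalizer_iff.1 hn x).1 hx

theorem inv_conj_mem_of_normalizer {P : Subgroup H} {n : H}
    (hn : n ∈ Subgroup.normalizer (P : Set H)) {x : H} (hx : x ∈ P) : n⁻¹ * x * n ∈ P := by
  simpa using conj_mem_of_normalizer (inv_mem hn) hx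

/-- The action of `N_H(P)` on `B^P`. -/
def fixedAct (P : Subgroup H) (n : Subgroup.normalizer (P : Set H)) :
    fixedPts act P →ₐ[O] fixedPts act P :=
  ((act (n : H)).comp (fixedPts act P).val).codRestrict _ fun a =>
    fixedPts_map (n : H) (fun _ hq => inv_conj_mem_of_normalizer n.2 hq) a.2

variable [Finite H]

theorem relTrace_apply (Q P : Subgroup H) (a : B) :
    relTrace act Q P a = ∑ᶠ x : P ⧸ Q.subgroupOf P, act (x.out : H) a := by
  let _ := Fintype.ofFinite (P ⧸ Q.subgroupOf P)
  rw [relTrace, finsum_eq_sum_of_fintype, finsum_eq_sum_of_fintype, LinearMap.sum_apply]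
  rfl

theorem relTrace_eq_sum {Q P : Subgroup H} {a : B} (ha : a ∈ fixedPts act Q) {ι : Type*}
    [Fintype ι] (e : ι ≃ P ⧸ Q.subgroupOf P) (r : ι → P) (hr : ∀ i, (r i : P ⧸ Q.subgroupOf P) = e i) :
    relTrace act Q P a = ∑ i, act (r i : H) a := by
  let _ := Fintype.ofFinite (P ⧸ Q.subgroupOf P)
  rw [relTrace_apply, finsum_eq_sum_of_fintype, ← e.sum_comp]
  exact Finset.sum_congr rfl fun i _ => act_eq_of_rep act ha (by
    rw [hr]; exact QuotientGroup.out_eq' _)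

theorem mul_relTrace {Q P : Subgroup H} (a : B) {c : B} (hc : c ∈ fixedPts act P) :
    c * relTrace act Q P a = relTrace act Q P (c * a) := by
  let _ := Fintype.ofFinite (P ⧸ Q.subgroupOf P)
  simp only [relTrace_apply, finsum_eq_sum_of_fintype, Finset.mul_sum, map_mul]
  exact Finset.sum_congr rfl fun x _ => by rw [hc _ x.out.2]

theorem relTrace_mul {Q P : Subgroup H} (a : B) {c : B} (hc : c ∈ fixedPts act P) :
    relTrace act Q P a * c = relTrace act Q P (a * c) := by
  let _ := Fintype.ofFinite (P ⧸ Q.subgroupOf P)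
  simp only [relTrace_apply, finsum_eq_sum_of_fintype, Finset.sum_mul, map_mul]
  exact Finset.sum_congr rfl fun x _ => by rw [hc _ x.out.2]

theorem mul_traceImage {Q P : Subgroup H} (hQ : Q ≤ P) {a c : B} (hc : c ∈ fixedPts act P)
    (ha : a ∈ traceImage act Q P) : c * a ∈ traceImage act Q P := by
  obtain ⟨a, ha, rfl⟩ := ha
  exact ⟨c * a, (fixedPts act Q).mul_mem (fixedPts_mono act hQ hc) ha, (mul_relTrace act a hc).symm⟩

theorem traceImage_mul {Q P : Subgroup H} (hQ : Q ≤ P) {a c : B} (hc : c ∈ fixedPts act P)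
    (ha : a ∈ traceImage act Q P) : a * c ∈ traceImage act Q P := by
  obtain ⟨a, ha, rfl⟩ := ha
  exact ⟨a * c, (fixedPts act Q).mul_mem ha (fixedPts_mono act hQ hc), (relTrace_mul act a hc).symm⟩

/-- `n • Tr_Q^P(a) = Tr_{nQn⁻¹}^P(n • a)` for `n ∈ N_H(P)`. -/
theorem act_traceImage {Q P : Subgroup H} {n : H} (hn : n ∈ Subgroup.normalizer (P : Set H))
    {a : B} (ha : a ∈ traceImage act Q P) :
    act n a ∈ traceImage act (Q.map (MulAut.conj n).toMonoidHom) P := by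
  obtain ⟨a, ha, rfl⟩ := ha
  have hmem : ∀ q, q ∈ Q.map (MulAut.conj n).toMonoidHom ↔ n⁻¹ * q * n ∈ Q := by
    intro q
    constructor
    · rintro ⟨q, hq, rfl⟩
      simpa [mul_assoc] using hq
    · intro hq
      exact ⟨_, hq, by simp [mul_assoc]⟩
  have ha' : act n a ∈ fixedPts act (Q.map (MulAut.conj n).toMonoidHom) :=
    fixedPts_map n (fun q hq => (hmem q).1 hq) ha
  refine ⟨act n a, ha', ?_⟩
  let _ := Fintype.ofFinite (P ⧸ Q.subgroupOf P)
  let c : P ≃ P :=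
    { toFun := fun x => ⟨n * x * n⁻¹, conj_mem_of_normalizer hn x.2⟩
      invFun := fun x => ⟨n⁻¹ * x * n, inv_conj_mem_of_normalizer hn x.2⟩
      left_inv := fun x => Subtype.ext (by simp [mul_assoc])
      right_inv := fun x => Subtype.ext (by simp [mul_assoc]) }
  let e : P ⧸ Q.subgroupOf P ≃ P ⧸ (Q.map (MulAut.conj n).toMonoidHom).subgroupOf P :=
    Quotient.congr c fun x y => by
      change QuotientGroup.leftRel _ x y ↔ QuotientGroup.leftRel _ (c x) (c y)
      rw [QuotientGroup.leftRel_apply, QuotientGroup.leftRel_apply, Subgroup.mem_subgroupOf,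
        Subgroup.mem_subgroupOf, hmem]
      simp [c, mul_assoc]
  rw [relTrace_eq_sum act ha' e (fun x => c x.out) (fun x => by
      conv_rhs => rw [← QuotientGroup.out_eq' x]
      rfl), relTrace_apply, finsum_eq_sum_of_fintype, map_sum]
  refine Finset.sum_congr rfl fun x _ => ?_
  rw [← AlgHom.mul_apply, ← AlgHom.mul_apply, ← map_mul, ← map_mul]
  simp [c]

variable [IsLocalRing O]

/-- The ideal `∑_{Q < P} B_Q^P + 𝔪 B^P` of `B^P`, where `𝔪` is the maximal ideal of `O`. -/
noncomputable def brauerIdeal (P : Subgroup H) : Ideal (fixedPts act P) :=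
  Ideal.span ({x | ∃ Q, Q < P ∧ (x : B) ∈ traceImage act Q P} ∪
    algebraMap O (fixedPts act P) '' (IsLocalRing.maximalIdeal O : Set O))

instance (P : Subgroup H) : (brauerIdeal act P).IsTwoSided where
  mul_mem_of_left := fun {a} c ha => by
    refine Submodule.span_induction (p := fun x _ => x * c ∈ brauerIdeal act P) ?_ ?_ ?_ ?_ ha
    · rintro x (⟨Q, hQ, hx⟩ | ⟨r, hr, rfl⟩)
      · exact Ideal.subset_span (Or.inl ⟨Q, hQ, traceImage_mul act hQ.le c.2 hx⟩)
      · rw [Algebra.commutes]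
        exact Ideal.mul_mem_left _ _ (Ideal.subset_span (Or.inr ⟨r, hr, rfl⟩))
    · rw [zero_mul]; exact Ideal.zero_mem _
    · intro x y _ _ hx hy
      rw [add_mul]; exact Ideal.add_mem _ hx hy
    · intro r x _ hx
      rw [smul_eq_mul, mul_assoc]; exact Ideal.mul_mem_left _ _ hx

/-- The Brauer quotient `B(P) = k ⊗ (B^P / ∑_{Q < P} B_Q^P)`, `k = O / 𝔪`. -/
def BrauerQuot (P : Subgroup H) : Type _ := fixedPts act P ⧸ brauerIdeal act P

noncomputable instance (P : Subgroup H) : Ring (BrauerQuot act P) :=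
  inferInstanceAs (Ring (fixedPts act P ⧸ brauerIdeal act P))

noncomputable instance (P : Subgroup H) : Algebra O (BrauerQuot act P) :=
  inferInstanceAs (Algebra O (fixedPts act P ⧸ brauerIdeal act P))

/-- The Brauer homomorphism `Br_P : B^P → B(P)`. -/
noncomputable def Br (P : Subgroup H) : fixedPts act P →ₐ[O] BrauerQuot act P :=
  Ideal.Quotient.mkₐ O (brauerIdeal act P)

theorem Br_surjective (P : Subgroup H) : Function.Surjective (Br act P) :=
  Ideal.Quotient.mk_surjective

theorem Br_eq_zero {P : Subgroup H} {x : fixedPts act P} :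
    Br act P x = 0 ↔ x ∈ brauerIdeal act P := Ideal.Quotient.eq_zero_iff_mem

theorem fixedAct_mem (P : Subgroup H) (n : Subgroup.normalizer (P : Set H)) {a : fixedPts act P}
    (ha : a ∈ brauerIdeal act P) : fixedAct act P n a ∈ brauerIdeal act P := by
  refine Submodule.span_induction (p := fun x _ => fixedAct act P n x ∈ brauerIdeal act P)
    ?_ ?_ ?_ ?_ ha
  · rintro x (⟨Q, hQ, hx⟩ | ⟨r, hr, rfl⟩)
    · refine Ideal.subset_span (Or.inl ⟨Q.map (MulAut.conj (n : H)).toMonoidHom, ?_,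
        act_traceImage act n.2 hx⟩)
      have h1 : ∀ x ∈ P, (n : H)⁻¹ * x * n ∈ P := fun x hx => inv_conj_mem_of_normalizer n.2 hx
      refine lt_of_le_not_ge ?_ fun h => hQ.not_ge fun x hx => ?_
      · rintro _ ⟨q, hq, rfl⟩
        exact conj_mem_of_normalizer n.2 (hQ.le hq)
      · obtain ⟨q, hq, hq'⟩ := h (conj_mem_of_normalizer n.2 hx)
        have : q = x := (MulAut.conj (n : H)).injective hq'
        exact this ▸ hq
    · rw [AlgHom.commutes]
      exact Ideal.subset_span (Or.inr ⟨r, hr, rfl⟩)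
  · rw [map_zero]; exact Ideal.zero_mem _
  · intro x y _ _ hx hy
    rw [map_add]; exact Ideal.add_mem _ hx hy
  · intro r x _ hx
    rw [smul_eq_mul, map_mul]; exact Ideal.mul_mem_left _ _ hx

/-- The action of `N_H(P)` on the Brauer quotient `B(P)`. -/
noncomputable def brauerAct (P : Subgroup H) :
    Subgroup.normalizer (P : Set H) →* (BrauerQuot act P →ₐ[O] BrauerQuot act P) where
  toFun n := Ideal.Quotient.liftₐ (brauerIdeal act P) ((Br act P).comp (fixedAct act P n)) fun _ ha =>
    (Br_eq_zero act).2 (fixedAct_mem act P n ha)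
  map_one' := by
    refine AlgHom.ext fun x => ?_
    obtain ⟨x, rfl⟩ := Br_surjective act P x
    change Br act P (fixedAct act P 1 x) = Br act P x
    congr 1
    refine Subtype.ext ?_
    change act (1 : H) (x : B) = x
    rw [map_one, AlgHom.one_apply]
  map_mul' n m := by
    refine AlgHom.ext fun x => ?_
    obtain ⟨x, rfl⟩ := Br_surjective act P x
    change Br act P (fixedAct act P (n * m) x) = Br act P (fixedAct act P n (fixedAct act P m x))
    congr 1
    refine Subtype.ext ?_
    change act ((n * m : Subgroup.normalizer (P : Set H)) : H) (x : B) = act n (act m (x : B))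
    rw [Subgroup.coe_mul, map_mul, AlgHom.mul_apply]

theorem brauerAct_Br (P : Subgroup H) (n : Subgroup.normalizer (P : Set H))
    (x : fixedPts act P) : brauerAct act P n (Br act P x) = Br act P (fixedAct act P n x) := rfl

end Brauer

end BlockExt

namespace BlockExt

/-- The stabilizer of `b` in a group `L` acting on `B`. -/
def stab {O L B : Type*} [CommRing O] [Group L] [Ring B] [Algebra O B]
    (act : L →* (B →ₐ[O] B)) (b : B) : Subgroup L where
  carrier := {l | act l b = b}
  one_mem' := by simp
  mul_mem' := fun {l m} hl hm => by
    change act (l * m) b = b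
    rw [map_mul, AlgHom.mul_apply, hm, hl]
  inv_mem' := fun {l} hl => by
    have h : act l b = b := hl
    change act l⁻¹ b = b
    conv_lhs => rw [← h]
    rw [← AlgHom.mul_apply, ← map_mul, inv_mul_cancel, map_one, AlgHom.one_apply]

/-- The conjugation action of `N_H(P)` on `C_H(P)`. -/
def conjCentralizer {H : Type*} [Group H] (P : Subgroup H) :
    Subgroup.normalizer (P : Set H) →* MulAut (Subgroup.centralizer (P : Set H)) where
  toFun n :=
    { toFun := fun c => ⟨n * c * (n : H)⁻¹, by
        rw [Subgroup.mem_centralizer_iff]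
        intro x hx
        have h := Subgroup.mem_centralizer_iff.1 c.2 _ (inv_conj_mem_of_normalizer n.2 hx)
        have h2 := congrArg (fun y => (n : H) * y * (n : H)⁻¹) h
        simpa [mul_assoc] using h2⟩
      invFun := fun c => ⟨(n : H)⁻¹ * c * n, by
        rw [Subgroup.mem_centralizer_iff]
        intro x hx
        have h := Subgroup.mem_centralizer_iff.1 c.2 _ (conj_mem_of_normalizer n.2 hx)
        have h2 := congrArg (fun y => (n : H)⁻¹ * y * (n : H)) h
        simpa [mul_assoc] using h2⟩
      left_inv := fun c => Subtype.ext (by simp [mul_assoc])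
      right_inv := fun c => Subtype.ext (by simp [mul_assoc])
      map_mul' := fun c d => Subtype.ext (by simp) }
  map_one' := by ext c; simp
  map_mul' n m := by ext c; simp [mul_assoc]

theorem conjCentralizer_coe {H : Type*} [Group H] (P : Subgroup H)
    (n : Subgroup.normalizer (P : Set H)) (c : Subgroup.centralizer (P : Set H)) :
    (conjCentralizer P n c : H) = n * c * (n : H)⁻¹ := rfl

/-- The natural homomorphism `C_H(P)/C_K(P) → H/K`. -/
def centralizerMap {H : Type*} [Group H] (K P : Subgroup H) [K.Normal] :
    Subgroup.centralizer (P : Set H) ⧸ K.subgroupOf (Subgroup.centralizer (P : Set H)) →* H ⧸ K :=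
  QuotientGroup.map _ K (Subgroup.centralizer (P : Set H)).subtype le_rfl

namespace InteriorAlgebra

variable {O H : Type*} [CommRing O] [Group H] {K : Subgroup H} [hK : K.Normal]
  {B : Type*} [Ring B] [Algebra O B] (𝒜 : InteriorAlgebra O K B)

/-- `b` is a primitive idempotent of `B^K` that lies in the center of `B`. -/
structure IsBlock (b : B) : Prop where
  mem_fixed : b ∈ fixedPts 𝒜.act K
  ne_zero : b ≠ 0
  idem : b * b = b
  primitive : ∀ e ∈ fixedPts 𝒜.act K, ∀ f ∈ fixedPts 𝒜.act K, e * e = e → f * f = f →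
    e * f = 0 → f * e = 0 → e + f = b → e = 0 ∨ f = 0
  central : ∀ a : B, b * a = a * b

/-- `P ≤ K` is a defect group of `b`: `b ∈ B_P^K` and `Br_P(b) ≠ 0`. -/
structure IsDefectGroup [Finite H] [IsLocalRing O] (b : B) (P : Subgroup H) : Prop where
  le : P ≤ K
  mem_trace : b ∈ traceImage 𝒜.act P K
  br_ne_zero : ∃ h : b ∈ fixedPts 𝒜.act P, Br 𝒜.act P ⟨b, h⟩ ≠ 0

/-- The stabilizer `H_b` of `b` in `H`. -/
abbrev stabH (b : B) : Subgroup H := stab 𝒜.act b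

/-- The stabilizer `G_b` of `b` in `G = H/K`. -/
def stabG (b : B) : Subgroup (H ⧸ K) := (𝒜.stabH b).map (QuotientGroup.mk' K)

/-- The stabilizer `N_H(P)_b` of `b` in `N_H(P)`. -/
def normStab (b : B) (P : Subgroup H) : Subgroup H :=
  Subgroup.normalizer (P : Set H) ⊓ 𝒜.stabH b

/-- The image `N_H(P)_b K / K` of `N_H(P)_b` in `G = H/K`. -/
def normImage (b : B) (P : Subgroup H) : Subgroup (H ⧸ K) :=
  (𝒜.normStab b P).map (QuotientGroup.mk' K)

theorem normImage_le (b : B) (P : Subgroup H) : 𝒜.normImage b P ≤ 𝒜.stabG b :=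
  Subgroup.map_mono inf_le_right

variable {𝒜}

theorem IsBlock.le_stabH {b : B} (hb : 𝒜.IsBlock b) : K ≤ 𝒜.stabH b := fun k hk =>
  hb.mem_fixed k hk

theorem IsBlock.act_of_mem_stabG {b : B} (hb : 𝒜.IsBlock b) {x : H}
    (hx : (x : H ⧸ K) ∈ 𝒜.stabG b) : 𝒜.act x b = b := by
  obtain ⟨y, hy, hxy⟩ := hx
  have h : y⁻¹ * x ∈ 𝒜.stabH b := hb.le_stabH (QuotientGroup.eq.1 hxy)
  have h2 : x ∈ 𝒜.stabH b := by simpa using (𝒜.stabH b).mul_mem hy h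
  exact h2

theorem IsBlock.mem_fixedPts_of_le {b : B} (hb : 𝒜.IsBlock b) {P : Subgroup H} (hP : P ≤ K) :
    b ∈ fixedPts 𝒜.act P := fixedPts_mono _ hP hb.mem_fixed

theorem conjSym_base {b : B} {l : H} (hl : l ∈ 𝒜.stabH b) {σ : H ⧸ K} (hσ : σ ∈ 𝒜.stabG b) :
    𝒜.conjSym.onQuot l σ ∈ 𝒜.stabG b := by
  obtain ⟨y, hy, rfl⟩ := hσ
  exact ⟨l * y * l⁻¹, (𝒜.stabH b).mul_mem ((𝒜.stabH b).mul_mem hl hy) ((𝒜.stabH b).inv_mem hl), rfl⟩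

variable [Finite H]

/-- The element `b ⊗ 1` of `A` commutes with the components of degree in `G_b`. -/
theorem IsBlock.tmul_comm {b : B} (hb : 𝒜.IsBlock b) {σ : H ⧸ K} (hσ : σ ∈ 𝒜.stabG b)
    {f : 𝒜.Crossed} (hf : f ∈ Crossed.grad 𝒜 σ) :
    Crossed.tmul 𝒜 b 1 * f = f * Crossed.tmul 𝒜 b 1 := by
  induction σ using QuotientGroup.induction_on with | _ x
  rw [Crossed.eq_tmul hf, Crossed.tmul_mul_tmul, Crossed.tmul_mul_tmul, map_one, AlgHom.one_apply,
    one_mul, mul_one, hb.act_of_mem_stabG hσ, hb.central]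

theorem crossedAct_tmul (h : H) (a : B) (x : H) :
    𝒜.crossedAct h (Crossed.tmul 𝒜 a x) = Crossed.tmul 𝒜 (𝒜.act h a) (h * x * h⁻¹) :=
  𝒜.conjSym.crossed_tmul h a x

theorem crossedAct_tmul_one (h : H) {b : B} (hb : 𝒜.act h b = b) :
    𝒜.crossedAct h (Crossed.tmul 𝒜 b 1) = Crossed.tmul 𝒜 b 1 := by
  rw [crossedAct_tmul, hb]; simp

theorem tmul_mul_tmul_one {b : B} (hb : b * b = b) :
    Crossed.tmul 𝒜 b 1 * Crossed.tmul 𝒜 b 1 = Crossed.tmul 𝒜 b 1 := by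
  rw [Crossed.tmul_mul_tmul]; simp [hb]

/-- The datum of the Clifford extension of `b`: the components are `C_σ = b (A_σ)^K`, `σ ∈ G_b`, and
`H_b` acts by conjugation (`K` acts trivially, so this is an action of `G_b`). -/
noncomputable def blockDatum {b : B} (hb : 𝒜.IsBlock b) :
    CliffordDatum O (H ⧸ K) (𝒜.stabH b) 𝒜.Crossed where
  grad := Crossed.grad 𝒜
  mul_mem_grad := Crossed.mul_mem_grad
  fix := fixedPts 𝒜.crossedAct K
  e := Crossed.tmul 𝒜 b 1
  e_mem_grad := Crossed.tmul_mem_grad b 1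
  e_mem_fix := fun k hk => crossedAct_tmul_one k (hb.mem_fixed k hk)
  e_mul_e := tmul_mul_tmul_one hb.idem
  base := 𝒜.stabG b
  e_comm := fun hσ hx => hb.tmul_comm hσ hx
  actB := 𝒜.crossedAct.comp (𝒜.stabH b).subtype
  actΓ := 𝒜.conjSym.onQuot.comp (𝒜.stabH b).subtype
  act_grad := fun l _ _ hx => 𝒜.conjSym.crossed_mem l hx
  act_fix := fun l _ hx =>
    fixedPts_map (l : H) (fun q hq => by simpa using hK.conj_mem q hq (l : H)⁻¹) hx
  act_e := fun l => crossedAct_tmul_one (l : H) l.2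
  act_base := fun l _ hσ => conjSym_base l.2 hσ

theorem tmul_mem_fixedPts {b : B} (hb : 𝒜.IsBlock b) {P : Subgroup H} (hP : P ≤ K) :
    Crossed.tmul 𝒜 b 1 ∈ fixedPts 𝒜.crossedAct P :=
  fun k hk => crossedAct_tmul_one k (hb.mem_fixed k (hP hk))

variable [IsLocalRing O]

/-- `b̄ = Br_P(b)`, an element of `A_1(P)`. -/
noncomputable def bbar {b : B} (hb : 𝒜.IsBlock b) {P : Subgroup H} (hP : P ≤ K) :
    BrauerQuot 𝒜.act P := Br 𝒜.act P ⟨b, hb.mem_fixedPts_of_le hP⟩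

variable (𝒜) in
/-- The component `A(P)_σ`, the image of `(A_σ)^P` under `Br_P`. -/
noncomputable def brauerGrad (P : Subgroup H) (σ : H ⧸ K) :
    Submodule O (BrauerQuot 𝒜.crossedAct P) :=
  ((Crossed.grad 𝒜 σ).comap (fixedPts 𝒜.crossedAct P).val.toLinearMap).map
    (Br 𝒜.crossedAct P).toLinearMap

theorem brauerAct_mem_fixedPts {O H B : Type*} [CommRing O] [Group H] [Ring B] [Algebra O B]
    {K N : Subgroup H} [hK : K.Normal] {act : N →* (B →ₐ[O] B)} (n : N) {x : B}
    (hx : x ∈ fixedPts act (K.subgroupOf N)) : act n x ∈ fixedPts act (K.subgroupOf N) :=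
  fixedPts_map n (fun q hq => by
    rw [Subgroup.mem_subgroupOf] at hq ⊢
    simpa using hK.conj_mem _ hq (n : H)⁻¹) hx

/-- The datum of the extension given by the Brauer quotient `A(P)`: the components are
`E_σ = b̄ A(P)_σ^{N_K(P)}`, `σ ∈ G_b`, and `N_H(P)_b` acts. -/
noncomputable def brauerDatum {b : B} (hb : 𝒜.IsBlock b) {P : Subgroup H} (hP : P ≤ K) :
    CliffordDatum O (H ⧸ K) (𝒜.normStab b P) (BrauerQuot 𝒜.crossedAct P) where
  grad := 𝒜.brauerGrad P
  mul_mem_grad := by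
    rintro σ τ _ _ ⟨x, hx, rfl⟩ ⟨y, hy, rfl⟩
    exact ⟨x * y, Crossed.mul_mem_grad hx hy, map_mul (Br 𝒜.crossedAct P) x y⟩
  fix := fixedPts (brauerAct 𝒜.crossedAct P) (K.subgroupOf (Subgroup.normalizer (P : Set H)))
  e := Br 𝒜.crossedAct P ⟨Crossed.tmul 𝒜 b 1, tmul_mem_fixedPts hb hP⟩
  e_mem_grad := ⟨_, Crossed.tmul_mem_grad b 1, rfl⟩
  e_mem_fix := fun n hn => congrArg (Br 𝒜.crossedAct P)
    (Subtype.ext (crossedAct_tmul_one (n : H) (hb.mem_fixed _ hn)))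
  e_mul_e := by
    rw [← map_mul]
    exact congrArg (Br 𝒜.crossedAct P) (Subtype.ext (tmul_mul_tmul_one hb.idem))
  base := 𝒜.stabG b
  e_comm := by
    rintro σ _ hσ ⟨x, hx, rfl⟩
    change Br 𝒜.crossedAct P _ * Br 𝒜.crossedAct P x = Br 𝒜.crossedAct P x * Br 𝒜.crossedAct P _
    rw [← map_mul, ← map_mul]
    exact congrArg (Br 𝒜.crossedAct P) (Subtype.ext (hb.tmul_comm hσ hx))
  actB := (brauerAct 𝒜.crossedAct P).comp (Subgroup.inclusion inf_le_left)
  actΓ := 𝒜.conjSym.onQuot.comp (𝒜.normStab b P).subtype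
  act_grad := by
    rintro l σ _ ⟨x, hx, rfl⟩
    exact ⟨fixedAct 𝒜.crossedAct P (Subgroup.inclusion inf_le_left l) x,
      𝒜.conjSym.crossed_mem (l : H) hx, rfl⟩
  act_fix := fun l _ hx => brauerAct_mem_fixedPts _ hx
  act_e := fun l => congrArg (Br 𝒜.crossedAct P)
    (Subtype.ext (crossedAct_tmul_one (l : H) (inf_le_right (a := Subgroup.normalizer _) l.2)))
  act_base := fun l _ hσ => conjSym_base (inf_le_right (a := Subgroup.normalizer _) l.2) hσ

variable (𝒜) in
/-- The Brauer quotient `A_1(P)` as a `C_K(P)`-interior `C_H(P)`-algebra. -/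
noncomputable def brauerInterior (P : Subgroup H) :
    InteriorAlgebra O (K.subgroupOf (Subgroup.centralizer (P : Set H))) (BrauerQuot 𝒜.act P) where
  act := (brauerAct 𝒜.act P).comp (Subgroup.inclusion (Subgroup.centralizer_le_normalizer _))
  unit := MonoidHom.toHomUnits
    { toFun := fun k => Br 𝒜.act P ⟨𝒜.unit ⟨k, Subgroup.mem_subgroupOf.1 k.2⟩, fun q hq => by
        rw [𝒜.act_unit]
        congr 2
        refine Subtype.ext ?_
        have h := Subgroup.mem_centralizer_iff.1 (k : Subgroup.centralizer (P : Set H)).2 q hq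
        exact mul_inv_eq_of_eq_mul h⟩
      map_one' := by
        rw [← map_one (Br 𝒜.act P)]
        exact congrArg (Br 𝒜.act P) (Subtype.ext (by
          exact congrArg Units.val (map_one 𝒜.unit)))
      map_mul' := fun k l => by
        rw [← map_mul (Br 𝒜.act P)]
        exact congrArg (Br 𝒜.act P) (Subtype.ext (by
          exact congrArg Units.val (map_mul 𝒜.unit ⟨k, Subgroup.mem_subgroupOf.1 k.2⟩ ⟨l, Subgroup.mem_subgroupOf.1 l.2⟩))) }
  act_unit := fun h x => congrArg (Br 𝒜.act P) (Subtype.ext (𝒜.act_unit (h : H) ⟨x, Subgroup.mem_subgroupOf.1 x.2⟩))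
  act_coe := fun x a => by
    obtain ⟨a, rfl⟩ := Br_surjective 𝒜.act P a
    refine congrArg (Br 𝒜.act P) (Subtype.ext ((𝒜.act_coe ⟨x, Subgroup.mem_subgroupOf.1 x.2⟩ (a : B)).trans ?_))
    change _ = _ * (𝒜.unit ⟨_, _⟩ : B)
    rw [← map_inv]
    rfl

variable (𝒜) in
/-- `N_H(P)` acts on `A_1(P)` and, by conjugation, on `C_H(P)`. -/
noncomputable def brauerSym (P : Subgroup H) :
    (𝒜.brauerInterior P).Sym (Subgroup.normalizer (P : Set H)) where
  onB := brauerAct 𝒜.act P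
  onH := conjCentralizer P
  onH_mem n k hk := hK.conj_mem _ hk n
  onB_unit n k := congrArg (Br 𝒜.act P) (Subtype.ext (𝒜.act_unit (n : H) ⟨k, Subgroup.mem_subgroupOf.1 k.2⟩))
  onB_act n h a := by
    change brauerAct 𝒜.act P n (brauerAct 𝒜.act P _ a) =
      brauerAct 𝒜.act P _ (brauerAct 𝒜.act P n a)
    rw [← AlgHom.mul_apply, ← AlgHom.mul_apply, ← map_mul, ← map_mul]
    congr 2
    ext
    simp [conjCentralizer_coe]

variable (𝒜) in
/-- The algebra `R = A_1(P) ⊗_{k C_K(P)} k C_H(P) = ⨁ A_1(P) ⊗ x`, graded by `C_H(P)/C_K(P)`. -/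
abbrev BrauerCrossed (P : Subgroup H) : Type _ := (𝒜.brauerInterior P).Crossed

/-- The stabilizer `C_H(P)_b̄ / C_K(P)` of `b̄` in `C_H(P)/C_K(P)`. -/
noncomputable def centralizerBase {b : B} (hb : 𝒜.IsBlock b) {P : Subgroup H} (hP : P ≤ K) :
    Subgroup (Subgroup.centralizer (P : Set H) ⧸
      K.subgroupOf (Subgroup.centralizer (P : Set H))) :=
  (stab (𝒜.brauerInterior P).act (bbar hb hP)).map (QuotientGroup.mk' _)

theorem bbar_fixed {b : B} (hb : 𝒜.IsBlock b) {P : Subgroup H} (hP : P ≤ K)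
    (n : Subgroup.normalizer (P : Set H)) (hn : 𝒜.act (n : H) b = b) :
    brauerAct 𝒜.act P n (bbar hb hP) = bbar hb hP :=
  congrArg (Br 𝒜.act P) (Subtype.ext hn)

theorem bbar_central {b : B} (hb : 𝒜.IsBlock b) {P : Subgroup H} (hP : P ≤ K)
    (a : BrauerQuot 𝒜.act P) : bbar hb hP * a = a * bbar hb hP := by
  obtain ⟨a, rfl⟩ := Br_surjective 𝒜.act P a
  exact congrArg (Br 𝒜.act P) (Subtype.ext (hb.central (a : B)))

theorem bbar_idem {b : B} (hb : 𝒜.IsBlock b) {P : Subgroup H} (hP : P ≤ K) :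
    bbar hb hP * bbar hb hP = bbar hb hP :=
  congrArg (Br 𝒜.act P) (Subtype.ext hb.idem)

theorem act_bbar_of_mem_base {b : B} (hb : 𝒜.IsBlock b) {P : Subgroup H} (hP : P ≤ K)
    {x : Subgroup.centralizer (P : Set H)}
    (hx : (QuotientGroup.mk x : Subgroup.centralizer (P : Set H) ⧸
      K.subgroupOf (Subgroup.centralizer (P : Set H))) ∈ centralizerBase hb hP) :
    (𝒜.brauerInterior P).act x (bbar hb hP) = bbar hb hP := by
  obtain ⟨y, hy, hxy⟩ := hx
  have h0 : y⁻¹ * x ∈ K.subgroupOf (Subgroup.centralizer (P : Set H)) := QuotientGroup.eq.1 hxy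
  have h : y⁻¹ * x ∈ stab (𝒜.brauerInterior P).act (bbar hb hP) :=
    bbar_fixed hb hP _ (hb.mem_fixed _ (Subgroup.mem_subgroupOf.1 h0))
  have h2 : x ∈ stab (𝒜.brauerInterior P).act (bbar hb hP) := by
    simpa using (stab (𝒜.brauerInterior P).act (bbar hb hP)).mul_mem hy h
  exact h2

theorem brauerSym_tmul_one {b : B} (hb : 𝒜.IsBlock b) {P : Subgroup H} (hP : P ≤ K)
    (n : Subgroup.normalizer (P : Set H)) (hn : 𝒜.act (n : H) b = b) :
    (𝒜.brauerSym P).crossed n (Crossed.tmul (𝒜.brauerInterior P) (bbar hb hP) 1) =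
      Crossed.tmul (𝒜.brauerInterior P) (bbar hb hP) 1 := by
  rw [Sym.crossed_tmul, map_one]
  exact congrArg (fun x => Crossed.tmul (𝒜.brauerInterior P) x 1) (bbar_fixed hb hP n hn)

/-- The datum of the extension given by `R`: the components are `D_τ = b̄ (R_τ)^{N_K(P)}`,
`τ ∈ C_H(P)_b̄ / C_K(P)`, and `N_H(P)_b` acts. -/
noncomputable def centralizerDatum {b : B} (hb : 𝒜.IsBlock b) {P : Subgroup H} (hP : P ≤ K) :
    CliffordDatum O (Subgroup.centralizer (P : Set H) ⧸
      K.subgroupOf (Subgroup.centralizer (P : Set H))) (𝒜.normStab b P) (𝒜.BrauerCrossed P) where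
  grad := Crossed.grad (𝒜.brauerInterior P)
  mul_mem_grad := Crossed.mul_mem_grad
  fix := fixedPts (𝒜.brauerSym P).crossed (K.subgroupOf (Subgroup.normalizer (P : Set H)))
  e := Crossed.tmul (𝒜.brauerInterior P) (bbar hb hP) 1
  e_mem_grad := Crossed.tmul_mem_grad _ 1
  e_mem_fix := fun n hn => brauerSym_tmul_one hb hP n (hb.mem_fixed _ hn)
  e_mul_e := tmul_mul_tmul_one (bbar_idem hb hP)
  base := centralizerBase hb hP
  e_comm := by
    intro τ f hτ hf
    induction τ using QuotientGroup.induction_on with | _ x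
    rw [Crossed.eq_tmul hf, Crossed.tmul_mul_tmul, Crossed.tmul_mul_tmul, map_one,
      AlgHom.one_apply, one_mul, mul_one, act_bbar_of_mem_base hb hP hτ, bbar_central]
  actB := (𝒜.brauerSym P).crossed.comp (Subgroup.inclusion inf_le_left)
  actΓ := (𝒜.brauerSym P).onQuot.comp (Subgroup.inclusion inf_le_left)
  act_grad := fun l _ _ hx => (𝒜.brauerSym P).crossed_mem _ hx
  act_fix := fun l _ hx => brauerAct_mem_fixedPts _ hx
  act_e := fun l => brauerSym_tmul_one hb hP _ (inf_le_right (a := Subgroup.normalizer _) l.2)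
  act_base := by
    rintro l _ ⟨y, hy, rfl⟩
    refine ⟨conjCentralizer P (Subgroup.inclusion inf_le_left l) y, ?_, rfl⟩
    have h1 : brauerAct 𝒜.act P (Subgroup.inclusion inf_le_left l) (bbar hb hP) = bbar hb hP :=
      bbar_fixed hb hP _ (inf_le_right (a := Subgroup.normalizer _) l.2)
    have h2 := (𝒜.brauerSym P).onB_act (Subgroup.inclusion inf_le_left l) y (bbar hb hP)
    have h3 : (𝒜.brauerInterior P).act y (bbar hb hP) = bbar hb hP := hy
    have h4 : (𝒜.brauerSym P).onB (Subgroup.inclusion inf_le_left l) (bbar hb hP) =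
      bbar hb hP := h1
    rw [h3, h4] at h2
    exact h2.symm

/-- The stabilizer `N_H(P)_b̄` of `b̄ = Br_P(b)` in `N_H(P)`. -/
noncomputable def normStabBar {b : B} (hb : 𝒜.IsBlock b) {P : Subgroup H} (hP : P ≤ K) :
    Subgroup H :=
  (stab (brauerAct 𝒜.act P) (bbar hb hP)).map (Subgroup.normalizer (P : Set H)).subtype

/-- The group `G[b] = {σ ∈ G_b | (b A_σ)^K (b A_{σ⁻¹})^K = (b A_1)^K}`. -/
noncomputable def blockGroup {b : B} (hb : 𝒜.IsBlock b) : Subgroup (H ⧸ K) :=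
  (blockDatum hb).strong

/-- The group `G[b̄]` of the `σ ∈ G_b` such that
`b̄ A(P)_σ^{N_K(P)} · b̄ A(P)_{σ⁻¹}^{N_K(P)} = b̄ A(P)_1^{N_K(P)}`. -/
noncomputable def brauerGroup {b : B} (hb : 𝒜.IsBlock b) {P : Subgroup H} (hP : P ≤ K) :
    Subgroup (H ⧸ K) :=
  (brauerDatum hb hP).strong

/-- The group `N̄_H(P)[b̄]` of the `σ ∈ N_H(P)_b K / K` such that
`b̄ A(P)_σ^{N_K(P)} · b̄ A(P)_{σ⁻¹}^{N_K(P)} = b̄ A(P)_1^{N_K(P)}`. -/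
noncomputable def normalizerGroup {b : B} (hb : 𝒜.IsBlock b) {P : Subgroup H} (hP : P ≤ K) :
    Subgroup (H ⧸ K) :=
  𝒜.normImage b P ⊓ brauerGroup hb hP

theorem mem_normalizerGroup {b : B} (hb : 𝒜.IsBlock b) {P : Subgroup H} (hP : P ≤ K)
    {σ : H ⧸ K} : σ ∈ normalizerGroup hb hP ↔ σ ∈ 𝒜.normImage b P ∧
      (brauerDatum hb hP).comp σ * (brauerDatum hb hP).comp σ⁻¹ = (brauerDatum hb hP).comp 1 :=
  ⟨fun h => ⟨h.1, h.2.2⟩, fun h => ⟨h.1, normImage_le _ _ _ h.1, h.2⟩⟩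

end InteriorAlgebra

end BlockExt

open BlockExt BlockExt.InteriorAlgebra

/-! The three extensions are instances of one construction, applied to a `CliffordDatum`, so the
theorem reduces to one statement about a `Morphism` of such data that is onto in each degree of its
source. Suppose that the identity component `C_1` of the source is local. Then the identity
component of the target, a nonzero quotient of `C_1`, is local too. A surjection from a local ring
onto a nonzero ring reflects units, and the Jacobson radical of a local ring is its set of nonunits,
so the radicals correspond (`Morphism.onC₁_mem_jacobson`) and the two residue rings agree. Lifting a
decomposition of the target identity and correcting it by a unit of `C_1` shows that strong degrees
are reflected (`Morphism.mem_strong_iff`).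

Over a local identity component, every strong degree contains a homogeneous unit (`exists_unit`).
This gives exactness of the extension, and also a test for membership in the ideal generated by the
radical: `x` lies in it exactly when the identity part of every `x * y` lies in the radical
(`Grading.mem_radIdeal_iff`). The test transfers along a morphism, so the map of quotient algebras
is injective, and it is onto in each strong degree of its source.

Locality starts with `b`: the algebra `b A_1^K` is finite over a complete Noetherian local ring, and
since `b` is primitive it has no idempotents but zero and `b`.

Two morphisms then give the result. The first is `Br_P` restricted to `A^K`. It is onto because `b =
Tr_P^K(a)`: if `Br_P(y)` is fixed by `N_K(P)`, the Mackey formula modulo the kernel of `Br_P` gives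
`Br_P(Tr_P^K(a y)) = Br_P(b) Br_P(y)` (`relTrace_mul_sub_mem`). The second is `R → A(P)`, `Br_P(a) ⊗
x ↦ Br_P(a ⊗ x)`. It is injective because taking the coefficient at an element of `C_H(P)` is
`P`-equivariant and so descends to Brauer quotients, and it is bijective in each degree coming from
`C_H(P)`.

The stabilizer statements rest on two facts. A block and its conjugate satisfy `b · ʰb = 0` or `b ·
ʰb = b`, and `Br_P` can tell these cases apart. For `h` fixing `b`, the block is also a trace from
`hPh⁻¹`, so a Frattini argument moves `h` into `N_H(P)` by an element of `K`. -/

namespace BlockExt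

/-! ### Units and the radical of a noncommutative local ring. -/

section LocalRing

variable {R : Type*} [Ring R] [IsLocalRing R]

/-- The element `b * a` is idempotent, and it or its complement is a unit. A unit idempotent is `1`;
if `1 - b * a` is a unit, then `a * (1 - b * a) = 0` forces `a = 0`. -/
theorem mul_eq_one_symm_of_isLocalRing {a b : R} (h : a * b = 1) : b * a = 1 := by
  have hi : b * a * (b * a) = b * a := by
    rw [mul_assoc, ← mul_assoc a, h, one_mul]
  rcases IsLocalRing.isUnit_or_isUnit_of_add_one (add_sub_cancel (b * a) 1) with hu | hu
  · exact (hu.mul_left_cancel (by rw [hi, mul_one]))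
  · have h0 : a * (1 - b * a) = 0 := by rw [mul_sub, ← mul_assoc, h]; simp
    have ha : a = 0 := by simpa using (hu.mul_left_eq_zero).1 h0
    rw [ha, zero_mul] at h
    exact absurd h zero_ne_one

theorem isUnit_of_mul_isUnit_left_of_isLocalRing {a b : R} (h : IsUnit (a * b)) : IsUnit a := by
  obtain ⟨u, hu⟩ := h
  have h1 : a * (b * (u⁻¹ : Rˣ)) = 1 := by rw [← mul_assoc, ← hu, Units.mul_inv]
  exact ⟨⟨a, _, h1, mul_eq_one_symm_of_isLocalRing h1⟩, rfl⟩

theorem isUnit_of_mul_isUnit_right_of_isLocalRing {a b : R} (h : IsUnit (a * b)) : IsUnit b := by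
  obtain ⟨u, hu⟩ := h
  have h1 : ((u⁻¹ : Rˣ) * a) * b = 1 := by rw [mul_assoc, ← hu, Units.inv_mul]
  exact ⟨⟨b, _, mul_eq_one_symm_of_isLocalRing h1, h1⟩, rfl⟩

/-- One-sided factors of units are units here, so for a nonunit `x` every multiple `y * x` is a
nonunit and `1 + y * x` is a unit, which is the criterion for the radical. -/
theorem mem_jacobson_iff_not_isUnit {x : R} : x ∈ Ring.jacobson R ↔ ¬ IsUnit x := by
  rw [← Ideal.jacobson_bot, Ideal.mem_jacobson_iff]
  constructor
  · rintro h ⟨u, rfl⟩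
    -- Taking `y = -x⁻¹` in the criterion cancels both terms that contain `z` and leaves `-1 = 0`.
    obtain ⟨z, hz⟩ := h (-(u⁻¹ : Rˣ))
    simp [mul_assoc] at hz
  · intro hx y
    have hyx : ¬ IsUnit (-(y * x)) := fun h =>
      hx (isUnit_of_mul_isUnit_right_of_isLocalRing (a := -y) (by simpa using h))
    have hu : IsUnit (1 + y * x) :=
      (IsLocalRing.isUnit_or_isUnit_of_add_one (a := -(y * x)) (b := 1 + y * x)
        (by abel)).resolve_left hyx
    obtain ⟨u, hu⟩ := hu
    refine ⟨(u⁻¹ : Rˣ), ?_⟩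
    have h1 := Units.inv_mul u
    rw [hu, mul_add, mul_one] at h1
    rw [Ideal.mem_bot, mul_assoc, add_comm, h1, sub_self]

theorem isLocalRing_of_surjective {S F : Type*} [Ring S] [Nontrivial S] [FunLike F R S]
    [RingHomClass F R S] (f : F) (hf : Function.Surjective f) : IsLocalRing S where
  isUnit_or_isUnit_of_add_one {a b} h := by
    obtain ⟨a, rfl⟩ := hf a
    have hb : b = f (1 - a) := by rw [map_sub, map_one, ← h, add_sub_cancel_left]
    rw [hb]
    exact (IsLocalRing.isUnit_or_isUnit_of_add_one (add_sub_cancel a 1)).imp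
      (fun h => h.map f) (fun h => h.map f)

end LocalRing

/-! ### Idempotents and locality for finite algebras over a complete local ring. -/

section Complete

variable {O : Type*} [CommRing O]

/-- For finite `M` the completion of `M` is a quotient of the completion of `O` tensored with `M`.
On a pure tensor the first factor already comes from `O`, so the tensor comes from `M`. -/
theorem isPrecomplete_of_finite (I : Ideal O) [IsPrecomplete I O] (M : Type*) [AddCommGroup M]
    [Module O M] [Module.Finite O M] : IsPrecomplete I M := by
  rw [← AdicCompletion.of_surjective_iff]
  intro x
  obtain ⟨x, rfl⟩ := AdicCompletion.ofTensorProduct_surjective_of_finite I M x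
  induction x using TensorProduct.induction_on with
  | zero => exact ⟨0, by simp⟩
  | tmul r m =>
    obtain ⟨r, rfl⟩ := AdicCompletion.of_surjective I O r
    refine ⟨r • m, ?_⟩
    rw [AdicCompletion.ofTensorProduct_tmul, map_smul]
    ext n
    simp
    rfl
  | add x y hx hy =>
    obtain ⟨a, ha⟩ := hx
    obtain ⟨b, hb⟩ := hy
    exact ⟨a + b, by rw [map_add, map_add, ha, hb]⟩

theorem exists_isIdempotentElem_sub_mem {S : Type*} [CommRing S] (I : Ideal S) [HenselianRing S I]
    {a : S} (ha : a * a - a ∈ I) : ∃ e : S, e * e = e ∧ e - a ∈ I := by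
  open Polynomial in
  obtain ⟨e, he, hea⟩ := HenselianRing.is_henselian (I := I) (X ^ 2 - X : S[X])
    (by monicity!) a (by simpa [sq] using ha) (by
      -- The derivative at `a` is `2a - 1`, whose square is `1 + 4(a² - a)`; so it is its own
      -- inverse modulo `I`, in any characteristic.
      refine IsUnit.of_mul_eq_one (Ideal.Quotient.mk I (2 * a - 1)) ?_
      rw [← map_mul, ← map_one (Ideal.Quotient.mk I), Ideal.Quotient.eq]
      have : (X ^ 2 - X : S[X]).derivative.eval a = 2 * a - 1 := by simp [one_add_one_eq_two]
      rw [this]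
      have h2 : (2 * a - 1) * (2 * a - 1) - 1 = 4 * (a * a - a) := by ring
      rw [h2]
      exact I.mul_mem_left _ ha)
  refine ⟨e, ?_, hea⟩
  have : e ^ 2 - e = 0 := by simpa using he
  rw [← sq]
  exact sub_eq_zero.1 this

variable [IsNoetherianRing O] [IsLocalRing O] [IsAdicComplete (IsLocalRing.maximalIdeal O) O]

/-- Modulo the ideal generated by the maximal ideal of `O` the ring is Artinian, so some power of
`a` times a power of some `y` is idempotent there. It lifts by Hensel's lemma, and the lift is `0`
or `1`: in the first case `a` is nilpotent modulo an ideal inside the radical and `1 - a` is a unit,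
in the second `a` is a unit. -/
theorem isLocalRing_of_idempotents_of_comm {S : Type*} [CommRing S] [Algebra O S]
    [Module.Finite O S] [Nontrivial S] (h : ∀ e : S, e * e = e → e = 0 ∨ e = 1) :
    IsLocalRing S := by
  let m := IsLocalRing.maximalIdeal O
  let I := m.map (algebraMap O S)
  have hp : IsPrecomplete m S := isPrecomplete_of_finite m S
  have hc : IsAdicComplete m S := { }
  have hI : IsAdicComplete I S := (IsAdicComplete.map_algebraMap_iff m S).2 hc
  have hh : HenselianRing S I := inferInstance
  have hjac : I ≤ Ideal.jacobson ⊥ := hh.jac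
  have hart : IsArtinianRing (S ⧸ I) := by
    have : Module.Finite (O ⧸ m) (S ⧸ I) := inferInstance
    let : Field (O ⧸ m) := Ideal.Quotient.field m
    exact isArtinian_of_tower (O ⧸ m) inferInstance
  refine IsLocalRing.of_isUnit_or_isUnit_one_sub_self fun a => ?_
  -- The chain of ideals generated by powers of `a` stabilizes: `a ^ n = a ^ (n + 1) * y` modulo
  -- `I`.
  obtain ⟨n, y, hy⟩ := IsArtinian.exists_pow_succ_smul_dvd (Ideal.Quotient.mk I a)
    (1 : S ⧸ I)
  obtain ⟨y, rfl⟩ := Ideal.Quotient.mk_surjective y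
  have hstep : ∀ k, (Ideal.Quotient.mk I a) ^ (n + 1) =
      (Ideal.Quotient.mk I a) ^ (n + 1 + k) * (Ideal.Quotient.mk I y) ^ k := by
    intro k
    induction k with
    | zero => simp
    | succ k ih =>
      rw [smul_eq_mul, smul_eq_mul, mul_one, Nat.succ_eq_add_one] at hy
      calc _ = (Ideal.Quotient.mk I a) ^ n * (Ideal.Quotient.mk I a) ^ (k + 1) *
            (Ideal.Quotient.mk I y) ^ k := by rw [ih]; ring
        _ = _ := by rw [← hy]; ring
  -- With `k = n + 1` the exponents double, which makes `a ^ (n + 1) * y ^ (n + 1)` idempotent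
  -- modulo `I`. The positive exponent is needed to pass from a unit power to a unit at the end.
  have hN := hstep (n + 1)
  have hidem : (a ^ (n + 1) * y ^ (n + 1)) * (a ^ (n + 1) * y ^ (n + 1)) -
      a ^ (n + 1) * y ^ (n + 1) ∈ I := by
    rw [← Ideal.Quotient.eq]
    simp only [map_mul, map_pow]
    conv_rhs => rw [hN]
    ring
  obtain ⟨e, he, hea⟩ := exists_isIdempotentElem_sub_mem I hidem
  rcases h e he with rfl | rfl
  · right
    rw [zero_sub, neg_mem_iff] at hea
    have ha : a ^ (n + 1) ∈ I := by
      rw [← Ideal.Quotient.eq_zero_iff_mem, map_mul, map_pow, map_pow] at hea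
      rw [← Ideal.Quotient.eq_zero_iff_mem, map_pow, hN, pow_add, mul_assoc, hea, mul_zero]
    have hu : IsUnit (1 - a ^ (n + 1)) := by
      refine Ideal.isUnit_of_sub_one_mem_jacobson_bot _ (hjac ?_)
      simpa using ha
    rw [← mul_neg_geom_sum] at hu
    exact isUnit_of_mul_isUnit_left hu
  · left
    have hu : IsUnit (a ^ (n + 1) * y ^ (n + 1)) := by
      refine Ideal.isUnit_of_sub_one_mem_jacobson_bot _ (hjac ?_)
      rw [← neg_sub]
      exact neg_mem hea
    exact (isUnit_pow_succ_iff).1 (isUnit_of_mul_isUnit_left hu)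

/-- Each `a` lies in the commutative subalgebra `O[a]`, which is finite over the Noetherian ring `O`
and whose idempotents are idempotents of `A`. Hence `O[a]` is local, and `a` or `1 - a` is
invertible already there. -/
theorem isLocalRing_of_idempotents {A : Type*} [Ring A] [Algebra O A] [Module.Finite O A]
    [Nontrivial A] (h : ∀ e : A, e * e = e → e = 0 ∨ e = 1) : IsLocalRing A where
  isUnit_or_isUnit_of_add_one {a b} hab := by
    -- The subalgebra `O[a]` is used in the form `O[X]` modulo the kernel of evaluation at `a`.
    let f := Polynomial.aeval (R := O) a
    let g := Ideal.kerLiftAlg f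
    have hg : Function.Injective g := Ideal.kerLiftAlg_injective f
    have : Module.Finite O (Polynomial O ⧸ RingHom.ker f) := Module.Finite.of_injective g.toLinearMap hg
    have : Nontrivial (Polynomial O ⧸ RingHom.ker f) := g.toRingHom.domain_nontrivial
    have hl : IsLocalRing (Polynomial O ⧸ RingHom.ker f) := by
      refine isLocalRing_of_idempotents_of_comm (O := O) fun e he => ?_
      refine (h (g e) (by rw [← map_mul, he])).imp (fun h => ?_) fun h => ?_
      · exact hg (by rw [h, map_zero])
      · exact hg (by rw [h, map_one])
    have ha : g (Ideal.Quotient.mk _ Polynomial.X) = a := by simp [g, f]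
    have hb : b = g (1 - Ideal.Quotient.mk _ Polynomial.X) := by
      rw [map_sub, map_one, ha, ← hab, add_sub_cancel_left]
    rw [hb, ← ha]
    exact (IsLocalRing.isUnit_or_isUnit_of_add_one (add_sub_cancel _ 1)).imp
      (fun h => h.map g) (fun h => h.map g)

end Complete

end BlockExt

/-! ### Strongly graded algebras with local identity component. -/

namespace BlockExt

namespace CliffordDatum

variable {O Γ Λ B : Type*} [CommRing O] [Group Γ] [Group Λ] [Ring B] [Algebra O B]
  {S : CliffordDatum O Γ Λ B}

variable (S) in
/-- Projections of `B` onto the components `B_σ`. -/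
structure Grading where
  part : Γ → B →ₗ[O] B
  part_self : ∀ {σ : Γ} {x : B}, x ∈ S.grad σ → part σ x = x
  part_of_ne : ∀ {σ τ : Γ} {x : B}, x ∈ S.grad τ → τ ≠ σ → part σ x = 0

variable [Finite Γ]

theorem ext_val {x y : S.C} (h : S.val x = S.val y) : x = y := S.val_injective h

variable (S) in
/-- An element of `B` as an element of `C`. -/
def toC (x : B) (hx : x ∈ S.sub) : S.C := (⟨x, hx⟩ : ↥S.sub)

theorem val_toC (x : B) (hx : x ∈ S.sub) : S.val (S.toC x hx) = x := rfl

theorem mul_mem_Ccomp {σ τ : Γ} {x y : S.C} (hx : x ∈ S.Ccomp σ) (hy : y ∈ S.Ccomp τ) :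
    x * y ∈ S.Ccomp (σ * τ) := mul_mem_comp hx hy

theorem mul_mem_Ccomp_one {σ : Γ} {x y : S.C} (hx : x ∈ S.Ccomp σ) (hy : y ∈ S.Ccomp σ⁻¹) :
    x * y ∈ S.Ccomp 1 := by
  simpa using mul_mem_Ccomp hx hy

theorem mul_mem_Ccomp_one_of_eq {σ τ : Γ} {x y : S.C} (hx : x ∈ S.Ccomp σ) (hy : y ∈ S.Ccomp τ)
    (h : σ * τ = 1) : x * y ∈ S.Ccomp 1 := h ▸ mul_mem_Ccomp hx hy

theorem C_induction {p : S.C → Prop} (x : S.C)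
    (mem : ∀ σ ∈ S.strong, ∀ y ∈ S.Ccomp σ, p y) (zero : p 0)
    (add : ∀ y z, p y → p z → p (y + z)) : p x := by
  have h : ∃ h : S.val x ∈ S.sub, p (S.toC (S.val x) h) := by
    refine sub_induction (p := fun b => ∃ h : b ∈ S.sub, p (S.toC b h)) (S.val_mem x)
      (fun σ hσ y hy => ⟨comp_le_sub hσ hy, mem σ hσ _ hy⟩) ⟨S.sub.zero_mem, zero⟩ ?_
    rintro y z ⟨hy, hpy⟩ ⟨hz, hpz⟩
    exact ⟨S.sub.add_mem hy hz, add _ _ hpy hpz⟩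
  exact h.2

namespace Grading

variable (G : S.Grading)

/-- The projection of `C` onto its identity component. -/
def partOne : S.C →ₗ[O] S.C where
  toFun x := S.toC (G.part 1 (S.val x)) (by
    refine sub_induction (p := fun b => G.part 1 b ∈ S.sub) (S.val_mem x) (fun σ hσ y hy => ?_)
      (by rw [map_zero]; exact S.sub.zero_mem)
      (fun y z hy hz => by rw [map_add]; exact S.sub.add_mem hy hz)
    by_cases h : σ = 1
    · subst h
      rw [G.part_self (comp_grad hy)]
      exact comp_le_sub hσ hy
    · rw [G.part_of_ne (comp_grad hy) h]
      exact S.sub.zero_mem)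
  map_add' x y := ext_val (by simp [val_toC])
  map_smul' r x := ext_val (by simp [val_toC])

theorem partOne_of_mem_one {x : S.C} (hx : x ∈ S.Ccomp 1) : G.partOne x = x :=
  ext_val (G.part_self (comp_grad hx))

theorem partOne_of_ne {σ : Γ} (hσ : σ ≠ 1) {x : S.C} (hx : x ∈ S.Ccomp σ) : G.partOne x = 0 :=
  ext_val ((G.part_of_ne (comp_grad hx) hσ).trans (map_zero S.val).symm)

theorem partOne_mem (x : S.C) : G.partOne x ∈ S.Ccomp 1 := by
  refine C_induction (p := fun x => G.partOne x ∈ S.Ccomp 1) x (fun σ _ y hy => ?_)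
    (by rw [map_zero]; exact Submodule.zero_mem _)
    (fun y z hy hz => by rw [map_add]; exact Submodule.add_mem _ hy hz)
  by_cases h : σ = 1
  · subst h
    rwa [G.partOne_of_mem_one hy]
  · rw [G.partOne_of_ne h hy]
    exact Submodule.zero_mem _

theorem partOne_mul_left {c : S.C} (hc : c ∈ S.Ccomp 1) (x : S.C) :
    G.partOne (c * x) = c * G.partOne x := by
  refine C_induction (p := fun x => G.partOne (c * x) = c * G.partOne x) x (fun σ _ y hy => ?_)
    (by simp) (fun y z hy hz => by rw [mul_add, map_add, map_add, mul_add, hy, hz])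
  have h1 : c * y ∈ S.Ccomp σ := by simpa using mul_mem_Ccomp hc hy
  by_cases h : σ = 1
  · subst h
    rw [G.partOne_of_mem_one hy, G.partOne_of_mem_one h1]
  · rw [G.partOne_of_ne h hy, G.partOne_of_ne h h1, mul_zero]

theorem partOne_mul_right {c : S.C} (hc : c ∈ S.Ccomp 1) (x : S.C) :
    G.partOne (x * c) = G.partOne x * c := by
  refine C_induction (p := fun x => G.partOne (x * c) = G.partOne x * c) x (fun σ _ y hy => ?_)
    (by simp) (fun y z hy hz => by rw [add_mul, map_add, map_add, add_mul, hy, hz])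
  have h1 : y * c ∈ S.Ccomp σ := by simpa using mul_mem_Ccomp hy hc
  by_cases h : σ = 1
  · subst h
    rw [G.partOne_of_mem_one hy, G.partOne_of_mem_one h1]
  · rw [G.partOne_of_ne h hy, G.partOne_of_ne h h1, zero_mul]

/-- Conjugation by `σ` fixes the trivial degree and permutes the others, so it commutes with taking
the identity part. -/
theorem partOne_conj {σ : Γ} {u v : S.C} (hu : u ∈ S.Ccomp σ) (hv : v ∈ S.Ccomp σ⁻¹) (x : S.C) :
    G.partOne (u * x * v) = u * G.partOne x * v := by
  refine C_induction (p := fun x => G.partOne (u * x * v) = u * G.partOne x * v) x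
    (fun τ _ y hy => ?_) (by simp)
    (fun y z hy hz => by rw [mul_add, add_mul, map_add, map_add, mul_add, add_mul, hy, hz])
  have h1 : u * y * v ∈ S.Ccomp (σ * τ * σ⁻¹) := mul_mem_Ccomp (mul_mem_Ccomp hu hy) hv
  by_cases h : τ = 1
  · subst h
    rw [G.partOne_of_mem_one hy, G.partOne_of_mem_one (by simpa using h1)]
  · rw [G.partOne_of_ne h hy, G.partOne_of_ne (by simpa using h) h1, mul_zero, zero_mul]

/-- The identity part is a `C_1`-bimodule map, so the identity part of an inverse in `C` is again an
inverse. -/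
theorem isUnit_iff (G : S.Grading) {c : S.C₁} : IsUnit c ↔ IsUnit (c : S.C) := by
  refine ⟨fun h => h.map S.C₁.val, ?_⟩
  rintro ⟨u, hu⟩
  have h1 : (c : S.C) * G.partOne (u⁻¹ : S.Cˣ) = 1 := by
    rw [← G.partOne_mul_left c.2, ← hu, Units.mul_inv, G.partOne_of_mem_one S.e_mem_comp]
  have h2 : G.partOne (u⁻¹ : S.Cˣ) * (c : S.C) = 1 := by
    rw [← G.partOne_mul_right c.2, ← hu, Units.inv_mul, G.partOne_of_mem_one S.e_mem_comp]
  exact ⟨⟨c, ⟨_, G.partOne_mem _⟩, Subtype.ext h1, Subtype.ext h2⟩, rfl⟩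

theorem mem_jacobson_iff (G : S.Grading) [IsLocalRing S.C₁] {c : S.C₁} :
    c ∈ Ring.jacobson S.C₁ ↔ ¬ IsUnit (c : S.C) := by
  rw [mem_jacobson_iff_not_isUnit, G.isUnit_iff]

/-- The projection of `C` onto its identity component, as a map to `C_1`. -/
def toC₁ : S.C →ₗ[O] S.C₁ where
  toFun x := ⟨G.partOne x, G.partOne_mem x⟩
  map_add' x y := Subtype.ext (map_add G.partOne x y)
  map_smul' r x := Subtype.ext (map_smul G.partOne r x)

theorem coe_toC₁ (x : S.C) : (G.toC₁ x : S.C) = G.partOne x := rfl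

theorem toC₁_coe (x : S.C₁) : G.toC₁ (x : S.C) = x := Subtype.ext (G.partOne_of_mem_one x.2)

end Grading

theorem coe_mem_radIdeal {c : S.C₁} (hc : c ∈ Ring.jacobson S.C₁) : (c : S.C) ∈ S.radIdeal :=
  TwoSidedIdeal.subset_span ⟨c, hc, rfl⟩

theorem Cbar₁Map_surjOn {x : S.Cbar} (hx : x ∈ S.CbarComp 1) : ∃ a, S.Cbar₁Map a = x := by
  obtain ⟨x, hx, rfl⟩ := hx
  exact ⟨Ideal.Quotient.mk _ ⟨x, hx⟩, rfl⟩

section Units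

variable [IsLocalRing S.C₁]

/-- The identity is a sum of products `x * y` with factors in degrees `σ` and `σ⁻¹`. If all these
products were nonunits of `C_1` they would lie in its radical, and so would `1`. One invertible
product gives a homogeneous `x` with a homogeneous right inverse `v`. -/
theorem exists_unit {σ : Γ} (hσ : σ ∈ S.strong) :
    ∃ u : S.Cˣ, (u : S.C) ∈ S.Ccomp σ ∧ ((u⁻¹ : S.Cˣ) : S.C) ∈ S.Ccomp σ⁻¹ := by
  have h : ∃ x ∈ S.Ccomp σ, ∃ y ∈ S.Ccomp σ⁻¹, ∃ c : S.C₁, IsUnit c ∧ x * y = c := by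
    by_contra hn
    push Not at hn
    have h1 : S.e ∈ S.comp σ * S.comp σ⁻¹ := comp_mul_comp_inv_iff.1 hσ.2
    have h2 : ∃ c : S.C₁, c ∈ Ring.jacobson S.C₁ ∧ S.val c = S.e := by
      refine Submodule.mul_induction_on (C := fun b => ∃ c : S.C₁, c ∈ Ring.jacobson S.C₁ ∧
        S.val c = b) h1 (fun x hx y hy => ?_) ?_
      · let x' : S.C := S.toC x (comp_le_sub hσ hx)
        let y' : S.C := S.toC y (comp_le_sub (inv_mem hσ) hy)
        refine ⟨⟨x' * y', mul_mem_Ccomp_one hx hy⟩, ?_, rfl⟩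
        rw [mem_jacobson_iff_not_isUnit]
        exact fun hu => hn x' hx y' hy _ hu rfl
      · rintro _ _ ⟨c, hc, rfl⟩ ⟨d, hd, rfl⟩
        exact ⟨c + d, add_mem hc hd, map_add S.val (c : S.C) d⟩
    obtain ⟨c, hc, hce⟩ := h2
    have : c = 1 := Subtype.ext (ext_val hce)
    rw [mem_jacobson_iff_not_isUnit, this] at hc
    exact hc isUnit_one
  obtain ⟨x, hx, y, hy, _, ⟨w, rfl⟩, hxy⟩ := h
  let v : S.C := y * ((w⁻¹ : S.C₁ˣ) : S.C₁)
  have hv : v ∈ S.Ccomp σ⁻¹ := by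
    simpa using mul_mem_Ccomp hy ((w⁻¹ : S.C₁ˣ) : S.C₁).2
  have h1 : x * v = 1 := by
    rw [← mul_assoc, hxy]
    exact congrArg Subtype.val (Units.mul_inv w)
  -- The right inverse is two-sided: `v * x` is an idempotent of the local ring `C_1`, and a unit
  -- complement would annihilate `x`.
  let f : S.C₁ := ⟨v * x, mul_mem_Ccomp_one_of_eq hv hx (inv_mul_cancel σ)⟩
  have hf : f * f = f := Subtype.ext (by
    change v * x * (v * x) = v * x
    rw [mul_assoc, ← mul_assoc x, h1, one_mul])
  have hf1 : f = 1 := by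
    rcases IsLocalRing.isUnit_or_isUnit_of_add_one (add_sub_cancel f 1) with hu | hu
    · exact hu.mul_left_cancel (by rw [hf, mul_one])
    · exfalso
      have h2 : x * ((1 - f : S.C₁) : S.C) = 0 := by
        change x * (1 - v * x) = 0
        rw [mul_sub, ← mul_assoc, h1]; simp
      have hx0 : x = 0 := by
        have hu' : IsUnit ((1 - f : S.C₁) : S.C) := hu.map S.C₁.val
        exact (hu'.mul_left_eq_zero).1 h2
      rw [hx0, zero_mul] at h1
      exact one_ne_zero (α := S.C₁) (Subtype.ext h1.symm)
  exact ⟨⟨x, v, h1, congrArg Subtype.val hf1⟩, hx, hv⟩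

/-- The elements `x` for which every `x * y` has identity part in `J(C_1)` form a two-sided ideal
containing `J(C_1)`. Closure under left multiplication is the point that needs homogeneous units. -/
theorem Grading.mem_radIdeal (G : S.Grading) {x : S.C} (hx : x ∈ S.radIdeal) :
    G.toC₁ x ∈ Ring.jacobson S.C₁ := by
  let I : TwoSidedIdeal S.C := TwoSidedIdeal.mk' {x | ∀ y, G.toC₁ (x * y) ∈ Ring.jacobson S.C₁}
    (fun y => by simp)
    (fun {x z} hx hz y => by rw [add_mul, map_add]; exact add_mem (hx y) (hz y))
    (fun {x} hx y => by rw [neg_mul, map_neg]; exact neg_mem (hx y))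
    (fun {z x} hx => by
      refine C_induction (p := fun z => ∀ y, G.toC₁ (z * x * y) ∈ Ring.jacobson S.C₁) z ?_ ?_ ?_
      · intro σ hσ z hz y
        obtain ⟨u, hu, hu'⟩ := exists_unit hσ
        -- Write `z = c * u`, and `u * x * y` as the conjugate by `u` of `x * (y * u)`. Conjugation
        -- by `u` preserves nonunits, hence the radical, so the conjugated identity part `d` stays
        -- in `J(C_1)`.
        let c : S.C₁ := ⟨z * (u⁻¹ : S.Cˣ), mul_mem_Ccomp_one hz hu'⟩
        have h1 : G.toC₁ (x * (y * u)) ∈ Ring.jacobson S.C₁ := hx _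
        let d : S.C₁ := ⟨u * G.partOne (x * (y * u)) * (u⁻¹ : S.Cˣ),
          mul_mem_Ccomp_one_of_eq (mul_mem_Ccomp hu (G.partOne_mem _)) hu' (by simp)⟩
        have hd : d ∈ Ring.jacobson S.C₁ := by
          rw [G.mem_jacobson_iff] at h1 ⊢
          intro h
          apply h1
          have h2 : (G.toC₁ (x * (y * u)) : S.C) = (u⁻¹ : S.Cˣ) * (d : S.C) * u := by
            simp [d, mul_assoc, G.coe_toC₁]
          rw [h2]
          exact ((Units.isUnit _).mul h).mul (Units.isUnit _)
        have h3 : G.toC₁ (z * x * y) = c * d := by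
          refine Subtype.ext ?_
          change G.partOne (z * x * y) =
            z * (u⁻¹ : S.Cˣ) * (u * G.partOne (x * (y * u)) * (u⁻¹ : S.Cˣ))
          rw [← G.partOne_conj hu hu', ← G.partOne_mul_left (mul_mem_Ccomp_one hz hu')]
          simp [mul_assoc]
        rw [h3]
        exact Ideal.mul_mem_left _ _ hd
      · intro y; simp
      · intro a b ha hb y
        rw [add_mul, add_mul, map_add]
        exact add_mem (ha y) (hb y))
    (fun {x z} hx y => by rw [mul_assoc]; exact hx _)
  have hI : TwoSidedIdeal.span (Subtype.val '' (Ring.jacobson S.C₁ : Set S.C₁)) ≤ I := by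
    rw [TwoSidedIdeal.span_le]
    rintro _ ⟨c, hc, rfl⟩
    refine (TwoSidedIdeal.mem_mk' _ _ _ _ _ _ _).2 fun y => ?_
    have h1 : G.toC₁ (c * y) = c * G.toC₁ y := Subtype.ext (G.partOne_mul_left c.2 y)
    rw [h1]
    exact Ideal.mul_mem_right _ _ hc
  have h := (TwoSidedIdeal.mem_mk' _ _ _ _ _ _ _).1 (hI hx) 1
  rwa [mul_one] at h

/-- For the converse, expand `x` in a system of homogeneous units `u σ`. Its coefficients are the
identity parts of the `x * (u σ)⁻¹`, which lie in `J(C_1)` by assumption. -/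
theorem Grading.mem_radIdeal_iff (G : S.Grading) {x : S.C} :
    x ∈ S.radIdeal ↔ ∀ y, G.toC₁ (x * y) ∈ Ring.jacobson S.C₁ := by
  refine ⟨fun hx y => G.mem_radIdeal (S.radIdeal.mul_mem_right _ hx), fun h => ?_⟩
  choose u hu hu' using fun σ : S.strong => exists_unit σ.2
  let _ := Fintype.ofFinite S.strong
  have key : ∀ x : S.C, x = ∑ σ : S.strong, G.partOne (x * ((u σ)⁻¹ : S.Cˣ)) * u σ := by
    intro x
    refine C_induction (p := fun x : S.C => x = ∑ σ : S.strong, G.partOne (x * ((u σ)⁻¹ : S.Cˣ)) * u σ)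
      x ?_ (by simp) ?_
    · intro τ hτ y hy
      rw [Finset.sum_eq_single (⟨τ, hτ⟩ : S.strong)]
      · rw [G.partOne_of_mem_one (mul_mem_Ccomp_one hy (hu' ⟨τ, hτ⟩))]
        simp
      · intro σ _ hσ
        rw [G.partOne_of_ne _ (mul_mem_Ccomp hy (hu' σ)), zero_mul]
        intro h
        exact hσ (Subtype.ext (mul_inv_eq_one.1 h).symm)
      · simp
    · intro y z hy hz
      simp only [add_mul, map_add, Finset.sum_add_distrib]
      rw [← hy, ← hz]
  rw [key x]
  exact Submodule.sum_mem _ fun σ _ => S.radIdeal.mul_mem_right _ (coe_mem_radIdeal (h _))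

/-- An element of `C_1` is its own identity part, so the ideal generated by `J(C_1)` meets `C_1`
only in `J(C_1)`. -/
theorem Grading.Cbar₁Map_injective (G : S.Grading) : Function.Injective S.Cbar₁Map := by
  rw [injective_iff_map_eq_zero]
  intro a ha
  obtain ⟨a, rfl⟩ := Ideal.Quotient.mk_surjective a
  have h1 : S.proj (a : S.C) = 0 := ha
  rw [S.proj_eq_zero] at h1
  have h2 := G.mem_radIdeal h1
  rw [G.toC₁_coe] at h2
  exact Ideal.Quotient.eq_zero_iff_mem.2 h2

/-- Homogeneous units of `C` make the degree map onto. A unit of degree one and its inverse both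
come from `C̄_1`, and injectivity of `C̄_1 → C̄` makes their preimages mutually inverse. -/
theorem Grading.isExtension (G : S.Grading) : S.IsExtension := by
  have hinj := G.Cbar₁Map_injective
  refine ⟨fun u v h => ?_, ?_, fun σ => ?_⟩
  · refine Units.ext (hinj ?_)
    exact congrArg (fun w : S.hU => ((w : S.strong × S.Cbarˣ).2 : S.Cbar)) h
  · ext w
    constructor
    · rintro ⟨u, rfl⟩
      rfl
    · intro hw
      have hw1 : (w : S.strong × S.Cbarˣ).1 = 1 := hw
      have h1 := w.2.1
      have h2 := w.2.2
      rw [hw1] at h1 h2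
      rw [inv_one] at h2
      obtain ⟨a, ha⟩ := Cbar₁Map_surjOn h1
      obtain ⟨c, hc⟩ := Cbar₁Map_surjOn h2
      refine ⟨⟨a, c, hinj ?_, hinj ?_⟩, ?_⟩
      · rw [map_mul, ha, hc, map_one, Units.mul_inv]
      · rw [map_mul, ha, hc, map_one, Units.inv_mul]
      · refine Subtype.ext (Prod.ext hw1.symm (Units.ext ha))
  · obtain ⟨u, hu, hu'⟩ := exists_unit σ.2
    exact ⟨⟨(σ, Units.map S.proj.toMonoidHom u), ⟨u, hu, rfl⟩, ⟨_, hu', rfl⟩⟩, rfl⟩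

end Units

end CliffordDatum

end BlockExt

/-! ### Morphisms of Clifford data and the induced maps of extensions. -/

namespace BlockExt

namespace CliffordDatum

variable {O Γ Λ B Γ' Λ' B' : Type*} [CommRing O] [Group Γ] [Group Λ] [Ring B] [Algebra O B]
  [Group Γ'] [Group Λ'] [Ring B'] [Algebra O B']

/-- A homomorphism from the fixed points of `B` to `B'` that maps each component of the datum `S`
onto the corresponding component of the datum `S'`. -/
structure Morphism (S : CliffordDatum O Γ Λ B) (S' : CliffordDatum O Γ' Λ' B') where
  onΓ : Γ →* Γ'
  onΓ_injective : Function.Injective onΓ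
  onFix : S.fix →ₐ[O] B'
  map_e : onFix ⟨S.e, S.e_mem_fix⟩ = S'.e
  map_comp : ∀ {σ : Γ} {x : S.fix}, (x : B) ∈ S.comp σ → onFix x ∈ S'.comp (onΓ σ)
  surj : ∀ {σ : Γ} {y : B'}, y ∈ S'.comp (onΓ σ) → ∃ x : S.fix, (x : B) ∈ S.comp σ ∧ onFix x = y
  mem_base : ∀ {σ : Γ}, onΓ σ ∈ S'.base ↔ σ ∈ S.base
  e_ne_zero : S'.e ≠ 0

variable {S : CliffordDatum O Γ Λ B} {S' : CliffordDatum O Γ' Λ' B'}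

theorem Morphism.nontrivial_C₁ [Finite Γ'] (t : S.Morphism S') : Nontrivial S'.C₁ :=
  ⟨1, 0, fun h => t.e_ne_zero (congrArg (fun x : S'.C₁ => S'.val x) h)⟩

variable [Finite Γ] [Finite Γ']

theorem sub_le_fix {x : B} (hx : x ∈ S.sub) : x ∈ S.fix :=
  sub_induction (p := (· ∈ S.fix)) hx (fun _ _ _ hy => comp_fix hy) S.fix.zero_mem
    fun _ _ hy hz => S.fix.add_mem hy hz

theorem hU_ext {u v : S.hU} (h : (S.deg u : Γ) = S.deg v)
    (h' : (S.toUnit u : S.Cbar) = S.toUnit v) : u = v :=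
  Subtype.ext (Prod.ext (Subtype.ext h) (Units.ext h'))

namespace Morphism

variable (t : S.Morphism S')

theorem map_strong {σ : Γ} (hσ : σ ∈ S.strong) : t.onΓ σ ∈ S'.strong := by
  refine ⟨t.mem_base.2 hσ.1, comp_mul_comp_inv_iff.2 ?_⟩
  have h1 : S.e ∈ S.comp σ * S.comp σ⁻¹ := comp_mul_comp_inv_iff.1 hσ.2
  -- The induction over sums of products carries membership in `fix` along, because `onFix` is
  -- defined only there.
  have h2 : ∃ h : S.e ∈ S.fix, t.onFix ⟨S.e, h⟩ ∈ S'.comp (t.onΓ σ) * S'.comp (t.onΓ σ)⁻¹ := by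
    refine Submodule.mul_induction_on (C := fun b => ∃ h : b ∈ S.fix,
      t.onFix ⟨b, h⟩ ∈ S'.comp (t.onΓ σ) * S'.comp (t.onΓ σ)⁻¹) h1 (fun x hx y hy => ?_) ?_
    · refine ⟨S.fix.mul_mem (comp_fix hx) (comp_fix hy), ?_⟩
      have h3 := t.map_comp (x := ⟨x, comp_fix hx⟩) hx
      have h4 := t.map_comp (x := ⟨y, comp_fix hy⟩) hy
      rw [map_inv] at h4
      have h5 := Submodule.mul_mem_mul h3 h4
      rw [← map_mul] at h5
      exact h5
    · rintro x y ⟨hx, hx'⟩ ⟨hy, hy'⟩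
      refine ⟨S.fix.add_mem hx hy, ?_⟩
      have h5 := add_mem hx' hy'
      rw [← map_add] at h5
      exact h5
  obtain ⟨h, h2⟩ := h2
  rwa [t.map_e] at h2

/-- The induced homomorphism `C → C'`. -/
def onC : S.C →ₐ[O] S'.C :=
  AlgHom.ofLinearMap
    { toFun := fun x => S'.toC (t.onFix ⟨S.val x, sub_le_fix (S.val_mem x)⟩) (by
        have h : ∃ h : S.val x ∈ S.fix, t.onFix ⟨S.val x, h⟩ ∈ S'.sub := by
          refine sub_induction (p := fun b => ∃ h : b ∈ S.fix, t.onFix ⟨b, h⟩ ∈ S'.sub)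
            (S.val_mem x) (fun σ hσ y hy => ⟨comp_fix hy, comp_le_sub (t.map_strong hσ)
              (t.map_comp hy)⟩) ⟨S.fix.zero_mem, ?_⟩ ?_
          · have : (⟨0, S.fix.zero_mem⟩ : S.fix) = 0 := rfl
            rw [this, map_zero]
            exact S'.sub.zero_mem
          · rintro y z ⟨hy, hy'⟩ ⟨hz, hz'⟩
            refine ⟨S.fix.add_mem hy hz, ?_⟩
            have h5 := S'.sub.add_mem hy' hz'
            rw [← map_add] at h5
            exact h5
        exact h.2)
      map_add' := fun x y => ext_val (map_add t.onFix ⟨S.val x, sub_le_fix (S.val_mem x)⟩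
        ⟨S.val y, sub_le_fix (S.val_mem y)⟩)
      map_smul' := fun r x => ext_val (map_smul t.onFix r ⟨S.val x, sub_le_fix (S.val_mem x)⟩) }
    (ext_val t.map_e)
    (fun x y => ext_val (map_mul t.onFix ⟨S.val x, sub_le_fix (S.val_mem x)⟩
        ⟨S.val y, sub_le_fix (S.val_mem y)⟩))

theorem onC_mem {σ : Γ} {x : S.C} (hx : x ∈ S.Ccomp σ) : t.onC x ∈ S'.Ccomp (t.onΓ σ) :=
  t.map_comp hx

theorem onC_surjOn {σ : Γ} (hσ : σ ∈ S.strong) {y : S'.C} (hy : y ∈ S'.Ccomp (t.onΓ σ)) :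
    ∃ x ∈ S.Ccomp σ, t.onC x = y := by
  obtain ⟨x, hx, hxy⟩ := t.surj hy
  exact ⟨S.toC x (comp_le_sub hσ hx), hx, ext_val hxy⟩

/-- The induced homomorphism `C_1 → C'_1`. -/
def onC₁ : S.C₁ →ₐ[O] S'.C₁ :=
  (t.onC.comp S.C₁.val).codRestrict S'.C₁ fun x => by
    have := t.onC_mem x.2
    rwa [map_one] at this

theorem coe_onC₁ (x : S.C₁) : (t.onC₁ x : S'.C) = t.onC x := rfl

theorem onC₁_surjective : Function.Surjective t.onC₁ := fun y => by
  obtain ⟨x, hx, hxy⟩ := t.onC_surjOn S.strong.one_mem (y := y) (by rw [map_one]; exact y.2)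
  exact ⟨⟨x, hx⟩, Subtype.ext hxy⟩

theorem isLocalRing_C₁ [IsLocalRing S.C₁] (t : S.Morphism S') : IsLocalRing S'.C₁ :=
  have := t.nontrivial_C₁
  isLocalRing_of_surjective t.onC₁ t.onC₁_surjective

/-- Lift the inverse of the image to `d`. Then `1 - c * d` maps to zero in a nonzero ring, so it is
not a unit; by locality `c * d` is one. -/
theorem isUnit_of_onC₁ [IsLocalRing S.C₁] {c : S.C₁} (h : IsUnit (t.onC₁ c)) : IsUnit c := by
  have := t.nontrivial_C₁
  obtain ⟨u, hu⟩ := h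
  obtain ⟨d, hd⟩ := t.onC₁_surjective (u⁻¹ : S'.C₁ˣ)
  rcases IsLocalRing.isUnit_or_isUnit_of_add_one (add_sub_cancel (c * d) 1) with h | h
  · exact isUnit_of_mul_isUnit_left_of_isLocalRing h
  · have h1 := h.map t.onC₁
    rw [map_sub, map_mul, map_one, hd, ← hu, Units.mul_inv, sub_self] at h1
    exact absurd h1 not_isUnit_zero

/-- Both radicals are the sets of nonunits, and units are preserved and reflected. This is what
identifies `C̄_1` with `C̄'_1`. -/
theorem onC₁_mem_jacobson [IsLocalRing S.C₁] {c : S.C₁} :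
    t.onC₁ c ∈ Ring.jacobson S'.C₁ ↔ c ∈ Ring.jacobson S.C₁ := by
  have := t.isLocalRing_C₁
  rw [mem_jacobson_iff_not_isUnit, mem_jacobson_iff_not_isUnit, not_iff_not]
  exact ⟨t.isUnit_of_onC₁, fun h => h.map _⟩

/-- Lift a decomposition of the target identity term by term. The result `w` lies in `C_σ C_{σ⁻¹}`
and need not be `e`, but it maps to the identity and is therefore a unit of `C_1`; multiplying by
its inverse gives `e`. -/
theorem mem_strong_iff [IsLocalRing S.C₁] {σ : Γ} : t.onΓ σ ∈ S'.strong ↔ σ ∈ S.strong := by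
  refine ⟨fun hσ => ⟨t.mem_base.1 hσ.1, comp_mul_comp_inv_iff.2 ?_⟩, t.map_strong⟩
  have h1 : S'.e ∈ S'.comp (t.onΓ σ) * S'.comp (t.onΓ σ)⁻¹ := comp_mul_comp_inv_iff.1 hσ.2
  have h2 : ∃ w : S.fix, (w : B) ∈ S.comp σ * S.comp σ⁻¹ ∧ t.onFix w = S'.e := by
    refine Submodule.mul_induction_on (C := fun b => ∃ w : S.fix,
      (w : B) ∈ S.comp σ * S.comp σ⁻¹ ∧ t.onFix w = b) h1 (fun x hx y hy => ?_) ?_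
    · rw [← map_inv] at hy
      obtain ⟨x, hx₀, rfl⟩ := t.surj hx
      obtain ⟨y, hy₀, rfl⟩ := t.surj hy
      exact ⟨x * y, Submodule.mul_mem_mul hx₀ hy₀, map_mul _ _ _⟩
    · rintro _ _ ⟨x, hx, rfl⟩ ⟨y, hy, rfl⟩
      exact ⟨x + y, add_mem hx hy, map_add _ _ _⟩
  obtain ⟨w, hw, hwe⟩ := h2
  have hw1 : (w : B) ∈ S.comp 1 := by simpa using comp_mul_comp_le (S := S) σ σ⁻¹ hw
  let c : S.C₁ := ⟨S.toC w (comp_le_sub S.strong.one_mem hw1), hw1⟩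
  have hc : t.onC₁ c = 1 := Subtype.ext (ext_val hwe)
  obtain ⟨u, hu⟩ := t.isUnit_of_onC₁ (c := c) (by rw [hc]; exact isUnit_one)
  have h3 : (w : B) * S.val ((u⁻¹ : S.C₁ˣ) : S.C₁) = S.e := by
    have := congrArg (fun x : S.C₁ => S.val x) (Units.mul_inv u)
    rw [hu] at this
    exact this
  rw [← h3]
  have h4 : S.val ((u⁻¹ : S.C₁ˣ) : S.C₁) ∈ S.comp 1 := ((u⁻¹ : S.C₁ˣ) : S.C₁).2
  have h5 := Submodule.mul_mem_mul hw h4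
  rw [mul_assoc] at h5
  exact (mul_le_mul' le_rfl (by simpa using comp_mul_comp_le (S := S) σ⁻¹ 1) :
    S.comp σ * (S.comp σ⁻¹ * S.comp 1) ≤ S.comp σ * S.comp σ⁻¹) h5

/-- Injectivity on degrees is essential: no nontrivial degree may collapse to the trivial one. -/
theorem onC_partOne (G : S.Grading) (G' : S'.Grading) (x : S.C) :
    t.onC (G.partOne x) = G'.partOne (t.onC x) := by
  refine C_induction (p := fun x => t.onC (G.partOne x) = G'.partOne (t.onC x)) x
    (fun σ _ y hy => ?_) (by simp) (fun y z hy hz => by simp only [map_add, hy, hz])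
  by_cases h : σ = 1
  · subst h
    rw [G.partOne_of_mem_one hy, G'.partOne_of_mem_one]
    simpa using t.onC_mem hy
  · rw [G.partOne_of_ne h hy, G'.partOne_of_ne _ (t.onC_mem hy), map_zero]
    exact fun h1 => h (t.onΓ_injective (h1.trans (map_one _).symm))

theorem onC_mem_radIdeal [IsLocalRing S.C₁] {x : S.C} (hx : x ∈ S.radIdeal) :
    t.onC x ∈ S'.radIdeal := by
  have h : TwoSidedIdeal.span (Subtype.val '' (Ring.jacobson S.C₁ : Set S.C₁)) ≤
      (TwoSidedIdeal.span (Subtype.val '' (Ring.jacobson S'.C₁ : Set S'.C₁))).comap t.onC := by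
    rw [TwoSidedIdeal.span_le]
    rintro _ ⟨y, hy, rfl⟩
    refine (TwoSidedIdeal.mem_comap _).2 ?_
    exact TwoSidedIdeal.subset_span ⟨t.onC₁ y, t.onC₁_mem_jacobson.2 hy, rfl⟩
  exact (TwoSidedIdeal.mem_comap _).1 (h hx)

/-- The test by identity parts pulls back, because `onC` commutes with them and reflects the radical
of `C_1`. Test elements from the image of `onC` suffice. -/
theorem onC_mem_radIdeal_iff [IsLocalRing S.C₁] (G : S.Grading) (G' : S'.Grading) {x : S.C} :
    t.onC x ∈ S'.radIdeal ↔ x ∈ S.radIdeal := by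
  have := t.isLocalRing_C₁
  refine ⟨fun hx => G.mem_radIdeal_iff.2 fun y => ?_, t.onC_mem_radIdeal⟩
  have h1 := G'.mem_radIdeal_iff.1 hx (t.onC y)
  rw [← t.onC₁_mem_jacobson]
  have h2 : t.onC₁ (G.toC₁ (x * y)) = G'.toC₁ (t.onC x * t.onC y) := Subtype.ext (by
    rw [coe_onC₁, G.coe_toC₁, G'.coe_toC₁, onC_partOne (G' := G'), map_mul])
  rwa [h2]

variable [IsLocalRing S.C₁]

/-- The induced homomorphism `C̄ → C̄'`. -/
def onCbar : S.Cbar →ₐ[O] S'.Cbar :=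
  Ideal.Quotient.liftₐ S.radIdeal (S'.proj.comp t.onC) fun _ ha =>
    S'.proj_eq_zero.2 (t.onC_mem_radIdeal ha)

theorem onCbar_proj (x : S.C) : t.onCbar (S.proj x) = S'.proj (t.onC x) := rfl

theorem onCbar_injective (G : S.Grading) (G' : S'.Grading) : Function.Injective t.onCbar := by
  rw [injective_iff_map_eq_zero]
  intro a ha
  obtain ⟨a, rfl⟩ := S.proj_surjective a
  rw [onCbar_proj, S'.proj_eq_zero, t.onC_mem_radIdeal_iff G G'] at ha
  exact S.proj_eq_zero.2 ha

theorem onCbar_mem {σ : Γ} {x : S.Cbar} (hx : x ∈ S.CbarComp σ) :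
    t.onCbar x ∈ S'.CbarComp (t.onΓ σ) := by
  obtain ⟨x, hx, rfl⟩ := hx
  exact ⟨t.onC x, t.onC_mem hx, rfl⟩

theorem onCbar_surjOn {σ : Γ} (hσ : σ ∈ S.strong) {y : S'.Cbar}
    (hy : y ∈ S'.CbarComp (t.onΓ σ)) : ∃ x ∈ S.CbarComp σ, t.onCbar x = y := by
  obtain ⟨y, hy, rfl⟩ := hy
  obtain ⟨x, hx, rfl⟩ := t.onC_surjOn hσ hy
  exact ⟨S.proj x, ⟨x, hx, rfl⟩, rfl⟩

theorem map_CbarComp {σ : Γ} (hσ : σ ∈ S.strong) :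
    (S.CbarComp σ).map t.onCbar.toLinearMap = S'.CbarComp (t.onΓ σ) := by
  refine le_antisymm ?_ fun y hy => ?_
  · rintro _ ⟨x, hx, rfl⟩
    exact t.onCbar_mem hx
  · obtain ⟨x, hx, rfl⟩ := t.onCbar_surjOn hσ hy
    exact ⟨x, hx, rfl⟩

theorem onCbar_surjective (h : Function.Surjective t.onΓ) : Function.Surjective t.onCbar := by
  have key : ∀ y : S'.C, ∃ x, t.onC x = y := by
    intro y
    refine C_induction (p := fun y => ∃ x, t.onC x = y) y (fun σ hσ y hy => ?_) ⟨0, map_zero _⟩ ?_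
    · obtain ⟨σ, rfl⟩ := h σ
      obtain ⟨x, -, hx⟩ := t.onC_surjOn (t.mem_strong_iff.1 hσ) hy
      exact ⟨x, hx⟩
    · rintro _ _ ⟨x, rfl⟩ ⟨y, rfl⟩
      exact ⟨x + y, map_add _ _ _⟩
  intro y
  obtain ⟨y, rfl⟩ := S'.proj_surjective y
  obtain ⟨x, rfl⟩ := key y
  exact ⟨S.proj x, rfl⟩

/-- The induced homomorphism `C̄_1 → C̄'_1`. -/
def onCbar₁ : S.Cbar₁ →ₐ[O] S'.Cbar₁ :=
  Ideal.Quotient.liftₐ (Ring.jacobson S.C₁)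
    ((Ideal.Quotient.mkₐ O (Ring.jacobson S'.C₁)).comp t.onC₁) fun _ ha =>
    Ideal.Quotient.eq_zero_iff_mem.2 (t.onC₁_mem_jacobson.2 ha)

theorem Cbar₁Map_onCbar₁ (x : S.Cbar₁) : S'.Cbar₁Map (t.onCbar₁ x) = t.onCbar (S.Cbar₁Map x) := by
  obtain ⟨x, rfl⟩ := Ideal.Quotient.mk_surjective x
  rfl

theorem onCbar₁_bijective : Function.Bijective t.onCbar₁ := by
  constructor
  · rw [injective_iff_map_eq_zero]
    intro a ha
    obtain ⟨a, rfl⟩ := Ideal.Quotient.mk_surjective a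
    exact Ideal.Quotient.eq_zero_iff_mem.2
      (t.onC₁_mem_jacobson.1 (Ideal.Quotient.eq_zero_iff_mem.1 ha))
  · intro a
    obtain ⟨a, rfl⟩ := Ideal.Quotient.mk_surjective a
    obtain ⟨a, rfl⟩ := t.onC₁_surjective a
    exact ⟨Ideal.Quotient.mk _ a, rfl⟩

/-- The induced homomorphism of the groups `strong`. -/
def onStrong : S.strong →* S'.strong :=
  (t.onΓ.comp S.strong.subtype).codRestrict S'.strong fun σ => t.map_strong σ.2

/-- The induced homomorphism `hU(C̄) → hU(C̄')`. -/
def onHU : S.hU →* S'.hU :=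
  ((t.onStrong.prodMap (Units.map t.onCbar.toMonoidHom)).comp S.hU.subtype).codRestrict
    S'.hU fun u => ⟨t.onCbar_mem u.2.1, by
      have := t.onCbar_mem u.2.2
      rw [Subgroup.coe_inv, map_inv] at this
      exact this⟩

theorem onHU_inl (u : S.Cbar₁ˣ) :
    t.onHU (S.inl u) = S'.inl (Units.map t.onCbar₁.toMonoidHom u) :=
  hU_ext (map_one t.onΓ) (t.Cbar₁Map_onCbar₁ u).symm

theorem onHU_injective (G : S.Grading) (G' : S'.Grading) : Function.Injective t.onHU :=
  fun _ _ h => hU_ext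
    (t.onΓ_injective (congrArg (fun w => (S'.deg w : Γ')) h))
    (t.onCbar_injective G G' (congrArg (fun w => (S'.toUnit w : S'.Cbar)) h))

/-- The unit and its inverse are lifted separately in opposite degrees; injectivity of `onCbar`
makes the lifts mutually inverse. -/
theorem onHU_surjective (G : S.Grading) (G' : S'.Grading) (h : Function.Surjective t.onΓ) :
    Function.Surjective t.onHU := by
  intro w
  obtain ⟨σ, hσ⟩ := h (S'.deg w)
  have hs : σ ∈ S.strong := t.mem_strong_iff.1 (by rw [hσ]; exact (S'.deg w).2)
  have h1 : ((S'.toUnit w : S'.Cbarˣ) : S'.Cbar) ∈ S'.CbarComp (t.onΓ σ) := by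
    rw [hσ]; exact w.2.1
  have h2 : (((S'.toUnit w)⁻¹ : S'.Cbarˣ) : S'.Cbar) ∈ S'.CbarComp (t.onΓ σ⁻¹) := by
    rw [map_inv, hσ]; exact w.2.2
  obtain ⟨x, hx, hx'⟩ := t.onCbar_surjOn hs h1
  obtain ⟨y, hy, hy'⟩ := t.onCbar_surjOn (inv_mem hs) h2
  have hinj := t.onCbar_injective G G'
  refine ⟨⟨(⟨σ, hs⟩, ⟨x, y, hinj ?_, hinj ?_⟩), hx, hy⟩, hU_ext hσ hx'⟩
  · rw [map_mul, hx', hy', map_one, Units.mul_inv]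
  · rw [map_mul, hx', hy', map_one, Units.inv_mul]

/-- The elements `l` and `l'` act compatibly. -/
def Compatible (t : S.Morphism S') (l : Λ) (l' : Λ') : Prop :=
  (∀ σ, t.onΓ (S.actΓ l σ) = S'.actΓ l' (t.onΓ σ)) ∧
    ∀ x : S.fix, t.onFix ⟨S.actB l x, S.act_fix l x.2⟩ = S'.actB l' (t.onFix x)

variable {t} {l : Λ} {l' : Λ'}

theorem Compatible.onCbar (h : t.Compatible l l') (x : S.Cbar) :
    t.onCbar (S.actCbar l x) = S'.actCbar l' (t.onCbar x) := by
  obtain ⟨x, rfl⟩ := S.proj_surjective x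
  exact congrArg S'.proj (ext_val (h.2 ⟨S.val x, sub_le_fix (S.val_mem x)⟩))

theorem Compatible.onHU (h : t.Compatible l l') (u : S.hU) :
    t.onHU (S.actHU l u) = S'.actHU l' (t.onHU u) :=
  hU_ext (h.1 _) (h.onCbar _)

end Morphism

end CliffordDatum

end BlockExt

/-! ### Functoriality of Brauer quotients and the Mackey formula. -/

namespace BlockExt

section Brauer

variable {O H B B' : Type*} [CommRing O] [Group H] [Ring B] [Algebra O B] [Ring B'] [Algebra O B']
  {act : H →* (B →ₐ[O] B)} {act' : H →* (B' →ₐ[O] B')}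

theorem map_mem_fixedPts {P Q : Subgroup H} (hQ : Q ≤ P) (L : B →ₗ[O] B')
    (hL : ∀ u ∈ P, ∀ x, L (act u x) = act' u (L x)) {a : B} (ha : a ∈ fixedPts act Q) :
    L a ∈ fixedPts act' Q := fun q hq => by rw [← hL q (hQ hq), ha q hq]

variable [Finite H]

theorem relTrace_mem_fixedPts {Q K : Subgroup H} {a : B} (ha : a ∈ fixedPts act Q) :
    relTrace act Q K a ∈ fixedPts act K := by
  intro k hk
  let _ := Fintype.ofFinite (K ⧸ Q.subgroupOf K)
  conv_rhs => rw [relTrace_eq_sum act ha (MulAction.toPerm (⟨k, hk⟩ : K)) (fun x => ⟨k, hk⟩ * x.out)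
    (fun x => by
      rw [MulAction.toPerm_apply, ← MulAction.Quotient.coe_smul_out]
      rfl)]
  rw [relTrace_eq_sum act ha (Equiv.refl _) (fun x => x.out) (fun x => QuotientGroup.out_eq' _),
    map_sum]
  refine Finset.sum_congr rfl fun x _ => ?_
  rw [← AlgHom.mul_apply, ← map_mul]
  rfl

theorem map_relTrace {P Q : Subgroup H} (L : B →ₗ[O] B')
    (hL : ∀ u ∈ P, ∀ x, L (act u x) = act' u (L x)) (a : B) :
    L (relTrace act Q P a) = relTrace act' Q P (L a) := by
  let _ := Fintype.ofFinite (P ⧸ Q.subgroupOf P)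
  simp only [relTrace_apply, finsum_eq_sum_of_fintype, map_sum]
  exact Finset.sum_congr rfl fun x _ => hL _ x.out.2 a

variable [IsLocalRing O]

theorem map_mem_brauerIdeal {P : Subgroup H} (L : B →ₗ[O] B')
    (hL : ∀ u ∈ P, ∀ x, L (act u x) = act' u (L x)) {x : fixedPts act P}
    (hx : x ∈ brauerIdeal act P) :
    (⟨L x, map_mem_fixedPts le_rfl L hL x.2⟩ : fixedPts act' P) ∈ brauerIdeal act' P := by
  -- Since `L` is only linear, it does not respect the ideal structure. The induction over the span
  -- therefore allows an arbitrary left factor `c`, which trace images absorb.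
  have key : ∀ c : fixedPts act P,
      (⟨L (c * x : fixedPts act P), map_mem_fixedPts le_rfl L hL (c * x).2⟩ : fixedPts act' P) ∈
        brauerIdeal act' P := by
    refine Submodule.span_induction (p := fun x _ => ∀ c : fixedPts act P,
      (⟨L (c * x : fixedPts act P), map_mem_fixedPts le_rfl L hL (c * x).2⟩ : fixedPts act' P) ∈
        brauerIdeal act' P) ?_ ?_ ?_ ?_ hx
    · rintro x (⟨Q, hQ, hx⟩ | ⟨r, hr, rfl⟩) c
      · obtain ⟨a, ha, hax⟩ := mul_traceImage act hQ.le c.2 hx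
        refine Ideal.subset_span (Or.inl ⟨Q, hQ, L a, map_mem_fixedPts hQ.le L hL ha, ?_⟩)
        rw [← map_relTrace L hL, hax]
        rfl
      · have h : (⟨L (c * algebraMap O (fixedPts act P) r : fixedPts act P),
            map_mem_fixedPts le_rfl L hL (Subtype.prop _)⟩ : fixedPts act' P) =
            ⟨L c, map_mem_fixedPts le_rfl L hL c.2⟩ * algebraMap O (fixedPts act' P) r := by
          refine Subtype.ext ?_
          rw [← Algebra.commutes, ← Algebra.smul_def, ← Algebra.commutes, ← Algebra.smul_def]
          exact map_smul L r (c : B)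
        rw [h]
        exact Ideal.mul_mem_left _ _ (Ideal.subset_span (Or.inr ⟨r, hr, rfl⟩))
    · intro c
      convert Ideal.zero_mem _
      simp
    · intro x y _ _ hx hy c
      convert Ideal.add_mem _ (hx c) (hy c)
      simp [mul_add]
    · intro r x _ hx c
      convert hx (c * r) using 3
      simp [mul_assoc]
  simpa using key 1

theorem Br_map_eq {P : Subgroup H} (L : B →ₗ[O] B')
    (hL : ∀ u ∈ P, ∀ x, L (act u x) = act' u (L x)) {x y : fixedPts act P}
    (h : Br act P x = Br act P y) :
    Br act' P ⟨L x, map_mem_fixedPts le_rfl L hL x.2⟩ =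
      Br act' P ⟨L y, map_mem_fixedPts le_rfl L hL y.2⟩ := by
  rw [← sub_eq_zero, ← map_sub, Br_eq_zero] at h ⊢
  convert map_mem_brauerIdeal L hL h
  simp

/-- The map `B(P) → B'(P)` induced by a `P`-equivariant linear map `B → B'`. -/
noncomputable def brauerMap {P : Subgroup H} (L : B →ₗ[O] B')
    (hL : ∀ u ∈ P, ∀ x, L (act u x) = act' u (L x)) :
    BrauerQuot act P →ₗ[O] BrauerQuot act' P where
  toFun X := Br act' P ⟨L (Function.surjInv (Br_surjective act P) X : fixedPts act P),
    map_mem_fixedPts le_rfl L hL (Subtype.prop _)⟩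
  map_add' X Y := by
    refine (Br_map_eq L hL (y := Function.surjInv (Br_surjective act P) X +
      Function.surjInv (Br_surjective act P) Y) ?_).trans ?_
    · simp only [map_add, Function.surjInv_eq]
    · rw [← map_add]
      exact congrArg (Br act' P) (Subtype.ext (map_add L _ _))
  map_smul' r X := by
    refine (Br_map_eq L hL (y := r • Function.surjInv (Br_surjective act P) X) ?_).trans ?_
    · simp only [map_smul, Function.surjInv_eq]
    · rw [← map_smul]
      exact congrArg (Br act' P) (Subtype.ext (map_smul L _ _))

theorem brauerMap_Br {P : Subgroup H} (L : B →ₗ[O] B')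
    (hL : ∀ u ∈ P, ∀ x, L (act u x) = act' u (L x)) (x : fixedPts act P) :
    brauerMap L hL (Br act P x) = Br act' P ⟨L x, map_mem_fixedPts le_rfl L hL x.2⟩ :=
  Br_map_eq L hL (Function.surjInv_eq (Br_surjective act P) _)

variable (act) in
/-- The kernel of the Brauer homomorphism `B^P → B(P)` as a subgroup of `B`. -/
noncomputable def brauerKer (P : Subgroup H) : AddSubgroup B :=
  (brauerIdeal act P).toAddSubgroup.map (fixedPts act P).val.toLinearMap.toAddMonoidHom

theorem mem_brauerKer {P : Subgroup H} {x : B} :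
    x ∈ brauerKer act P ↔ ∃ h : x ∈ fixedPts act P, Br act P ⟨x, h⟩ = 0 := by
  constructor
  · rintro ⟨x, hx, rfl⟩
    exact ⟨x.2, (Br_eq_zero act).2 hx⟩
  · rintro ⟨h, hx⟩
    exact ⟨⟨x, h⟩, (Br_eq_zero act).1 hx, rfl⟩

theorem sub_mem_brauerKer_iff {P : Subgroup H} {x y : fixedPts act P} :
    (x : B) - y ∈ brauerKer act P ↔ Br act P x = Br act P y := by
  rw [mem_brauerKer]
  have h0 : ∀ h : (x : B) - y ∈ fixedPts act P,
      Br act P ⟨(x : B) - y, h⟩ = Br act P x - Br act P y := fun h => by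
    rw [← map_sub]; rfl
  constructor
  · rintro ⟨h, h'⟩
    rwa [h0, sub_eq_zero] at h'
  · intro h
    exact ⟨(x - y).2, by rw [h0, h, sub_self]⟩

theorem mul_mem_brauerKer {P : Subgroup H} {c x : B} (hc : c ∈ fixedPts act P)
    (hx : x ∈ brauerKer act P) : c * x ∈ brauerKer act P := by
  obtain ⟨h, hx⟩ := mem_brauerKer.1 hx
  refine mem_brauerKer.2 ⟨(fixedPts act P).mul_mem hc h, ?_⟩
  have : (⟨c * x, (fixedPts act P).mul_mem hc h⟩ : fixedPts act P) = ⟨c, hc⟩ * ⟨x, h⟩ := rfl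
  rw [this, map_mul, hx, mul_zero]

theorem brauerKer_mul_mem {P : Subgroup H} {c x : B} (hc : c ∈ fixedPts act P)
    (hx : x ∈ brauerKer act P) : x * c ∈ brauerKer act P := by
  obtain ⟨h, hx⟩ := mem_brauerKer.1 hx
  refine mem_brauerKer.2 ⟨(fixedPts act P).mul_mem h hc, ?_⟩
  have : (⟨x * c, (fixedPts act P).mul_mem h hc⟩ : fixedPts act P) = ⟨x, h⟩ * ⟨c, hc⟩ := rfl
  rw [this, map_mul, hx, zero_mul]

theorem relTrace_mem_brauerKer {P Q : Subgroup H} (hQ : Q < P) {a : B}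
    (ha : a ∈ fixedPts act Q) : relTrace act Q P a ∈ brauerKer act P :=
  mem_brauerKer.2 ⟨relTrace_mem_fixedPts ha,
    (Br_eq_zero act).2 (Ideal.subset_span (Or.inl ⟨Q, hQ, a, ha, rfl⟩))⟩

open Classical in
/-- A sum over a finite `P`-set is congruent to the sum over the fixed points modulo the kernel of
the Brauer homomorphism. -/
theorem sum_sub_sum_fixedPoints_mem {P : Subgroup H} {X : Type*} [Fintype X] [MulAction P X]
    (f : X → B) (hf : ∀ (u : P) x, f (u • x) = act (u : H) (f x)) :
    ∑ x, f x - ∑ x ∈ Finset.univ.filter (· ∈ MulAction.fixedPoints P X), f x ∈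
      brauerKer act P := by
  -- The function `g` vanishes at fixed points, so the difference is a sum over orbits: a fixed
  -- orbit contributes zero and any other a trace from a proper subgroup.
  let g : X → B := fun x => if x ∈ MulAction.fixedPoints P X then 0 else f x
  have h1 : ∑ x, f x - ∑ x ∈ Finset.univ.filter (· ∈ MulAction.fixedPoints P X), f x =
      ∑ x, g x := by
    rw [Finset.sum_filter, ← Finset.sum_sub_distrib]
    refine Finset.sum_congr rfl fun x _ => ?_
    by_cases h : x ∈ MulAction.fixedPoints P X
    · simp only [g, if_pos h, sub_self]
    · simp only [g, if_neg h, sub_zero]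
  let _ : Fintype (MulAction.orbitRel.Quotient P X) := Fintype.ofFinite _
  rw [h1, ← Finset.sum_fiberwise Finset.univ
    (fun x => (Quotient.mk (MulAction.orbitRel P X) x : MulAction.orbitRel.Quotient P X))]
  refine AddSubgroup.sum_mem _ fun ω _ => ?_
  induction ω using Quotient.inductionOn with | _ x₀
  have hcls : ∀ x, (Quotient.mk (MulAction.orbitRel P X) x : MulAction.orbitRel.Quotient P X) =
      Quotient.mk (MulAction.orbitRel P X) x₀ ↔ x ∈ MulAction.orbit P x₀ := fun x => by
    rw [Quotient.eq, MulAction.orbitRel_apply]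
  simp only [hcls]
  by_cases hx₀ : x₀ ∈ MulAction.fixedPoints P X
  · rw [Finset.sum_eq_zero]
    · exact zero_mem _
    · intro x hx
      obtain ⟨u, rfl⟩ := (Finset.mem_filter.1 hx).2
      have : u • x₀ = x₀ := hx₀ u
      simp only [g, this, if_pos hx₀]
  · let Q : Subgroup H := (MulAction.stabilizer P x₀).map P.subtype
    have hQs : Q.subgroupOf P = MulAction.stabilizer P x₀ :=
      Subgroup.comap_map_eq_self_of_injective P.subtype_injective _
    have hQP : Q ≤ P := Subgroup.map_subtype_le _
    have hQ : Q < P := by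
      refine lt_of_le_of_ne hQP fun h => hx₀ fun u => ?_
      have : u ∈ Q.subgroupOf P := Subgroup.mem_subgroupOf.2 (h.ge u.2)
      rw [hQs] at this
      exact this
    have ha : f x₀ ∈ fixedPts act Q := by
      rintro _ ⟨u, hu, rfl⟩
      have hu' : u • x₀ = x₀ := hu
      rw [Subgroup.coe_subtype, ← hf, hu']
    let e : MulAction.orbit P x₀ ≃ P ⧸ Q.subgroupOf P :=
      (MulAction.orbitEquivQuotientStabilizer P x₀).trans (Subgroup.quotientEquivOfEq hQs.symm)
    have h2 : relTrace act Q P (f x₀) = ∑ x : MulAction.orbit P x₀, f x := by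
      rw [relTrace_eq_sum act ha e (fun x => (e x).out) fun x => QuotientGroup.out_eq' _]
      refine Finset.sum_congr rfl fun x _ => ?_
      rw [← hf]
      congr 1
      obtain ⟨q, rfl⟩ := e.symm.surjective x
      rw [Equiv.apply_symm_apply]
      induction q using QuotientGroup.induction_on with | _ u
      have h3 : (e.symm (QuotientGroup.mk u) : X) = u • x₀ := rfl
      rw [h3]
      have h4 : (QuotientGroup.mk u : P ⧸ Q.subgroupOf P).out⁻¹ * u ∈ Q.subgroupOf P :=
        QuotientGroup.eq.1 (QuotientGroup.out_eq' _)
      have h5 := hQs.le h4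
      rw [MulAction.mem_stabilizer_iff, mul_smul] at h5
      exact (inv_smul_eq_iff.1 h5).symm
    have h3 : ∑ x ∈ Finset.univ.filter (· ∈ MulAction.orbit P x₀), g x =
        ∑ x : MulAction.orbit P x₀, f x := by
      rw [Finset.sum_subtype (p := (· ∈ MulAction.orbit P x₀)) _ (by simp)]
      refine Finset.sum_congr rfl fun x _ => if_neg fun hx => hx₀ ?_
      obtain ⟨u, hu⟩ := x.2
      have hu' : u • x₀ = x := hu
      rw [← inv_smul_eq_iff.2 hu'.symm]
      intro v
      have h5 : u⁻¹ • (x : X) = x := hx u⁻¹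
      rw [h5]
      exact hx v
    rw [h3, ← h2]
    exact relTrace_mem_brauerKer hQ ha

omit [IsLocalRing O] in
-- As `H` is finite, an inclusion of a conjugate of `P` in `P` is an equality.
theorem mem_normalizer_of_inv_conj_mem {P : Subgroup H} {x : H} (h : ∀ u ∈ P, x⁻¹ * u * x ∈ P) :
    x ∈ Subgroup.normalizer (P : Set H) := by
  rw [← inv_mem_iff]
  exact Subgroup.mem_normalizer_fintype fun u hu => by simpa using h u hu

open Classical in
/-- The Mackey formula modulo the kernel of the Brauer homomorphism. -/
theorem exists_relTrace_sub_sum_mem {K P : Subgroup H} (Q : Subgroup H) (hP : P ≤ K) :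
    ∃ s : Finset (K ⧸ Q.subgroupOf K), (∀ x ∈ s, ∀ u ∈ P, (x.out : H)⁻¹ * u * x.out ∈ Q) ∧
      ∀ c ∈ fixedPts act Q, relTrace act Q K c - ∑ x ∈ s, act (x.out : H) c ∈
        brauerKer act P := by
  let _ := Fintype.ofFinite (K ⧸ Q.subgroupOf K)
  -- Let `P` act on the cosets `K/Q` by left translation. The coset of `x` is fixed exactly when
  -- `x⁻¹ P x ≤ Q`, so only such cosets survive in the trace.
  let _ : MulAction P (K ⧸ Q.subgroupOf K) := MulAction.compHom _ (Subgroup.inclusion hP)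
  have hout : ∀ (u : P) (x : K ⧸ Q.subgroupOf K),
      (QuotientGroup.mk (Subgroup.inclusion hP u * x.out) : K ⧸ Q.subgroupOf K) = u • x := by
    intro u x
    change _ = Subgroup.inclusion hP u • x
    conv_rhs => rw [← QuotientGroup.out_eq' x]
    rfl
  refine ⟨Finset.univ.filter (· ∈ MulAction.fixedPoints P (K ⧸ Q.subgroupOf K)), ?_, ?_⟩
  · intro x hx u hu
    have h1 : (⟨u, hu⟩ : P) • x = x := (Finset.mem_filter.1 hx).2 _
    rw [← hout, eq_comm] at h1
    have h2 := QuotientGroup.eq.1 ((QuotientGroup.out_eq' x).trans h1)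
    rw [Subgroup.mem_subgroupOf] at h2
    simpa [mul_assoc] using h2
  · intro c hc
    rw [relTrace_apply, finsum_eq_sum_of_fintype]
    refine sum_sub_sum_fixedPoints_mem (fun x : K ⧸ Q.subgroupOf K => act (x.out : H) c) fun u x => ?_
    rw [← AlgHom.mul_apply, ← map_mul]
    exact act_eq_of_rep act hc ((QuotientGroup.out_eq' _).trans (hout u x).symm)

/-- If no coset in `K/Q` were fixed by `P`, the Mackey sum would be empty and the trace would vanish
under `Br_P`. -/
theorem exists_conj_mem_of_notMem_brauerKer {K P Q : Subgroup H} (hP : P ≤ K) {b : B}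
    (hb : b ∈ traceImage act Q K) (hb' : b ∉ brauerKer act P) :
    ∃ k ∈ K, ∀ u ∈ P, k⁻¹ * u * k ∈ Q := by
  obtain ⟨a, ha, rfl⟩ := hb
  obtain ⟨s, hs, hs'⟩ := exists_relTrace_sub_sum_mem (act := act) Q hP
  rcases s.eq_empty_or_nonempty with rfl | ⟨x, hx⟩
  · have := hs' a ha
    rw [Finset.sum_empty, sub_zero] at this
    exact absurd this hb'
  · exact ⟨x.out, x.out.2, hs x hx⟩

/-- If `Br_P(y)` is fixed by `N_K(P)`, then `Br_P(Tr_P^K(a y)) = Br_P(Tr_P^K(a)) Br_P(y)`. -/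
theorem relTrace_mul_sub_mem {K P : Subgroup H} (hP : P ≤ K) {a y : B} (ha : a ∈ fixedPts act P)
    (hy : y ∈ fixedPts act P)
    (hy' : ∀ n ∈ K, n ∈ Subgroup.normalizer (P : Set H) → act n y - y ∈ brauerKer act P) :
    relTrace act P K (a * y) - relTrace act P K a * y ∈ brauerKer act P := by
  obtain ⟨s, hs, hs'⟩ := exists_relTrace_sub_sum_mem (act := act) P hP
  have h1 := hs' _ ((fixedPts act P).mul_mem ha hy)
  have h2 := brauerKer_mul_mem hy (hs' _ ha)
  -- The surviving representatives normalize `P`. For them `ˣ(a y) - ˣa · y = ˣa (ˣy - y)`, which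
  -- lies in the kernel because `Br_P(y)` is fixed by `N_K(P)`.
  have h3 : ∑ x ∈ s, act (x.out : H) (a * y) - (∑ x ∈ s, act (x.out : H) a) * y ∈
      brauerKer act P := by
    rw [Finset.sum_mul, ← Finset.sum_sub_distrib]
    refine AddSubgroup.sum_mem _ fun x hx => ?_
    have hn := mem_normalizer_of_inv_conj_mem (hs x hx)
    rw [map_mul, ← mul_sub]
    exact mul_mem_brauerKer (fixedPts_map _ (hs x hx) ha) (hy' _ x.out.2 hn)
  have h4 := sub_mem (add_mem h1 h3) h2
  rw [sub_mul] at h4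
  convert h4 using 1
  abel

end Brauer

end BlockExt

/-! ### The embedding of `R` into `A(P)`. -/

namespace BlockExt

namespace InteriorAlgebra

theorem conj_eq_of_mem_centralizer {H : Type*} [Group H] {P : Subgroup H} {x u : H}
    (hx : x ∈ Subgroup.centralizer (P : Set H)) (hu : u ∈ P) : u * x * u⁻¹ = x :=
  mul_inv_eq_of_eq_mul (Subgroup.mem_centralizer_iff.1 hx u hu)

theorem centralizerMap_injective {H : Type*} [Group H] (K P : Subgroup H) [K.Normal] :
    Function.Injective (centralizerMap K P) := by
  rw [injective_iff_map_eq_one]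
  intro τ hτ
  induction τ using QuotientGroup.induction_on with | _ x
  exact (QuotientGroup.eq_one_iff x).2 (Subgroup.mem_subgroupOf.2 ((QuotientGroup.eq_one_iff _).1 hτ))

namespace Crossed

variable {O H : Type*} [CommRing O] [Group H] {K : Subgroup H} [hK : K.Normal]
  {B : Type*} [Ring B] [Algebra O B] {𝒜 : InteriorAlgebra O K B}

variable (𝒜) in
open Classical in
/-- The projection of `A` onto `A_σ`. -/
noncomputable def part (σ : H ⧸ K) : 𝒜.Crossed →ₗ[O] 𝒜.Crossed where
  toFun f := (⟨fun x => if (x : H ⧸ K) = σ then coeff 𝒜 f x else 0, by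
    intro k x
    have h : ((k * x : H) : H ⧸ K) = x := by
      rw [eq_comm, QuotientGroup.eq, ← mul_assoc]
      simpa using hK.conj_mem k k.2 x⁻¹
    simp only [h]
    split_ifs
    · exact coeff_mul_left f k x
    · simp⟩ : ↥𝒜.funs)
  map_add' f g := ext fun x => by
    change (if _ then coeff 𝒜 (f + g) x else 0) = (if _ then _ else 0) + (if _ then _ else 0)
    split_ifs <;> simp
  map_smul' r f := ext fun x => by
    change (if _ then coeff 𝒜 (r • f) x else 0) = r • (if _ then _ else 0)
    split_ifs <;> simp

open Classical in
theorem coeff_part (σ : H ⧸ K) (f : 𝒜.Crossed) (x : H) :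
    coeff 𝒜 (part 𝒜 σ f) x = if (x : H ⧸ K) = σ then coeff 𝒜 f x else 0 := rfl

theorem part_self {σ : H ⧸ K} {f : 𝒜.Crossed} (hf : f ∈ grad 𝒜 σ) : part 𝒜 σ f = f :=
  ext fun x => by
    rw [coeff_part]
    split_ifs with h
    · rfl
    · exact (hf x h).symm

theorem part_of_ne {σ τ : H ⧸ K} {f : 𝒜.Crossed} (hf : f ∈ grad 𝒜 τ) (h : τ ≠ σ) :
    part 𝒜 σ f = 0 :=
  ext fun x => by
    rw [coeff_part, map_zero]
    split_ifs with h1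
    · exact hf x (by rw [h1]; exact h.symm)
    · rfl

variable (𝒜) in
/-- The coefficient at `x`. -/
def coeffAt (x : H) : 𝒜.Crossed →ₗ[O] B := (LinearMap.proj x).comp (coeff 𝒜)

theorem coeffAt_apply (x : H) (f : 𝒜.Crossed) : coeffAt 𝒜 x f = coeff 𝒜 f x := rfl

variable (𝒜) in
/-- The map `a ↦ a ⊗ x`. -/
noncomputable def tmulLin (x : H) : B →ₗ[O] 𝒜.Crossed where
  toFun a := tmul 𝒜 a x
  map_add' a c := ext_of_support x (tmul_mem_grad _ x)
    (Submodule.add_mem _ (tmul_mem_grad a x) (tmul_mem_grad c x)) (by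
      rw [map_add, Pi.add_apply]; simp only [coeff_tmul_self])
  map_smul' r a := ext_of_support x (tmul_mem_grad _ x)
    (Submodule.smul_mem _ r (tmul_mem_grad a x)) (by
      rw [map_smul, Pi.smul_apply]; simp only [coeff_tmul_self, RingHom.id_apply])

theorem tmulLin_apply (x : H) (a : B) : tmulLin 𝒜 x a = tmul 𝒜 a x := rfl

variable [Finite H]

theorem eq_sum_tmul [Fintype (H ⧸ K)] (f : 𝒜.Crossed) :
    f = ∑ σ : H ⧸ K, tmul 𝒜 (coeff 𝒜 f σ.out) σ.out := by
  refine ext fun x => ?_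
  rw [map_sum, Finset.sum_apply, Finset.sum_eq_single (x : H ⧸ K)]
  · have h : part 𝒜 (x : H ⧸ K) f ∈ grad 𝒜 ((x : H ⧸ K).out : H ⧸ K) := by
      intro y hy
      rw [QuotientGroup.out_eq'] at hy
      rw [coeff_part, if_neg hy]
    have h1 := congrArg (fun g => coeff 𝒜 g x) (eq_tmul h)
    simp only [coeff_part, if_true, QuotientGroup.out_eq'] at h1
    exact h1
  · intro σ _ hσ
    exact coeff_tmul_of_ne _ (by rw [QuotientGroup.out_eq']; exact hσ.symm)
  · simp

theorem coeff_crossedAct (h : H) (f : 𝒜.Crossed) (x : H) :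
    coeff 𝒜 (𝒜.crossedAct h f) x = 𝒜.act h (coeff 𝒜 f (h⁻¹ * x * h)) := by
  have : MulAut.conj h⁻¹ x = h⁻¹ * x * h := by simp
  rw [← this]
  rfl

/-- Conjugation by elements of `K` is trivial on `H/K`, so `K` preserves every degree of `A`. -/
theorem part_crossedAct {u : H} (hu : u ∈ K) (σ : H ⧸ K) (f : 𝒜.Crossed) :
    part 𝒜 σ (𝒜.crossedAct u f) = 𝒜.crossedAct u (part 𝒜 σ f) := ext fun x => by
  have h : ((u⁻¹ * x * u : H) : H ⧸ K) = x := by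
    have h1 : (u : H ⧸ K) = 1 := (QuotientGroup.eq_one_iff u).2 hu
    simp [h1]
  rw [coeff_part, coeff_crossedAct, coeff_crossedAct, coeff_part, h]
  split_ifs
  · rfl
  · rw [map_zero]

/-- Conjugation by `P` fixes `x`, so taking the coefficient at `x` is `P`-equivariant and descends
to the Brauer quotients. -/
theorem coeffAt_crossedAct {P : Subgroup H} (x : Subgroup.centralizer (P : Set H)) :
    ∀ u ∈ P, ∀ f, coeffAt 𝒜 (x : H) (𝒜.crossedAct u f) = 𝒜.act u (coeffAt 𝒜 x f) := by
  intro u hu f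
  have h := conj_eq_of_mem_centralizer x.2 (inv_mem hu)
  rw [inv_inv] at h
  rw [coeffAt_apply, coeff_crossedAct, h, coeffAt_apply]

theorem tmulLin_act {P : Subgroup H} (x : Subgroup.centralizer (P : Set H)) :
    ∀ u ∈ P, ∀ a, tmulLin 𝒜 (x : H) (𝒜.act u a) = 𝒜.crossedAct u (tmulLin 𝒜 x a) := by
  intro u hu a
  rw [tmulLin_apply, tmulLin_apply, crossedAct_tmul, conj_eq_of_mem_centralizer x.2 hu]

end Crossed

variable {O H : Type*} [CommRing O] [Group H] {K : Subgroup H} [hK : K.Normal]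
  {B : Type*} [Ring B] [Algebra O B] (𝒜 : InteriorAlgebra O K B) [Finite H] {P : Subgroup H}

theorem tmul_mem_fixedPts_of_mem_centralizer (x : Subgroup.centralizer (P : Set H)) {a : B}
    (ha : a ∈ fixedPts 𝒜.act P) : Crossed.tmul 𝒜 a (x : H) ∈ fixedPts 𝒜.crossedAct P :=
  map_mem_fixedPts le_rfl (Crossed.tmulLin 𝒜 (x : H)) (Crossed.tmulLin_act x) ha

variable [IsLocalRing O]

variable (P) in
/-- The map `A_1(P) → A(P)`, `Br_P(a) ↦ Br_P(a ⊗ x)`, for `x ∈ C_H(P)`. -/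
noncomputable def brauerTmul (x : Subgroup.centralizer (P : Set H)) :
    BrauerQuot 𝒜.act P →ₗ[O] BrauerQuot 𝒜.crossedAct P :=
  brauerMap (Crossed.tmulLin 𝒜 (x : H)) (Crossed.tmulLin_act x)

variable (P) in
/-- The map `A(P) → A_1(P)` that takes the coefficient at `x ∈ C_H(P)`. -/
noncomputable def brauerCoeff (x : Subgroup.centralizer (P : Set H)) :
    BrauerQuot 𝒜.crossedAct P →ₗ[O] BrauerQuot 𝒜.act P :=
  brauerMap (Crossed.coeffAt 𝒜 (x : H)) (Crossed.coeffAt_crossedAct x)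

variable {𝒜}

theorem brauerTmul_Br (x : Subgroup.centralizer (P : Set H)) (a : fixedPts 𝒜.act P) :
    𝒜.brauerTmul P x (Br 𝒜.act P a) = Br 𝒜.crossedAct P
      ⟨Crossed.tmul 𝒜 a (x : H), tmul_mem_fixedPts_of_mem_centralizer 𝒜 x a.2⟩ :=
  brauerMap_Br _ _ _

theorem brauerCoeff_Br (x : Subgroup.centralizer (P : Set H)) (f : fixedPts 𝒜.crossedAct P) :
    𝒜.brauerCoeff P x (Br 𝒜.crossedAct P f) = Br 𝒜.act P ⟨Crossed.coeff 𝒜 f (x : H),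
      map_mem_fixedPts le_rfl (Crossed.coeffAt 𝒜 (x : H)) (Crossed.coeffAt_crossedAct x) f.2⟩ :=
  brauerMap_Br _ _ _

theorem brauerCoeff_brauerTmul_self (x : Subgroup.centralizer (P : Set H))
    (a : BrauerQuot 𝒜.act P) : 𝒜.brauerCoeff P x (𝒜.brauerTmul P x a) = a := by
  obtain ⟨a, rfl⟩ := Br_surjective 𝒜.act P a
  rw [brauerTmul_Br, brauerCoeff_Br]
  exact congrArg (Br 𝒜.act P) (Subtype.ext (Crossed.coeff_tmul_self _ _))

theorem brauerCoeff_brauerTmul_of_ne {x y : Subgroup.centralizer (P : Set H)}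
    (h : ((x : H) : H ⧸ K) ≠ (y : H)) (a : BrauerQuot 𝒜.act P) :
    𝒜.brauerCoeff P x (𝒜.brauerTmul P y a) = 0 := by
  obtain ⟨a, rfl⟩ := Br_surjective 𝒜.act P a
  rw [brauerTmul_Br, brauerCoeff_Br, ← map_zero (Br 𝒜.act P)]
  exact congrArg (Br 𝒜.act P) (Subtype.ext (Crossed.coeff_tmul_of_ne _ h))

theorem brauerTmul_mul (x y : Subgroup.centralizer (P : Set H)) (a c : BrauerQuot 𝒜.act P) :
    𝒜.brauerTmul P x a * 𝒜.brauerTmul P y c =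
      𝒜.brauerTmul P (x * y) (a * (𝒜.brauerInterior P).act x c) := by
  obtain ⟨a, rfl⟩ := Br_surjective 𝒜.act P a
  obtain ⟨c, rfl⟩ := Br_surjective 𝒜.act P c
  change _ = 𝒜.brauerTmul P (x * y) (Br 𝒜.act P a * brauerAct 𝒜.act P
    (Subgroup.inclusion (Subgroup.centralizer_le_normalizer _) x) (Br 𝒜.act P c))
  rw [brauerAct_Br, ← map_mul, brauerTmul_Br, brauerTmul_Br, brauerTmul_Br, ← map_mul]
  exact congrArg (Br 𝒜.crossedAct P) (Subtype.ext (Crossed.tmul_mul_tmul _ _ _ _))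

theorem brauerTmul_mul_unit (a : BrauerQuot 𝒜.act P) (x : Subgroup.centralizer (P : Set H))
    (k : K.subgroupOf (Subgroup.centralizer (P : Set H))) :
    𝒜.brauerTmul P x (a * ((𝒜.brauerInterior P).unit k : (BrauerQuot 𝒜.act P)ˣ)) =
      𝒜.brauerTmul P (k * x) a := by
  obtain ⟨a, rfl⟩ := Br_surjective 𝒜.act P a
  have hk : (((𝒜.brauerInterior P).unit k : (BrauerQuot 𝒜.act P)ˣ) : BrauerQuot 𝒜.act P) =
    Br 𝒜.act P ⟨𝒜.unit ⟨k, Subgroup.mem_subgroupOf.1 k.2⟩, fun q hq => by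
        rw [𝒜.act_unit]
        congr 2
        refine Subtype.ext ?_
        have h := Subgroup.mem_centralizer_iff.1 (k : Subgroup.centralizer (P : Set H)).2 q hq
        exact mul_inv_eq_of_eq_mul h⟩ := rfl
  rw [hk, ← map_mul, brauerTmul_Br, brauerTmul_Br]
  exact congrArg (Br 𝒜.crossedAct P) (Subtype.ext
    (Crossed.tmul_unit (𝒜 := 𝒜) (a : B)
      (⟨((k : Subgroup.centralizer (P : Set H)) : H), Subgroup.mem_subgroupOf.1 k.2⟩ : K) (x : H)))

/-- Changing the representative by an element of `C_K(P)` introduces a unit in the coefficient and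
its inverse in the tensor, so the summands of `crossedToBrauerLin` are independent of
representatives. -/
theorem brauerTmul_coeff_eq (F : 𝒜.BrauerCrossed P) {x y : Subgroup.centralizer (P : Set H)}
    (h : (x : Subgroup.centralizer (P : Set H) ⧸
      K.subgroupOf (Subgroup.centralizer (P : Set H))) = y) :
    𝒜.brauerTmul P x (Crossed.coeff (𝒜.brauerInterior P) F x) =
      𝒜.brauerTmul P y (Crossed.coeff (𝒜.brauerInterior P) F y) := by
  obtain ⟨k, rfl⟩ : ∃ k : K.subgroupOf (Subgroup.centralizer (P : Set H)), k * x = y := by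
    refine ⟨⟨y * x⁻¹, ?_⟩, by simp⟩
    have h1 := (inferInstance : (K.subgroupOf (Subgroup.centralizer (P : Set H))).Normal)
    exact h1.mem_comm_iff.1 (QuotientGroup.eq.1 h)
  rw [Crossed.coeff_mul_left, ← brauerTmul_mul_unit]
  simp [mul_assoc]

variable (𝒜 P) in
/-- The linear map `R → A(P)`, `Br_P(a) ⊗ x ↦ Br_P(a ⊗ x)`. -/
noncomputable def crossedToBrauerLin : 𝒜.BrauerCrossed P →ₗ[O] BrauerQuot 𝒜.crossedAct P :=
  ∑ᶠ τ : Subgroup.centralizer (P : Set H) ⧸ K.subgroupOf (Subgroup.centralizer (P : Set H)),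
    (𝒜.brauerTmul P τ.out).comp (Crossed.coeffAt (𝒜.brauerInterior P) τ.out)

theorem crossedToBrauerLin_apply [Fintype (Subgroup.centralizer (P : Set H) ⧸
    K.subgroupOf (Subgroup.centralizer (P : Set H)))] (F : 𝒜.BrauerCrossed P) :
    𝒜.crossedToBrauerLin P F = ∑ τ : Subgroup.centralizer (P : Set H) ⧸
      K.subgroupOf (Subgroup.centralizer (P : Set H)),
      𝒜.brauerTmul P τ.out (Crossed.coeff (𝒜.brauerInterior P) F τ.out) := by
  rw [crossedToBrauerLin, finsum_eq_sum_of_fintype, LinearMap.sum_apply]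
  rfl

theorem crossedToBrauerLin_tmul (a : BrauerQuot 𝒜.act P)
    (x : Subgroup.centralizer (P : Set H)) :
    𝒜.crossedToBrauerLin P (Crossed.tmul (𝒜.brauerInterior P) a x) = 𝒜.brauerTmul P x a := by
  let _ := Fintype.ofFinite (Subgroup.centralizer (P : Set H) ⧸
    K.subgroupOf (Subgroup.centralizer (P : Set H)))
  rw [crossedToBrauerLin_apply, Finset.sum_eq_single (x : Subgroup.centralizer (P : Set H) ⧸
      K.subgroupOf (Subgroup.centralizer (P : Set H)))]
  · rw [brauerTmul_coeff_eq _ (QuotientGroup.out_eq' _), Crossed.coeff_tmul_self]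
  · intro τ _ hτ
    rw [Crossed.coeff_tmul_of_ne, map_zero]
    rwa [QuotientGroup.out_eq']
  · simp

theorem crossedToBrauerLin_mul (F F' : 𝒜.BrauerCrossed P) :
    𝒜.crossedToBrauerLin P (F * F') = 𝒜.crossedToBrauerLin P F * 𝒜.crossedToBrauerLin P F' := by
  let _ := Fintype.ofFinite (Subgroup.centralizer (P : Set H) ⧸
    K.subgroupOf (Subgroup.centralizer (P : Set H)))
  rw [Crossed.eq_sum_tmul F, Crossed.eq_sum_tmul F']
  simp only [Finset.sum_mul_sum, map_sum, Crossed.tmul_mul_tmul, crossedToBrauerLin_tmul,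
    brauerTmul_mul]

variable (𝒜 P) in
/-- The homomorphism `R → A(P)`, `Br_P(a) ⊗ x ↦ Br_P(a ⊗ x)`. -/
noncomputable def crossedToBrauer : 𝒜.BrauerCrossed P →ₐ[O] BrauerQuot 𝒜.crossedAct P :=
  AlgHom.ofLinearMap (𝒜.crossedToBrauerLin P)
    (by
      rw [Crossed.one_def, crossedToBrauerLin_tmul, ← map_one (Br 𝒜.act P), brauerTmul_Br]
      rfl)
    crossedToBrauerLin_mul

theorem crossedToBrauer_tmul (a : fixedPts 𝒜.act P) (x : Subgroup.centralizer (P : Set H)) :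
    𝒜.crossedToBrauer P (Crossed.tmul (𝒜.brauerInterior P) (Br 𝒜.act P a) x) =
      Br 𝒜.crossedAct P
        ⟨Crossed.tmul 𝒜 a (x : H), tmul_mem_fixedPts_of_mem_centralizer 𝒜 x a.2⟩ :=
  (crossedToBrauerLin_tmul _ _).trans (brauerTmul_Br _ _)

/-- Applying `brauerCoeff` at a representative isolates one coefficient: distinct classes modulo
`C_K(P)` remain distinct modulo `K`, so all other terms vanish. -/
theorem crossedToBrauer_injective : Function.Injective (𝒜.crossedToBrauer P) := by
  rw [injective_iff_map_eq_zero]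
  intro F hF
  let _ := Fintype.ofFinite (Subgroup.centralizer (P : Set H) ⧸
    K.subgroupOf (Subgroup.centralizer (P : Set H)))
  have hF' : 𝒜.crossedToBrauerLin P F = 0 := hF
  rw [Crossed.eq_sum_tmul F]
  refine Finset.sum_eq_zero fun τ _ => ?_
  have h1 := congrArg (𝒜.brauerCoeff P τ.out) hF'
  rw [crossedToBrauerLin_apply, map_sum, map_zero, Finset.sum_eq_single τ,
    brauerCoeff_brauerTmul_self] at h1
  · rw [h1]
    exact map_zero (Crossed.tmulLin (𝒜.brauerInterior P) τ.out)
  · intro τ' _ hτ'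
    refine brauerCoeff_brauerTmul_of_ne (fun h => hτ' ?_) _
    apply centralizerMap_injective K P
    rw [← QuotientGroup.out_eq' τ, ← QuotientGroup.out_eq' τ']
    exact h.symm
  · simp

theorem crossedToBrauer_mem {τ : Subgroup.centralizer (P : Set H) ⧸
      K.subgroupOf (Subgroup.centralizer (P : Set H))} {F : 𝒜.BrauerCrossed P}
    (hF : F ∈ Crossed.grad (𝒜.brauerInterior P) τ) :
    𝒜.crossedToBrauer P F ∈ 𝒜.brauerGrad P (centralizerMap K P τ) := by
  induction τ using QuotientGroup.induction_on with | _ x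
  rw [Crossed.eq_tmul hF]
  obtain ⟨a, ha⟩ := Br_surjective 𝒜.act P (Crossed.coeff (𝒜.brauerInterior P) F x)
  rw [← ha, crossedToBrauer_tmul]
  exact ⟨_, Crossed.tmul_mem_grad (a : B) (x : H), rfl⟩

/-- A `P`-fixed element of degree `xK` with `x` in `C_H(P)` has the form `a ⊗ x`, and `a` is then
itself `P`-fixed. -/
theorem exists_crossedToBrauer_eq {τ : Subgroup.centralizer (P : Set H) ⧸
      K.subgroupOf (Subgroup.centralizer (P : Set H))} {Y : BrauerQuot 𝒜.crossedAct P}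
    (hY : Y ∈ 𝒜.brauerGrad P (centralizerMap K P τ)) :
    ∃ F ∈ Crossed.grad (𝒜.brauerInterior P) τ, 𝒜.crossedToBrauer P F = Y := by
  induction τ using QuotientGroup.induction_on with | _ x
  obtain ⟨f, hf, rfl⟩ := hY
  have hf' : (f : 𝒜.Crossed) ∈ Crossed.grad 𝒜 ((x : H) : H ⧸ K) := hf
  refine ⟨Crossed.tmul _ (Br 𝒜.act P ⟨Crossed.coeff 𝒜 f (x : H),
      map_mem_fixedPts le_rfl (Crossed.coeffAt 𝒜 (x : H)) (Crossed.coeffAt_crossedAct x) f.2⟩) x,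
    Crossed.tmul_mem_grad _ x, ?_⟩
  rw [crossedToBrauer_tmul]
  exact congrArg (Br 𝒜.crossedAct P) (Subtype.ext (Crossed.eq_tmul hf').symm)

theorem crossedToBrauer_act (n : Subgroup.normalizer (P : Set H)) (F : 𝒜.BrauerCrossed P) :
    𝒜.crossedToBrauer P ((𝒜.brauerSym P).crossed n F) =
      brauerAct 𝒜.crossedAct P n (𝒜.crossedToBrauer P F) := by
  let _ := Fintype.ofFinite (Subgroup.centralizer (P : Set H) ⧸
    K.subgroupOf (Subgroup.centralizer (P : Set H)))
  have key : ∀ a x, 𝒜.crossedToBrauer P ((𝒜.brauerSym P).crossed n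
      (Crossed.tmul (𝒜.brauerInterior P) a x)) =
      brauerAct 𝒜.crossedAct P n (𝒜.crossedToBrauer P
        (Crossed.tmul (𝒜.brauerInterior P) a x)) := by
    intro a x
    obtain ⟨a, rfl⟩ := Br_surjective 𝒜.act P a
    rw [Sym.crossed_tmul, crossedToBrauer_tmul, brauerAct_Br]
    refine (crossedToBrauer_tmul (fixedAct 𝒜.act P n a) (conjCentralizer P n x)).trans ?_
    exact congrArg (Br 𝒜.crossedAct P) (Subtype.ext (crossedAct_tmul _ _ _).symm)
  rw [Crossed.eq_sum_tmul F]
  simp only [map_sum, key]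

end InteriorAlgebra

end BlockExt

/-! ### Blocks, defect groups and the two morphisms of the theorem. -/

namespace BlockExt

namespace InteriorAlgebra

variable {O H : Type*} [CommRing O] [Group H] {K : Subgroup H} [hK : K.Normal]
  {B : Type*} [Ring B] [Algebra O B] {𝒜 : InteriorAlgebra O K B} {b : B}

/-! ### Blocks -/

theorem fixedPts_act_of_normal (h : H) {a : B} (ha : a ∈ fixedPts 𝒜.act K) :
    𝒜.act h a ∈ fixedPts 𝒜.act K :=
  fixedPts_map h (fun q hq => by simpa using hK.conj_mem q hq h⁻¹) ha

theorem act_act_inv (h : H) (a : B) : 𝒜.act h (𝒜.act h⁻¹ a) = a := by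
  rw [act_act, mul_inv_cancel, map_one, AlgHom.one_apply]

/-- A block is either orthogonal to a conjugate or dominated by it. -/
theorem IsBlock.mul_act_eq (hb : 𝒜.IsBlock b) (h : H) : b * 𝒜.act h b = 0 ∨ b * 𝒜.act h b = b := by
  have hc : 𝒜.act h b ∈ fixedPts 𝒜.act K := fixedPts_act_of_normal h hb.mem_fixed
  have hcc : 𝒜.act h b * 𝒜.act h b = 𝒜.act h b := by rw [← map_mul, hb.idem]
  have hcomm := hb.central (𝒜.act h b)
  have hi : b * 𝒜.act h b * (b * 𝒜.act h b) = b * 𝒜.act h b := by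
    rw [mul_assoc, ← mul_assoc (𝒜.act h b), ← hcomm, mul_assoc b (𝒜.act h b), hcc, ← mul_assoc,
      hb.idem]
  have hb1 : b * (b * 𝒜.act h b) = b * 𝒜.act h b := by rw [← mul_assoc, hb.idem]
  have hb2 : b * 𝒜.act h b * b = b * 𝒜.act h b := by rw [← hb.central, hb1]
  -- Centrality makes `b · ʰb` idempotent, and primitivity is applied to its sum with its complement
  -- in `b`.
  refine (hb.primitive (b * 𝒜.act h b) (mul_mem hb.mem_fixed hc) (b - b * 𝒜.act h b)
    (sub_mem hb.mem_fixed (mul_mem hb.mem_fixed hc)) hi ?_ ?_ ?_ (add_sub_cancel _ _)).imp id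
    fun h => (sub_eq_zero.1 h).symm
  · rw [sub_mul, mul_sub, mul_sub, hb.idem, hb1, hb2, hi]; abel
  · rw [mul_sub, hb2, hi, sub_self]
  · rw [sub_mul, hb1, hi, sub_self]

/-- The hypothesis for `h` gives `b · ʰb = b`. Applying `h` to the corresponding equation for `h⁻¹`
gives `ʰb · b = ʰb`. -/
theorem IsBlock.act_eq_of_mul_ne_zero (hb : 𝒜.IsBlock b) {h : H} (h1 : b * 𝒜.act h b ≠ 0)
    (h2 : b * 𝒜.act h⁻¹ b ≠ 0) : 𝒜.act h b = b := by
  have h3 := (hb.mul_act_eq h).resolve_left h1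
  have h4 := congrArg (𝒜.act h) ((hb.mul_act_eq h⁻¹).resolve_left h2)
  rw [map_mul, act_act_inv, ← hb.central, h3] at h4
  exact h4.symm

variable [Finite H]

/-- The coefficient at `1` embeds `C_1` multiplicatively in `A_1`, with identity `b` and image fixed
by `K`; finiteness follows because `O` is Noetherian. An idempotent of `C_1` would split `b`, so
primitivity leaves only the trivial ones. -/
theorem IsBlock.isLocalRing [IsNoetherianRing O] [IsLocalRing O]
    [IsAdicComplete (IsLocalRing.maximalIdeal O) O] [Module.Finite O B] (hb : 𝒜.IsBlock b) :
    IsLocalRing (blockDatum hb).C₁ := by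
  let L : (blockDatum hb).C₁ →ₗ[O] B := (Crossed.coeffAt 𝒜 1).comp
    ((blockDatum hb).val.comp (Subalgebra.toSubmodule (blockDatum hb).C₁).subtype)
  have hgrad : ∀ x : (blockDatum hb).C₁,
      (blockDatum hb).val x ∈ Crossed.grad 𝒜 ((1 : H) : H ⧸ K) := fun x =>
    CliffordDatum.comp_grad x.2
  have heq : ∀ x : (blockDatum hb).C₁, (blockDatum hb).val x = Crossed.tmul 𝒜 (L x) 1 :=
    fun x => Crossed.eq_tmul (hgrad x)
  have hL : Function.Injective L := fun x y h => by
    refine Subtype.ext (CliffordDatum.ext_val ?_)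
    rw [heq x, heq y, h]
  have hmul : ∀ x y, L (x * y) = L x * L y := fun x y => by
    change Crossed.coeff 𝒜 ((blockDatum hb).val x * (blockDatum hb).val y) 1 = _
    rw [heq x, heq y, Crossed.tmul_mul_tmul, mul_one, Crossed.coeff_tmul_self, map_one,
      AlgHom.one_apply]
  have hone : L 1 = b := Crossed.coeff_tmul_self (𝒜 := 𝒜) b 1
  have hfix : ∀ x, L x ∈ fixedPts 𝒜.act K := fun x k hk => by
    have h1 : 𝒜.crossedAct k ((blockDatum hb).val x) = (blockDatum hb).val x :=
      CliffordDatum.comp_fix x.2 k hk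
    have h2 := congrArg (fun f => Crossed.coeff 𝒜 f 1) h1
    simp only [Crossed.coeff_crossedAct, mul_one, inv_mul_cancel] at h2
    exact h2
  have : Module.Finite O (blockDatum hb).C₁ := Module.Finite.of_injective L hL
  have : Nontrivial (blockDatum hb).C₁ := ⟨1, 0, fun h => hb.ne_zero (by
    rw [← hone, h, map_zero])⟩
  refine isLocalRing_of_idempotents (O := O) fun f hf => ?_
  have h1 : b * L f = L f := by
    have := hmul 1 f
    rw [one_mul, hone] at this
    exact this.symm
  have h2 : L f * b = L f := by
    have := hmul f 1
    rw [mul_one, hone] at this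
    exact this.symm
  have h3 : L f * L f = L f := by rw [← hmul, hf]
  refine (hb.primitive (L f) (hfix f) (b - L f) (sub_mem hb.mem_fixed (hfix f)) h3 ?_ ?_ ?_
    (add_sub_cancel _ _)).imp (fun h => ?_) fun h => ?_
  · rw [sub_mul, mul_sub, mul_sub, hb.idem, h1, h2, h3]; abel
  · rw [mul_sub, h2, h3, sub_self]
  · rw [sub_mul, h1, h3, sub_self]
  · exact hL (by rw [h, map_zero])
  · exact hL (by rw [hone]; exact (sub_eq_zero.1 h).symm)

/-- The grading of `A`. -/
noncomputable def blockGrading (hb : 𝒜.IsBlock b) : (blockDatum hb).Grading where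
  part := Crossed.part 𝒜
  part_self := fun hx => Crossed.part_self hx
  part_of_ne := fun hx h => Crossed.part_of_ne hx h

variable [IsLocalRing O] {P : Subgroup H}

/-- The grading of `A(P)`. -/
noncomputable def brauerGrading (hb : 𝒜.IsBlock b) (hP : P ≤ K) :
    (brauerDatum hb hP).Grading where
  part σ := brauerMap (Crossed.part 𝒜 σ) fun _ hu f => Crossed.part_crossedAct (hP hu) σ f
  part_self := by
    rintro σ _ ⟨x, hx, rfl⟩
    exact (brauerMap_Br _ _ _).trans
      (congrArg (Br 𝒜.crossedAct P) (Subtype.ext (Crossed.part_self hx)))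
  part_of_ne := by
    rintro σ τ _ ⟨x, hx, rfl⟩ h
    refine (brauerMap_Br _ _ _).trans ?_
    rw [← map_zero (Br 𝒜.crossedAct P)]
    exact congrArg (Br 𝒜.crossedAct P) (Subtype.ext (Crossed.part_of_ne hx h))

/-- The grading of `R`. -/
noncomputable def centralizerGrading (hb : 𝒜.IsBlock b) (hP : P ≤ K) :
    (centralizerDatum hb hP).Grading where
  part := Crossed.part (𝒜.brauerInterior P)
  part_self := fun hx => Crossed.part_self hx
  part_of_ne := fun hx h => Crossed.part_of_ne hx h

/-! ### Stabilizers -/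

theorem IsDefectGroup.bbar_ne_zero (hb : 𝒜.IsBlock b) (hP : 𝒜.IsDefectGroup b P) :
    bbar hb hP.le ≠ 0 := hP.br_ne_zero.2

theorem IsDefectGroup.notMem_brauerKer (hP : 𝒜.IsDefectGroup b P) : b ∉ brauerKer 𝒜.act P := by
  intro h
  obtain ⟨h1, h2⟩ := mem_brauerKer.1 h
  obtain ⟨h3, h4⟩ := hP.br_ne_zero
  exact h4 h2

/-- If `n` fixes `b̄`, then `Br_P(b · ⁿb) = b̄² = b̄` is nonzero, hence so is `b · ⁿb`. The same
holds for `n⁻¹`, and then the blocks coincide. -/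
theorem act_eq_iff_brauerAct_bbar_eq (hb : 𝒜.IsBlock b) (hP : 𝒜.IsDefectGroup b P)
    (n : Subgroup.normalizer (P : Set H)) :
    brauerAct 𝒜.act P n (bbar hb hP.le) = bbar hb hP.le ↔ 𝒜.act (n : H) b = b := by
  refine ⟨fun h => ?_, bbar_fixed hb hP.le n⟩
  have key : ∀ m : Subgroup.normalizer (P : Set H),
      brauerAct 𝒜.act P m (bbar hb hP.le) = bbar hb hP.le → b * 𝒜.act (m : H) b ≠ 0 := by
    intro m hm h0
    apply hP.bbar_ne_zero hb
    have h1 : bbar hb hP.le * brauerAct 𝒜.act P m (bbar hb hP.le) = 0 := by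
      rw [bbar, brauerAct_Br, ← map_mul, ← map_zero (Br 𝒜.act P)]
      exact congrArg (Br 𝒜.act P) (Subtype.ext h0)
    rwa [hm, bbar_idem] at h1
  have hinv : n⁻¹ ∈ stab (brauerAct 𝒜.act P) (bbar hb hP.le) := inv_mem (show n ∈ stab _ _ from h)
  exact hb.act_eq_of_mul_ne_zero (key n h) (key n⁻¹ hinv)

theorem normStab_eq_normStabBar (hb : 𝒜.IsBlock b) (hP : 𝒜.IsDefectGroup b P) :
    𝒜.normStab b P = normStabBar hb hP.le := by
  ext n
  constructor
  · rintro ⟨hn, hn'⟩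
    exact ⟨⟨n, hn⟩, (act_eq_iff_brauerAct_bbar_eq hb hP ⟨n, hn⟩).2 hn', rfl⟩
  · rintro ⟨n, hn, rfl⟩
    exact ⟨n.2, (act_eq_iff_brauerAct_bbar_eq hb hP n).1 hn⟩

/-- This is a Frattini argument. As `h` normalizes `K` and fixes `b`, the block is also a trace from
`hPh⁻¹`. Since `Br_P(b)` is nonzero, some `k` in `K` satisfies `k⁻¹Pk ≤ hPh⁻¹`, and then `kh`
normalizes `P`. -/
theorem exists_mul_mem_normalizer (hP : 𝒜.IsDefectGroup b P) {h : H}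
    (hh : 𝒜.act h b = b) : ∃ k ∈ K, k * h ∈ Subgroup.normalizer (P : Set H) := by
  have h1 : h ∈ Subgroup.normalizer (K : Set H) := by
    rw [Subgroup.normalizer_eq_top]; trivial
  have h2 := act_traceImage 𝒜.act h1 hP.mem_trace
  rw [hh] at h2
  obtain ⟨k, hk, hk'⟩ := exists_conj_mem_of_notMem_brauerKer hP.le h2 hP.notMem_brauerKer
  refine ⟨k, hk, mem_normalizer_of_inv_conj_mem fun u hu => ?_⟩
  obtain ⟨v, hv, hvu⟩ := hk' u hu
  have : (k * h)⁻¹ * u * (k * h) = v := by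
    have h3 : h * v * h⁻¹ = k⁻¹ * u * k := hvu
    have h4 : (k * h)⁻¹ * u * (k * h) = h⁻¹ * (k⁻¹ * u * k) * h := by simp [mul_assoc]
    rw [h4, ← h3]
    simp [mul_assoc]
  rw [this]
  exact hv

theorem stabG_eq_normImage (hb : 𝒜.IsBlock b) (hP : 𝒜.IsDefectGroup b P) :
    𝒜.stabG b = 𝒜.normImage b P := by
  refine le_antisymm ?_ (normImage_le 𝒜 b P)
  rintro _ ⟨h, hh, rfl⟩
  obtain ⟨k, hk, hkh⟩ := exists_mul_mem_normalizer hP hh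
  refine ⟨k * h, ⟨hkh, mul_mem (hb.le_stabH hk) hh⟩, ?_⟩
  rw [map_mul]
  have : QuotientGroup.mk' K k = 1 := (QuotientGroup.eq_one_iff k).2 hk
  rw [this, one_mul]

/-! ### Morphisms of Clifford data -/

/-- The identity of the target is the image of `b̄ ⊗ 1` under the injective map `R → A(P)`, and `b̄`
is nonzero. -/
theorem IsDefectGroup.brauerDatum_e_ne_zero (hb : 𝒜.IsBlock b) (hP : 𝒜.IsDefectGroup b P) :
    (brauerDatum hb hP.le).e ≠ 0 := by
  intro h
  have h1 := (crossedToBrauer_tmul (𝒜 := 𝒜) (P := P) ⟨b, hb.mem_fixedPts_of_le hP.le⟩ 1).trans h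
  rw [← map_zero (𝒜.crossedToBrauer P)] at h1
  have h2 := congrArg (fun f => Crossed.coeff (𝒜.brauerInterior P) f 1)
    (crossedToBrauer_injective h1)
  simp only [Crossed.coeff_tmul_self, map_zero] at h2
  exact hP.bbar_ne_zero hb h2

/-- The Brauer homomorphism as a morphism from the datum of `b` to the datum given by `A(P)`. -/
noncomputable def brauerMorphism (hb : 𝒜.IsBlock b) (hP : 𝒜.IsDefectGroup b P) :
    (blockDatum hb).Morphism (brauerDatum hb hP.le) where
  onΓ := MonoidHom.id _
  onΓ_injective := Function.injective_id
  onFix := (Br 𝒜.crossedAct P).comp (Subalgebra.inclusion (fixedPts_mono 𝒜.crossedAct hP.le))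
  map_e := rfl
  map_comp := by
    rintro σ ⟨x, hx⟩ hx'
    refine CliffordDatum.mem_comp.2 ⟨Br 𝒜.crossedAct P ⟨x, fixedPts_mono 𝒜.crossedAct hP.le hx⟩,
      ⟨_, CliffordDatum.comp_grad hx', rfl⟩, fun n hn => ?_, ?_⟩
    · rw [brauerAct_Br]
      exact congrArg (Br 𝒜.crossedAct P) (Subtype.ext (hx n (Subgroup.mem_subgroupOf.1 hn)))
    · exact congrArg (Br 𝒜.crossedAct P) (Subtype.ext (CliffordDatum.e_mul hx'))
  surj := by
    intro σ Y hY
    obtain ⟨Z, ⟨y, hy, rfl⟩, hZ, rfl⟩ := CliffordDatum.mem_comp.1 hY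
    obtain ⟨a, ha, hab⟩ := hP.mem_trace
    have ha' : Crossed.tmulLin 𝒜 1 a ∈ fixedPts 𝒜.crossedAct P :=
      tmul_mem_fixedPts_of_mem_centralizer 𝒜 (1 : Subgroup.centralizer (P : Set H)) ha
    -- The map `a ↦ a ⊗ 1` commutes with the action, so the expression of `b` as a trace carries
    -- over to `A`.
    have htr : relTrace 𝒜.crossedAct P K (Crossed.tmulLin 𝒜 1 a) = Crossed.tmul 𝒜 b 1 := by
      rw [← map_relTrace (Crossed.tmulLin 𝒜 1) (fun u _ c => ?_) a, hab, Crossed.tmulLin_apply]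
      rw [Crossed.tmulLin_apply, Crossed.tmulLin_apply, crossedAct_tmul]
      simp
    have hy' : (y : 𝒜.Crossed) ∈ Crossed.grad 𝒜 σ := hy
    have hfix : ∀ n ∈ K, n ∈ Subgroup.normalizer (P : Set H) →
        𝒜.crossedAct n (y : 𝒜.Crossed) - y ∈ brauerKer 𝒜.crossedAct P := by
      intro n hn hn'
      exact (sub_mem_brauerKer_iff (x := fixedAct 𝒜.crossedAct P ⟨n, hn'⟩ y)).2
        (hZ ⟨n, hn'⟩ (Subgroup.mem_subgroupOf.2 hn))
    have h1 := relTrace_mul_sub_mem hP.le ha' y.2 hfix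
    rw [htr] at h1
    -- The candidate preimage. It is fixed by `K`, has degree `σ`, and satisfies `Br_P(z) = b̄
    -- Br_P(y)` by the trace formula.
    let z := relTrace 𝒜.crossedAct P K (Crossed.tmulLin 𝒜 1 a * y)
    have hz : z ∈ fixedPts 𝒜.crossedAct K := relTrace_mem_fixedPts (mul_mem ha' y.2)
    have hzg : z ∈ Crossed.grad 𝒜 σ := by
      let _ := Fintype.ofFinite (K ⧸ P.subgroupOf K)
      have h2 : Crossed.tmulLin 𝒜 1 a * y ∈ Crossed.grad 𝒜 σ := by
        have h3 := Crossed.mul_mem_grad (Crossed.tmul_mem_grad (𝒜 := 𝒜) a 1) hy'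
        rwa [QuotientGroup.mk_one, one_mul] at h3
      change relTrace 𝒜.crossedAct P K _ ∈ _
      rw [relTrace_apply, finsum_eq_sum_of_fintype]
      refine Submodule.sum_mem _ fun x _ => ?_
      rw [← Crossed.part_self h2, ← Crossed.part_crossedAct x.out.2]
      intro y hy
      rw [Crossed.coeff_part, if_neg hy]
    have hzb : Crossed.tmul 𝒜 b 1 * z ∈ (blockDatum hb).comp σ :=
      CliffordDatum.mem_comp.2 ⟨z, hzg, hz, rfl⟩
    refine ⟨⟨Crossed.tmul 𝒜 b 1 * z, CliffordDatum.comp_fix hzb⟩, hzb, ?_⟩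
    have hb1 := tmul_mem_fixedPts hb hP.le
    have h3 : Br 𝒜.crossedAct P ⟨z, fixedPts_mono 𝒜.crossedAct hP.le hz⟩ =
        Br 𝒜.crossedAct P (⟨Crossed.tmul 𝒜 b 1, hb1⟩ * y) := sub_mem_brauerKer_iff.1 h1
    -- Multiplication by `b` puts `z` into the component; on the Brauer side this adds a second
    -- factor `b̄`, absorbed by idempotency.
    have h4 := congrArg (fun w => Br 𝒜.crossedAct P ⟨Crossed.tmul 𝒜 b 1, hb1⟩ * w) h3
    simp only [map_mul] at h4
    rw [← mul_assoc, ← map_mul, ← map_mul] at h4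
    refine h4.trans ?_
    rw [map_mul]
    exact congrArg (· * Br 𝒜.crossedAct P y) (brauerDatum hb hP.le).e_mul_e
  mem_base := Iff.rfl
  e_ne_zero := hP.brauerDatum_e_ne_zero hb

theorem centralizerMap_mem_stabG_iff (hb : 𝒜.IsBlock b) (hP : 𝒜.IsDefectGroup b P)
    {τ : Subgroup.centralizer (P : Set H) ⧸ K.subgroupOf (Subgroup.centralizer (P : Set H))} :
    centralizerMap K P τ ∈ 𝒜.stabG b ↔ τ ∈ centralizerBase hb hP.le := by
  constructor
  · induction τ using QuotientGroup.induction_on with | _ x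
    intro h
    have h1 : 𝒜.act (x : H) b = b := hb.act_of_mem_stabG h
    exact ⟨x, (act_eq_iff_brauerAct_bbar_eq hb hP
      (Subgroup.inclusion (Subgroup.centralizer_le_normalizer _) x)).2 h1, rfl⟩
  · rintro ⟨x, hx, rfl⟩
    exact ⟨x, (act_eq_iff_brauerAct_bbar_eq hb hP
      (Subgroup.inclusion (Subgroup.centralizer_le_normalizer _) x)).1 hx, rfl⟩

/-- The homomorphism `R → A(P)` as a morphism of Clifford data. -/
noncomputable def centralizerMorphism (hb : 𝒜.IsBlock b) (hP : 𝒜.IsDefectGroup b P) :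
    (centralizerDatum hb hP.le).Morphism (brauerDatum hb hP.le) where
  onΓ := centralizerMap K P
  onΓ_injective := centralizerMap_injective K P
  onFix := (𝒜.crossedToBrauer P).comp (centralizerDatum hb hP.le).fix.val
  map_e := crossedToBrauer_tmul (𝒜 := 𝒜) (P := P) ⟨b, hb.mem_fixedPts_of_le hP.le⟩ 1
  map_comp := by
    rintro τ ⟨F, hF⟩ hF'
    refine CliffordDatum.mem_comp.2 ⟨𝒜.crossedToBrauer P F,
      crossedToBrauer_mem (CliffordDatum.comp_grad hF'), fun n hn => ?_, ?_⟩
    · rw [← crossedToBrauer_act]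
      exact congrArg (𝒜.crossedToBrauer P) (hF n hn)
    · have h1 : (brauerDatum hb hP.le).e =
          𝒜.crossedToBrauer P (centralizerDatum hb hP.le).e :=
        (crossedToBrauer_tmul (𝒜 := 𝒜) (P := P) ⟨b, hb.mem_fixedPts_of_le hP.le⟩ 1).symm
      rw [h1, ← map_mul]
      exact congrArg (𝒜.crossedToBrauer P) (CliffordDatum.e_mul hF')
  surj := by
    intro τ Y hY
    obtain ⟨Z, hZ, hZ', rfl⟩ := CliffordDatum.mem_comp.1 hY
    obtain ⟨F, hF, rfl⟩ := exists_crossedToBrauer_eq hZ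
    have hF' : F ∈ (centralizerDatum hb hP.le).fix := fun n hn =>
      crossedToBrauer_injective ((crossedToBrauer_act n F).trans (hZ' n hn))
    have hc : (centralizerDatum hb hP.le).e * F ∈ (centralizerDatum hb hP.le).comp τ :=
      CliffordDatum.mem_comp.2 ⟨F, hF, hF', rfl⟩
    refine ⟨⟨_, CliffordDatum.comp_fix hc⟩, hc, ?_⟩
    have h1 : (brauerDatum hb hP.le).e = 𝒜.crossedToBrauer P (centralizerDatum hb hP.le).e :=
      (crossedToBrauer_tmul (𝒜 := 𝒜) (P := P) ⟨b, hb.mem_fixedPts_of_le hP.le⟩ 1).symm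
    rw [h1]
    exact map_mul (𝒜.crossedToBrauer P) _ F
  mem_base := centralizerMap_mem_stabG_iff hb hP
  e_ne_zero := hP.brauerDatum_e_ne_zero hb

/-- Locality passes forward along a morphism, but here it is known for the target. The map of
identity components is bijective, so it can be transported back. -/
theorem isLocalRing_centralizerDatum (hb : 𝒜.IsBlock b) (hP : 𝒜.IsDefectGroup b P)
    [IsLocalRing (brauerDatum hb hP.le).C₁] : IsLocalRing (centralizerDatum hb hP.le).C₁ := by
  let t := centralizerMorphism hb hP
  have hinj : Function.Injective t.onC₁ := fun x y h => by
    refine Subtype.ext (CliffordDatum.ext_val (crossedToBrauer_injective ?_))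
    exact congrArg (fun z : (brauerDatum hb hP.le).C₁ => (brauerDatum hb hP.le).val z) h
  let e := AlgEquiv.ofBijective t.onC₁ ⟨hinj, t.onC₁_surjective⟩
  have : Nontrivial (centralizerDatum hb hP.le).C₁ := e.toEquiv.nontrivial
  exact isLocalRing_of_surjective e.symm e.symm.surjective

/-! ### Compatibility with the actions -/

/-- The quotient `n⁻¹ h` lies in `K` and so acts trivially on `A^K`, where the morphism is defined.
-/
theorem brauerMorphism_compatible (hb : 𝒜.IsBlock b) (hP : 𝒜.IsDefectGroup b P)
    (h : 𝒜.stabH b) (n : 𝒜.normStab b P) (hn : ((h : H) : H ⧸ K) = ((n : H) : H ⧸ K)) :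
    (brauerMorphism hb hP).Compatible h n := by
  have hk : (n : H)⁻¹ * h ∈ K := QuotientGroup.eq.1 hn.symm
  refine ⟨fun σ => ?_, fun x => ?_⟩
  · induction σ using QuotientGroup.induction_on with | _ y
    change (((h : H) * y * (h : H)⁻¹ : H) : H ⧸ K) = ((n : H) * y * (n : H)⁻¹ : H)
    simp only [QuotientGroup.mk_mul, QuotientGroup.mk_inv, hn]
  · refine congrArg (Br 𝒜.crossedAct P) (Subtype.ext ?_)
    change 𝒜.crossedAct (h : H) (x : 𝒜.Crossed) = 𝒜.crossedAct (n : H) (x : 𝒜.Crossed)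
    have h1 : 𝒜.crossedAct ((n : H)⁻¹ * h) (x : 𝒜.Crossed) = x := x.2 _ hk
    conv_rhs => rw [← h1]
    rw [← AlgHom.mul_apply, ← map_mul, mul_inv_cancel_left]

/-- Here `n'⁻¹ n` lies in `N_K(P)`, which fixes the relevant elements of `R` by definition. -/
theorem centralizerMorphism_compatible (hb : 𝒜.IsBlock b) (hP : 𝒜.IsDefectGroup b P)
    (n n' : 𝒜.normStab b P) (hn : ((n : H) : H ⧸ K) = ((n' : H) : H ⧸ K)) :
    (centralizerMorphism hb hP).Compatible n n' := by
  have hk : (n' : H)⁻¹ * n ∈ K := QuotientGroup.eq.1 hn.symm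
  refine ⟨fun τ => ?_, fun x => ?_⟩
  · induction τ using QuotientGroup.induction_on with | _ y
    change (((n : H) * y * (n : H)⁻¹ : H) : H ⧸ K) = ((n' : H) * y * (n' : H)⁻¹ : H)
    simp only [QuotientGroup.mk_mul, QuotientGroup.mk_inv, hn]
  · let m : Subgroup.normalizer (P : Set H) := Subgroup.inclusion inf_le_left n
    let m' : Subgroup.normalizer (P : Set H) := Subgroup.inclusion inf_le_left n'
    change 𝒜.crossedToBrauer P ((𝒜.brauerSym P).crossed m (x : 𝒜.BrauerCrossed P)) =
      brauerAct 𝒜.crossedAct P m' (𝒜.crossedToBrauer P (x : 𝒜.BrauerCrossed P))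
    rw [← crossedToBrauer_act]
    have h1 : (𝒜.brauerSym P).crossed (m'⁻¹ * m) (x : 𝒜.BrauerCrossed P) = x :=
      x.2 _ (Subgroup.mem_subgroupOf.2 hk)
    conv_rhs => rw [← h1]
    rw [← AlgHom.mul_apply, ← map_mul, mul_inv_cancel_left]

end InteriorAlgebra

end BlockExt

theorem theorem3 {O H A₁ : Type*} [CommRing O] [IsDomain O] [IsPrincipalIdealRing O]
    [IsLocalRing O] [IsAdicComplete (IsLocalRing.maximalIdeal O) O]
    (p : ℕ) [Fact p.Prime] [CharP (IsLocalRing.ResidueField O) p]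
    [Group H] [Finite H] (K : Subgroup H) [K.Normal]
    [Ring A₁] [Algebra O A₁] [Module.Finite O A₁]
    (𝒜 : InteriorAlgebra O K A₁) (b : A₁) (hb : 𝒜.IsBlock b)
    (P : Subgroup H) (hP : 𝒜.IsDefectGroup b P) :
    -- the three sequences are group extensions
    ((blockDatum hb).IsExtension ∧ (centralizerDatum hb hP.le).IsExtension ∧
      (brauerDatum hb hP.le).IsExtension) ∧
    -- the stabilizers
    (𝒜.stabG b = 𝒜.normImage b P ∧
      𝒜.stabG b = (normStabBar hb hP.le).map (QuotientGroup.mk' K) ∧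
      𝒜.normStab b P = normStabBar hb hP.le) ∧
    -- the subgroups that give the gradings
    (blockGroup hb = brauerGroup hb hP.le ∧ blockGroup hb = normalizerGroup hb hP.le) ∧
    -- the isomorphism between the extension of `b` and the extension given by `A(P)`
    (∃ (φ₁ : (blockDatum hb).Cbar₁ˣ ≃* (brauerDatum hb hP.le).Cbar₁ˣ)
        (φ : (blockDatum hb).hU ≃* (brauerDatum hb hP.le).hU)
        (Φ : (blockDatum hb).Cbar ≃ₐ[O] (brauerDatum hb hP.le).Cbar),
      (∀ u, φ ((blockDatum hb).inl u) = (brauerDatum hb hP.le).inl (φ₁ u)) ∧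
      (∀ u, ((brauerDatum hb hP.le).deg (φ u) : H ⧸ K) = (blockDatum hb).deg u) ∧
      (∀ (h : 𝒜.stabH b) (n : 𝒜.normStab b P), ((h : H) : H ⧸ K) = ((n : H) : H ⧸ K) →
        ∀ u, φ ((blockDatum hb).actHU h u) = (brauerDatum hb hP.le).actHU n (φ u)) ∧
      -- the isomorphism is induced by an isomorphism of graded algebras
      (∀ u, ((brauerDatum hb hP.le).toUnit (φ u) : (brauerDatum hb hP.le).Cbar) =
        Φ ((blockDatum hb).toUnit u : (blockDatum hb).Cbar)) ∧
      (∀ σ ∈ blockGroup hb, ((blockDatum hb).CbarComp σ).map Φ.toLinearMap =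
        (brauerDatum hb hP.le).CbarComp σ) ∧
      (∀ (h : 𝒜.stabH b) (n : 𝒜.normStab b P), ((h : H) : H ⧸ K) = ((n : H) : H ⧸ K) →
        ∀ x, Φ ((blockDatum hb).actCbar h x) = (brauerDatum hb hP.le).actCbar n (Φ x))) ∧
    -- the monomorphism from the extension given by `R` into the extension given by `A(P)`
    (Function.Injective (centralizerMap K P) ∧
      (centralizerDatum hb hP.le).strong.map (centralizerMap K P) ≤ blockGroup hb ∧
      ∃ (ψ₁ : (centralizerDatum hb hP.le).Cbar₁ˣ →* (brauerDatum hb hP.le).Cbar₁ˣ)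
        (ψ : (centralizerDatum hb hP.le).hU →* (brauerDatum hb hP.le).hU)
        (Ψ : (centralizerDatum hb hP.le).Cbar →ₐ[O] (brauerDatum hb hP.le).Cbar),
      Function.Injective ψ₁ ∧ Function.Injective ψ ∧ Function.Injective Ψ ∧
      (∀ u, ψ ((centralizerDatum hb hP.le).inl u) = (brauerDatum hb hP.le).inl (ψ₁ u)) ∧
      (∀ u, ((brauerDatum hb hP.le).deg (ψ u) : H ⧸ K) =
        centralizerMap K P ((centralizerDatum hb hP.le).deg u)) ∧
      (∀ n n' : 𝒜.normStab b P, ((n : H) : H ⧸ K) = ((n' : H) : H ⧸ K) →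
        ∀ u, ψ ((centralizerDatum hb hP.le).actHU n u) =
          (brauerDatum hb hP.le).actHU n' (ψ u)) ∧
      -- the monomorphism is induced by a monomorphism of graded algebras
      (∀ u, ((brauerDatum hb hP.le).toUnit (ψ u) : (brauerDatum hb hP.le).Cbar) =
        Ψ ((centralizerDatum hb hP.le).toUnit u : (centralizerDatum hb hP.le).Cbar)) ∧
      (∀ τ ∈ (centralizerDatum hb hP.le).strong,
        ((centralizerDatum hb hP.le).CbarComp τ).map Ψ.toLinearMap ≤
          (brauerDatum hb hP.le).CbarComp (centralizerMap K P τ)) ∧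
      (∀ n n' : 𝒜.normStab b P, ((n : H) : H ⧸ K) = ((n' : H) : H ⧸ K) →
        ∀ x, Ψ ((centralizerDatum hb hP.le).actCbar n x) =
          (brauerDatum hb hP.le).actCbar n' (Ψ x))) := by
  -- Locality is obtained from primitivity of `b`, then for the Brauer quotient as an image, and
  -- last for `R` through the isomorphism of identity components.
  have hC : IsLocalRing (blockDatum hb).C₁ := hb.isLocalRing
  let t := brauerMorphism hb hP
  let s := centralizerMorphism hb hP
  have hE : IsLocalRing (brauerDatum hb hP.le).C₁ := t.isLocalRing_C₁
  have hD : IsLocalRing (centralizerDatum hb hP.le).C₁ := isLocalRing_centralizerDatum hb hP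
  let G := blockGrading hb
  let G' := brauerGrading hb hP.le
  let G'' := centralizerGrading hb hP.le
  have hstab : 𝒜.stabG b = 𝒜.normImage b P := stabG_eq_normImage hb hP
  have hstrong : blockGroup hb = brauerGroup hb hP.le := Subgroup.ext fun σ => t.mem_strong_iff.symm
  have hid : Function.Surjective t.onΓ := Function.surjective_id
  refine ⟨⟨G.isExtension, G''.isExtension, G'.isExtension⟩,
    ⟨hstab, ?_, normStab_eq_normStabBar hb hP⟩, ⟨hstrong, ?_⟩, ?_,
    centralizerMap_injective K P, ?_, ?_⟩
  · rw [← normStab_eq_normStabBar hb hP]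
    exact hstab
  -- Strong degrees lie in `G_b`, which is already the image of `N_H(P)_b`, so the intersection
  -- defining the third group changes nothing.
  · refine hstrong.trans (inf_eq_right.2 fun σ hσ => ?_).symm
    rw [← hstab]
    exact hσ.1
  · refine ⟨Units.mapEquiv (AlgEquiv.ofBijective t.onCbar₁ t.onCbar₁_bijective).toMulEquiv,
      MulEquiv.ofBijective t.onHU ⟨t.onHU_injective G G', t.onHU_surjective G G' hid⟩,
      AlgEquiv.ofBijective t.onCbar ⟨t.onCbar_injective G G', t.onCbar_surjective hid⟩,
      fun u => t.onHU_inl u, fun u => rfl,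
      fun h n hn u => (brauerMorphism_compatible hb hP h n hn).onHU u, fun u => rfl,
      fun σ hσ => t.map_CbarComp hσ,
      fun h n hn x => (brauerMorphism_compatible hb hP h n hn).onCbar x⟩
  · rw [hstrong]
    rintro _ ⟨τ, hτ, rfl⟩
    exact s.map_strong hτ
  · refine ⟨Units.map s.onCbar₁.toMonoidHom, s.onHU, s.onCbar,
      Units.map_injective s.onCbar₁_bijective.1, s.onHU_injective G'' G',
      s.onCbar_injective G'' G', s.onHU_inl, fun u => rfl,
      fun n n' hn u => (centralizerMorphism_compatible hb hP n n' hn).onHU u, fun u => rfl,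
      fun τ hτ => (s.map_CbarComp hτ).le,
      fun n n' hn x => (centralizerMorphism_compatible hb hP n n' hn).onCbar x⟩
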